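/- Conventions. Let $D^2$ be the closed unit disk, $N_{\mathrm{st}}=D^2\times S^1$ the solid torus; a meridian disk is a slice $D^2\times\{z\}$. Pairs of spaces are compared up to homeomorphism of pairs. A subset $\Sigma\subset S^3$ is a solenoid if it is homeomorphic to the inverse limit of a sequence of covering maps $\phi_n:S^1\to S^1$ $(n\ge 1)$ of degrees $w_n>1$. A thick braid of winding number $w$ is an embedding $e:N_{\mathrm{st}}\to \operatorname{int}N_{\mathrm{st}}$ which maps each meridian disk $D^2\times\{z\}$ into the meridian disk $D^2\times\{z^w\}$. A standard solenoid in $N_{\mathrm{st}}$ is a set $\bigcap_{n\ge0}N_n$, where $N_n=\psi_n(N_{\mathrm{st}})$, $\psi_0=\mathrm{id}$, $\psi_n=e_1\circ e_2\circ\cdots\circ e_n$, the $e_n$ are thick braids of winding numbers $w_n>1$, and the diameters of the meridian disks $\psi_n(D^2\times\{z\})$ of $N_n$ tend to $0$ as $n\to\infty$, uniformly in $z$. A subset $\Sigma\subset N_{\mathrm{st}}$ is tame in $N_{\mathrm{st}}$ if some homeomorphism of $N_{\mathrm{st}}$ maps it onto a standard solenoid. A solenoid $\Sigma\subset S^3$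 is tame if there is an embedding $\iota:N_{\mathrm{st}}\to S^3$ with $\Sigma=\iota(T)$ for some $T$ tame in $N_{\mathrm{st}}$. Let $C\subset D^2$ be a Cantor set. An orientation preserving homeomorphism $f:D^2\to D^2$ with $f(C)=C$ factors through nested disks if there are subsets $U_n\subset D^2$ $(n\ge0)$ with $U_{n+1}\subset\operatorname{int}U_n$ and $\bigcap_{n\ge0}U_n=C$, such that each $U_n$ is a non-empty finite disjoint union of closed $2$-disks which $f$ cyclically permutes (in a single cycle). The mapping torus of $f:(D^2,C)\to(D^2,C)$ is the pair $(T_f,T_{f|C})$, where $T_f=D^2\times[0,1]/\big((x,1)\sim(f(x),0)\big)$ and $T_{f|C}$ is the image of $C\times[0,1]$ in $T_f$. Theorem. A solenoid $\Sigma\subset S^3$ is tame if and only if $\Sigma$ has a neighbourhood $N\subset S^3$ such that the pair $(N,\Sigma)$ is homeomorphic to the mapping torus of a homeomorphism $f:(D^2,C)\to(D^2,C)$, for some Cantor set $C\subset D^2$, which factors through nested disks. -/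

import Mathlib

open Set Filter Topology

/-- The closed unit disk in the plane. -/
abbrev UnitDisk : Type := ↥(Metric.closedBall (0 : ℂ) 1)

/-- The unit 3-sphere in Euclidean 4-space. -/
abbrev Sphere3 : Type := ↥(Metric.sphere (0 : EuclideanSpace ℝ (Fin 4)) 1)

/-- The solid torus `D² × S¹`. -/
abbrev SolidTorus : Type := UnitDisk × Circle

/-- A self-map of the circle is continuous of degree `w`: it has a continuous lift to angles which
increases by `2πw` when the angle increases by `2π`. -/
def HasCircleDegree (φ : Circle → Circle) (w : ℤ) : Prop :=
  ∃ θ : ℝ → ℝ, Continuous θ ∧ (∀ t, φ (Circle.exp t) = Circle.exp (θ t)) ∧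
    ∀ t, θ (t + 2 * Real.pi) = θ t + 2 * Real.pi * w

/-- The inverse limit of a sequence `⋯ → X → X → X` of self-maps of a space. -/
def InverseLimit {X : Type} (φ : ℕ → X → X) : Set (ℕ → X) :=
  {x | ∀ n, x n = φ n (x (n + 1))}

/-- A subset of a space is a solenoid: in the subspace topology it is homeomorphic to the inverse
limit of a sequence of covering maps of the circle, all of degree greater than `1`. -/
def IsSolenoid {X : Type} [TopologicalSpace X] (S : Set X) : Prop :=
  ∃ (φ : ℕ → Circle → Circle) (w : ℕ → ℤ),
    (∀ n, 1 < w n ∧ IsCoveringMap (φ n) ∧ HasCircleDegree (φ n) (w n)) ∧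
      Nonempty (S ≃ₜ InverseLimit φ)

/-- The pairs `(X, A)` and `(Y, B)` are homeomorphic. -/
def PairHomeomorphic {X Y : Type} [TopologicalSpace X] [TopologicalSpace Y]
    (A : Set X) (B : Set Y) : Prop :=
  ∃ h : X ≃ₜ Y, h '' A = B

/-- A thick braid of winding number `w`: an embedding of the solid torus into its own interior
which maps meridian disks into meridian disks, covering `z ↦ z ^ w` on the circle factor. -/
structure IsThickBraid (e : SolidTorus → SolidTorus) (w : ℤ) : Prop where
  isEmbedding : IsEmbedding e
  mem_interior : ∀ p, ‖((e p).1 : ℂ)‖ < 1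
  fibre : ∀ p, (e p).2 = p.2 ^ w

/-- The composition `e 0 ∘ e 1 ∘ ⋯ ∘ e (n - 1)`. -/
def iteratedBraid (e : ℕ → SolidTorus → SolidTorus) : ℕ → SolidTorus → SolidTorus
  | 0 => id
  | n + 1 => iteratedBraid e n ∘ e n

/-- A standardly embedded solenoid in the solid torus: the intersection of a nested sequence of
solid tori `N n`, the images of iterated thick braids of winding numbers greater than `1`, where
the diameters of the meridian disks of `N n` tend to zero uniformly. -/
def IsStandardSolenoid (S : Set SolidTorus) : Prop :=
  ∃ (e : ℕ → SolidTorus → SolidTorus) (w : ℕ → ℤ),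
    (∀ n, 1 < w n ∧ IsThickBraid (e n) (w n)) ∧
    TendstoUniformly
      (fun n (z : Circle) ↦ Metric.diam (iteratedBraid e n '' {p : SolidTorus | p.2 = z}))
      (fun _ ↦ 0) atTop ∧
    S = ⋂ n, range (iteratedBraid e n)

/-- A tame solenoid in the solid torus. -/
def IsTameInSolidTorus (S : Set SolidTorus) : Prop :=
  ∃ S' : Set SolidTorus, IsStandardSolenoid S' ∧ PairHomeomorphic S S'

/-- A tame solenoid in the 3-sphere: the inclusion factors through an embedded solid torus in which
it is tame. -/
def IsTame (S : Set Sphere3) : Prop :=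
  ∃ (ι : SolidTorus → Sphere3) (T : Set SolidTorus),
    IsEmbedding ι ∧ IsTameInSolidTorus T ∧ ι '' T = S

/-- A subset that is a Cantor set in the subspace topology. -/
def IsCantorSet {X : Type} [TopologicalSpace X] (C : Set X) : Prop :=
  Nonempty (C ≃ₜ (ℕ → Bool))

/-- A subset that is a closed 2-disk in the subspace topology. -/
def IsTwoDisk {X : Type} [TopologicalSpace X] (d : Set X) : Prop :=
  Nonempty (d ≃ₜ UnitDisk)

/-- The inclusion of the boundary circle in the unit disk. -/
def boundaryCircle (z : Circle) : UnitDisk :=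
  ⟨(z : ℂ), mem_closedBall_zero_iff.mpr (Circle.norm_coe z).le⟩

/-- A homeomorphism of the disk is orientation preserving: it restricts to a map of degree `1` of
the boundary circle. -/
def IsOrientationPreserving (f : UnitDisk ≃ₜ UnitDisk) : Prop :=
  ∃ g : Circle → Circle, HasCircleDegree g 1 ∧ ∀ z, f (boundaryCircle z) = boundaryCircle (g z)

/-- `U` is a disjoint union of 2-disks `d i`, indexed by the integers modulo some `k ≥ 1`, which
`f` permutes cyclically. -/
def CyclicallyPermutesDisks (f : UnitDisk ≃ₜ UnitDisk) (U : Set UnitDisk) : Prop :=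
  ∃ (k : ℕ) (d : ZMod k → Set UnitDisk), 0 < k ∧ (∀ i, IsTwoDisk (d i)) ∧
    Pairwise (fun i j ↦ Disjoint (d i) (d j)) ∧ U = (⋃ i, d i) ∧ ∀ i, f '' d i = d (i + 1)

/-- The orientation preserving homeomorphism `f` of the pair `(D², C)` factors through nested
disks. The interior of `U n` is its interior as a subset of the plane. -/
def FactorsThroughNestedDisks (f : UnitDisk ≃ₜ UnitDisk) (C : Set UnitDisk) : Prop :=
  IsOrientationPreserving f ∧ ∃ U : ℕ → Set UnitDisk,
    (∀ n, ∀ x ∈ U (n + 1), (x : ℂ) ∈ interior ((↑) '' U n : Set ℂ)) ∧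
    (⋂ n, U n) = C ∧ ∀ n, CyclicallyPermutesDisks f (U n)

/-- The mapping torus `D² × [0,1] / (x, 1) ∼ (f x, 0)`, with the quotient topology. -/
def MappingTorus (f : UnitDisk ≃ₜ UnitDisk) : Type :=
  Quot fun p q : UnitDisk × unitInterval ↦ p.2 = 1 ∧ q.2 = 0 ∧ q.1 = f p.1

instance instTopologicalSpaceMappingTorus (f : UnitDisk ≃ₜ UnitDisk) :
    TopologicalSpace (MappingTorus f) :=
  inferInstanceAs (TopologicalSpace (Quot _))

/-- The image of `C × [0,1]` in the mapping torus of `f`. -/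
def mappingTorusOf (f : UnitDisk ≃ₜ UnitDisk) (C : Set UnitDisk) : Set (MappingTorus f) :=
  (fun p : UnitDisk × unitInterval ↦ (Quot.mk _ p : MappingTorus f)) '' (C ×ˢ univ)

/-!
A tame solenoid and a neighbourhood of it form a mapping torus because a nested sequence of braided
solid tori can be straightened, all generations at once, by an isotopy of the meridian disk.

*From mapping tori to tame solenoids.* An orientation preserving homeomorphism `f` of the disk is
isotopic to the identity (`IsOrientationPreserving.exists_isotopy`: the boundary map is isotoped
radially, and the Alexander trick does the rest). An isotopy identifies the mapping torus of `f`
with the solid torus (`exists_homeomorph_mappingTorus`), so it remains to see that the suspension of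
`C` is standard. The disks of the `n`-th nested family sweep out a subset of the solid torus, which
is parametrized as a solid torus by straightening the first return map of one of the disks
(`exists_swept_torus`). This return map preserves the orientation by
`isOrientationPreserving_of_isotopy`: the winding number of an embedded boundary circle about the
image of the center is odd, hence not zero, and it is invariant under the isotopy. A subsequence of
the families with strictly increasing numbers of disks (`NestedCycles`) gives thick braids of
winding numbers greater than `1`, and the disks shrink because `C` is totally disconnected.

*From tame solenoids to mapping tori.* Neither the Schoenflies theorem nor the annulus theorem is
needed. A thick braid is shrunk to one whose motion through the meridian disks extends to an
isotopy of the disk, fixed on the boundary (`IsThickBraid.exists_extendable`): up to homeomorphisms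
supported in the given braid, the smaller braid consists of round disks moving by translations, and
these are carried along by pushing isotopies. The shrunk braids interleave with the given ones, so
they define the same solenoid (`IsStandardSolenoid.exists_extendable`). Then the isotopies for the
single braids are glued: the isotopy for the remaining sequence of braids is transported into the
disks of the first braid, one `w`-th of it being performed in each of the `w` disks
(`exists_glued_isotopies`). As the disks shrink, the isotopies converge together with their inverses
(`exists_isotopy_of_braids`). The limit isotopy moves the disks of every generation around, and its
time-one map permutes them cyclically. The Cantor set is recognized by Brouwer's
characterization (`nonempty_homeomorph_nat_bool`).

*Invariance of domain.* Both directions need that embedded disks and solid tori have interior in the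
plane, in the product of the plane with the line of times, and in the 3-sphere. Invariance of domain
in dimension 3 (`isOpen_image_of_injOn`) is deduced from Brouwer's fixed point theorem, which
follows from the nonexistence of smooth retractions of the ball onto the sphere
(`no_smooth_retraction`): for a retraction `x + g x`, the integral of `det (1 + t g')` over the ball
is a polynomial in `t`, equal to the volume of the ball for small `t`, but it vanishes at `t = 1`.
-/


/-! ### Brouwer's theorem and invariance of domain in dimension three -/

/-- Euclidean space of dimension three. -/
abbrev Space3 : Type := EuclideanSpace ℝ (Fin 3)

lemma exists_norm_eq_one_dist (x : Space3) (hx : ‖x‖ ≤ 1) :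
    ∃ z : Space3, ‖z‖ = 1 ∧ ‖x - z‖ = 1 - ‖x‖ := by
  by_cases h0 : x = 0
  · obtain ⟨z, hz⟩ := exists_norm_eq Space3 (zero_le_one (α := ℝ))
    exact ⟨z, hz, by simp [h0, hz]⟩
  · have hn : ‖x‖ ≠ 0 := norm_ne_zero_iff.mpr h0
    refine ⟨‖x‖⁻¹ • x, by rw [norm_smul]; simp [hn], ?_⟩
    have : x - ‖x‖⁻¹ • x = (1 - ‖x‖⁻¹) • x := by rw [sub_smul, one_smul]
    have h1 : 1 ≤ ‖x‖⁻¹ := (one_le_inv₀ (norm_pos_iff.mpr h0)).mpr hx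
    rw [this, norm_smul, Real.norm_eq_abs, abs_of_nonpos (by linarith)]
    field_simp
    ring

/-- Extending by zero a Lipschitz map on the ball which vanishes on the sphere gives a Lipschitz
map. -/
lemma lipschitzWith_extend_by_zero {g : Space3 → Space3} {L : NNReal}
    (hg : LipschitzOnWith L g (Metric.closedBall 0 1)) (h0 : ∀ x, ‖x‖ = 1 → g x = 0) :
    LipschitzWith L (fun x : Space3 ↦ if ‖x‖ ≤ 1 then g x else 0) := by
  have key : ∀ x y : Space3, ‖x‖ ≤ 1 → ¬ ‖y‖ ≤ 1 → ‖g x‖ ≤ L * ‖x - y‖ := by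
    intro x y hx hy
    obtain ⟨z, hz, hxz⟩ := exists_norm_eq_one_dist x hx
    have h1 := hg.dist_le_mul x (by simpa using hx) z (by simp [hz])
    rw [h0 z hz, dist_zero_right, dist_eq_norm, hxz] at h1
    refine h1.trans (mul_le_mul_of_nonneg_left ?_ L.2)
    have := norm_sub_norm_le y x
    rw [norm_sub_rev] at this
    linarith
  refine LipschitzWith.of_dist_le_mul fun x y ↦ ?_
  beta_reduce
  split_ifs with hx hy hy
  · exact hg.dist_le_mul x (by simpa using hx) y (by simpa using hy)
  · simpa [dist_eq_norm] using key x y hx hy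
  · have := key y x hy hx
    rw [norm_sub_rev] at this
    simpa [dist_eq_norm] using this
  · simp; positivity

lemma det_one_add_smul_fin_three (M : Matrix (Fin 3) (Fin 3) ℝ) (t : ℝ) :
    (1 + t • M).det = 1 + t * (M 0 0 + M 1 1 + M 2 2)
      + t ^ 2 * ((M 0 0 * M 1 1 - M 0 1 * M 1 0) + (M 0 0 * M 2 2 - M 0 2 * M 2 0)
        + (M 1 1 * M 2 2 - M 1 2 * M 2 1)) + t ^ 3 * M.det := by
  simp [Matrix.det_fin_three]
  ring

/-- The determinant of `1 + t A` is a cubic polynomial in `t`; Lagrange interpolation at the nodes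
`0, τ, 2τ, 3τ` expresses its value at `1`. -/
lemma det_interpolation (τ : ℝ) (hτ : 0 < τ) : ∃ a b c d : ℝ, a + b + c + d = 1 ∧
    ∀ A : Space3 →L[ℝ] Space3, (1 + A).det = a + b * (1 + τ • A).det
      + c * (1 + (2 * τ) • A).det + d * (1 + (3 * τ) • A).det := by
  have hdet : ∀ (A : Space3 →L[ℝ] Space3), ∃ p q r : ℝ, ∀ t : ℝ,
      (1 + t • A).det = 1 + t * p + t ^ 2 * q + t ^ 3 * r := by
    intro A
    let b := (EuclideanSpace.basisFun (Fin 3) ℝ).toBasis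
    let M := LinearMap.toMatrix b b (A : Space3 →ₗ[ℝ] Space3)
    refine ⟨_, _, _, fun t ↦ Eq.trans ?_ (det_one_add_smul_fin_three M t)⟩
    have : (1 + t • M) = LinearMap.toMatrix b b
        ((1 + t • A : Space3 →L[ℝ] Space3) : Space3 →ₗ[ℝ] Space3) := by
      have h1 : ((1 + t • A : Space3 →L[ℝ] Space3) : Space3 →ₗ[ℝ] Space3) =
          LinearMap.id + t • (A : Space3 →ₗ[ℝ] Space3) := by
        ext; simp
      rw [h1, map_add, map_smul, LinearMap.toMatrix_id]
    rw [this, LinearMap.det_toMatrix]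
  -- the Lagrange basis polynomials for the nodes, evaluated at `1`
  refine ⟨(1 - τ) * (1 - 2 * τ) * (1 - 3 * τ) / (-6 * τ ^ 3),
    (1 - 2 * τ) * (1 - 3 * τ) / (2 * τ ^ 3),
    (1 - τ) * (1 - 3 * τ) / (-2 * τ ^ 3), (1 - τ) * (1 - 2 * τ) / (6 * τ ^ 3), ?_, fun A ↦ ?_⟩
  · field_simp
    ring
  · obtain ⟨p, q, r, h⟩ := hdet A
    have h1 := h 1
    rw [one_smul] at h1
    rw [h1, h τ, h (2 * τ), h (3 * τ)]
    field_simp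
    ring

/-- There is no differentiable retraction of the ball onto its boundary sphere. For a retraction
`x + g x`, the volume of the ball is `∫ det (1 + t • g' x)` for small `t`, hence for all `t` because
this is polynomial in `t`; but the integrand vanishes at `t = 1`. -/
theorem no_smooth_retraction (g : Space3 → Space3) (g' : Space3 → Space3 →L[ℝ] Space3)
    (hg : ∀ x ∈ Metric.closedBall (0 : Space3) 1, HasFDerivAt g (g' x) x)
    (hc : ContinuousOn g' (Metric.closedBall 0 1)) (h0 : ∀ x, ‖x‖ = 1 → g x = 0)
    (h1 : ∀ x, ‖x‖ ≤ 1 → ‖x + g x‖ = 1) : False := by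
  have hB : IsCompact (Metric.closedBall (0 : Space3) 1) := isCompact_closedBall 0 1
  obtain ⟨L, hL⟩ : ∃ L : NNReal, ∀ x ∈ Metric.closedBall (0 : Space3) 1, ‖g' x‖₊ ≤ L := by
    obtain ⟨C, hC⟩ := hB.exists_bound_of_continuousOn hc
    refine ⟨C.toNNReal, fun x hx ↦ ?_⟩
    rw [← NNReal.coe_le_coe]
    exact (hC x hx).trans (Real.le_coe_toNNReal C)
  have hlip : LipschitzOnWith L g (Metric.closedBall 0 1) :=
    (convex_closedBall 0 1).lipschitzOnWith_of_nnnorm_hasFDerivWithin_le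
      (fun x hx ↦ (hg x hx).hasFDerivWithinAt) hL
  have hext := lipschitzWith_extend_by_zero hlip h0
  set G := fun x : Space3 ↦ if ‖x‖ ≤ 1 then g x else 0 with hG
  have hGout : ∀ x, 1 ≤ ‖x‖ → G x = 0 := by
    intro x hx
    by_cases h : ‖x‖ = 1
    · simp [hG, h0 x h]
    · simp only [hG]
      rw [if_neg]
      exact fun h' ↦ h (le_antisymm h' hx)
  have hGin : ∀ x, ‖x‖ ≤ 1 → G x = g x := by
    intro x hx
    simp [hG, hx]
  -- small multiples of `G` are perturbations of the identity by contractions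
  have hvol : ∀ t : ℝ, 0 ≤ t → t * L < 1 → (fun x ↦ x + t • G x) '' Metric.ball (0 : Space3) 1 =
      Metric.ball 0 1 ∧ InjOn (fun x ↦ x + t • G x) (Metric.ball (0 : Space3) 1) := by
    intro t ht htL
    have happ : ApproximatesLinearOn (fun x ↦ x + t • G x)
        ((ContinuousLinearEquiv.refl ℝ Space3 : Space3 ≃L[ℝ] Space3) : Space3 →L[ℝ] Space3) univ
        (t.toNNReal * L) := by
      intro x _ y _
      have h2 := hext.dist_le_mul x y
      simp only [ContinuousLinearEquiv.coe_coe, ContinuousLinearEquiv.refl_apply,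
        NNReal.coe_mul, Real.coe_toNNReal t ht]
      rw [dist_eq_norm, dist_eq_norm] at h2
      have h3 : x + t • G x - (y + t • G y) - (x - y) = t • (G x - G y) := by
        rw [smul_sub]; abel
      rw [h3, norm_smul, Real.norm_eq_abs, abs_of_nonneg ht, mul_assoc]
      exact mul_le_mul_of_nonneg_left h2 ht
    have hlt : Subsingleton Space3 ∨ t.toNNReal * L < ‖((ContinuousLinearEquiv.refl ℝ Space3).symm :
        Space3 →L[ℝ] Space3)‖₊⁻¹ := by
      right
      have : ‖((ContinuousLinearEquiv.refl ℝ Space3).symm : Space3 →L[ℝ] Space3)‖₊ = 1 := by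
        simp
      rw [this, inv_one, ← NNReal.coe_lt_coe]
      simpa [Real.coe_toNNReal t ht] using htL
    have hbij : Function.Bijective (fun x ↦ x + t • G x) :=
      (happ.toHomeomorph _ hlt).bijective
    refine ⟨?_, hbij.1.injOn⟩
    ext y
    simp only [mem_image, mem_ball_zero_iff]
    constructor
    · rintro ⟨x, hx, rfl⟩
      by_contra hy
      have h3 := hGout _ (not_lt.mp hy)
      have h4 : x + t • G x = x := hbij.1 (by simp only []; rw [h3]; simp)
      rw [h4] at hy
      exact hy hx
    · intro hy
      obtain ⟨x, hx⟩ := hbij.2 y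
      refine ⟨x, ?_, hx⟩
      by_contra hx'
      have h3 := hGout _ (not_lt.mp hx')
      simp only [h3, smul_zero, add_zero] at hx
      exact hx' (hx ▸ hy)
  obtain ⟨δ, hδ, hdetpos⟩ : ∃ δ > 0, ∀ A : Space3 →L[ℝ] Space3, ‖A‖ < δ → 0 < (1 + A).det := by
    have hcont : Continuous fun A : Space3 →L[ℝ] Space3 ↦ (1 + A).det :=
      ContinuousLinearMap.continuous_det.comp (by fun_prop)
    have h3 : ∀ᶠ A in 𝓝 (0 : Space3 →L[ℝ] Space3), 0 < (1 + A).det := by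
      refine continuousAt_const.eventually_lt hcont.continuousAt ?_
      have : (1 + (0 : Space3 →L[ℝ] Space3)).det = 1 := by
        rw [add_zero]
        exact LinearMap.det_id
      rw [this]
      exact one_pos
    obtain ⟨δ, hδ, h⟩ := Metric.eventually_nhds_iff.mp h3
    exact ⟨δ, hδ, fun A hA ↦ h (by simpa using hA)⟩
  have hsub : Metric.ball (0 : Space3) 1 ⊆ Metric.closedBall 0 1 := Metric.ball_subset_closedBall
  set V := (MeasureTheory.volume (Metric.ball (0 : Space3) 1)).toReal with hVdef
  have hdcont : ∀ t : ℝ, ContinuousOn (fun x ↦ (1 + t • g' x).det) (Metric.closedBall 0 1) := by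
    intro t
    exact ContinuousLinearMap.continuous_det.comp_continuousOn (by fun_prop)
  have hint : ∀ t : ℝ, MeasureTheory.IntegrableOn (fun x ↦ (1 + t • g' x).det)
      (Metric.ball 0 1) := fun t ↦
    ((hdcont t).integrableOn_compact hB).mono_set hsub
  have hsmall : ∀ t : ℝ, 0 ≤ t → t * L < 1 → t * L < δ →
      ∫ x in Metric.ball (0 : Space3) 1, (1 + t • g' x).det = V := by
    intro t ht htL htδ
    obtain ⟨him, hinj⟩ := hvol t ht htL
    have hder : ∀ x ∈ Metric.ball (0 : Space3) 1, HasFDerivWithinAt (fun x ↦ x + t • G x)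
        (1 + t • g' x) (Metric.ball 0 1) x := by
      intro x hx
      have h3 : HasFDerivWithinAt (fun x ↦ x + t • g x) (1 + t • g' x) (Metric.ball 0 1) x :=
        ((hasFDerivAt_id x).add ((hg x (hsub hx)).const_smul t)).hasFDerivWithinAt
      refine h3.congr (fun y hy ↦ ?_) ?_
      · rw [hGin y (by simpa using hsub hy)]
      · rw [hGin x (by simpa using hsub hx)]
    have h3 := MeasureTheory.integral_image_eq_integral_abs_det_fderiv_smul MeasureTheory.volume
      measurableSet_ball hder hinj (fun _ ↦ (1 : ℝ))
    rw [him] at h3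
    simp only [MeasureTheory.setIntegral_const, smul_eq_mul, mul_one] at h3
    rw [hVdef, ← MeasureTheory.measureReal_def, h3]
    refine MeasureTheory.setIntegral_congr_fun measurableSet_ball fun x hx ↦ ?_
    refine (abs_of_pos (hdetpos _ ?_)).symm
    rw [norm_smul, Real.norm_eq_abs, abs_of_nonneg ht]
    exact (mul_le_mul_of_nonneg_left (NNReal.coe_le_coe.mpr (hL x (hsub hx))) ht).trans_lt htδ
  obtain ⟨τ, hτ, hτ1, hτ2⟩ : ∃ τ : ℝ, 0 < τ ∧ 3 * τ * L < 1 ∧ 3 * τ * L < δ := by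
    refine ⟨min 1 δ / (6 * (L + 1)), by positivity, ?_⟩
    have hL0 : (0 : ℝ) ≤ L := L.2
    have : 3 * (min 1 δ / (6 * ((L : ℝ) + 1))) * L = min 1 δ * (L / (2 * (L + 1))) := by
      field_simp
      ring
    rw [this]
    have h4 : (L : ℝ) / (2 * (L + 1)) < 1 := by
      rw [div_lt_one (by positivity)]
      linarith
    have h5 : 0 < min 1 δ := by positivity
    have h6 : min 1 δ * ((L : ℝ) / (2 * (L + 1))) < min 1 δ := by nlinarith
    exact ⟨h6.trans_le (min_le_left _ _), h6.trans_le (min_le_right _ _)⟩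
  obtain ⟨a, b, c, d, habcd, hlag⟩ := det_interpolation τ hτ
  have hτL : 0 ≤ τ * L := by positivity
  have hi1 := hsmall τ hτ.le (by nlinarith) (by nlinarith)
  have hi2 := hsmall (2 * τ) (by positivity) (by nlinarith) (by nlinarith)
  have hi3 := hsmall (3 * τ) (by positivity) hτ1 hτ2
  have hone : ∫ x in Metric.ball (0 : Space3) 1, (1 + g' x).det = V := by
    rw [MeasureTheory.integral_congr_ae (Eventually.of_forall fun x ↦ hlag (g' x))]
    have hfin : MeasureTheory.volume (Metric.ball (0 : Space3) 1) ≠ ⊤ :=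
      MeasureTheory.measure_ball_lt_top.ne
    have hca : MeasureTheory.IntegrableOn (fun _ : Space3 ↦ a) (Metric.ball (0 : Space3) 1) :=
      MeasureTheory.integrableOn_const hfin
    rw [MeasureTheory.integral_add, MeasureTheory.integral_add, MeasureTheory.integral_add,
      MeasureTheory.integral_const_mul, MeasureTheory.integral_const_mul,
      MeasureTheory.integral_const_mul, hi1, hi2, hi3, MeasureTheory.setIntegral_const,
      MeasureTheory.measureReal_def, ← hVdef, smul_eq_mul]
    · linear_combination V * habcd
    · exact hca
    · exact (hint τ).const_mul b
    · exact hca.add ((hint τ).const_mul b)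
    · exact (hint (2 * τ)).const_mul c
    · exact (hca.add ((hint τ).const_mul b)).add ((hint (2 * τ)).const_mul c)
    · exact (hint (3 * τ)).const_mul d
  have hzero : ∀ x ∈ Metric.ball (0 : Space3) 1, (1 + g' x).det = 0 := by
    intro x hx
    by_contra hne
    have hder : HasFDerivAt (fun x ↦ x + g x) (1 + g' x) x :=
      (hasFDerivAt_id x).add (hg x (hsub hx))
    have hns : HasFDerivAt (fun x ↦ ‖x + g x‖ ^ 2) (2 • (innerSL ℝ (x + g x)).comp (1 + g' x)) x :=
      hder.norm_sq
    have hconst : HasFDerivAt (fun x ↦ ‖x + g x‖ ^ 2) (0 : Space3 →L[ℝ] ℝ) x := by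
      refine (hasFDerivAt_const (1 : ℝ) x).congr_of_eventuallyEq ?_
      filter_upwards [Metric.isOpen_ball.mem_nhds hx] with y hy
      rw [h1 y (by simpa using hsub hy)]
      norm_num
    have heq := hns.unique hconst
    have hu : IsUnit (((1 + g' x : Space3 →L[ℝ] Space3) : Space3 →ₗ[ℝ] Space3).det) :=
      isUnit_iff_ne_zero.mpr hne
    obtain ⟨v, hv⟩ := (LinearMap.equivOfIsUnitDet hu).surjective (x + g x)
    have hv' : (1 + g' x) v = x + g x := by
      rw [← hv]; exact (LinearMap.equivOfIsUnitDet_apply hu v).symm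
    have h3 := congrArg (fun A : Space3 →L[ℝ] ℝ ↦ A v) heq
    simp only [_root_.smul_apply, ContinuousLinearMap.comp_apply, hv',
      innerSL_apply_apply, real_inner_self_eq_norm_sq, h1 x (by simpa using hsub hx)] at h3
    norm_num at h3
  have hV0 : V = 0 := by
    rw [← hone, MeasureTheory.setIntegral_congr_fun measurableSet_ball
      (g := fun _ ↦ (0 : ℝ)) hzero]
    simp
  have hVpos : 0 < V := ENNReal.toReal_pos
    (Metric.measure_ball_pos MeasureTheory.volume _ one_pos).ne'
    MeasureTheory.measure_ball_lt_top.ne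
  exact hVpos.ne' hV0

/-- Radial projection of a normed space onto its closed unit ball. -/
noncomputable def ballProj {E : Type*} [NormedAddCommGroup E] [NormedSpace ℝ E] (x : E) : E :=
  (max 1 ‖x‖)⁻¹ • x

section ballProj

variable {E : Type*} [NormedAddCommGroup E] [NormedSpace ℝ E]

lemma continuous_ballProj : Continuous (ballProj : E → E) := by
  unfold ballProj
  refine Continuous.smul (Continuous.inv₀ (by fun_prop) fun x ↦ ?_) continuous_id
  have : (1 : ℝ) ≤ max 1 ‖x‖ := le_max_left _ _
  positivity

lemma norm_ballProj_le (x : E) : ‖ballProj x‖ ≤ 1 := by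
  have h : 0 < max 1 ‖x‖ := lt_of_lt_of_le one_pos (le_max_left _ _)
  rw [ballProj, norm_smul, norm_inv, Real.norm_eq_abs, abs_of_pos h, inv_mul_le_one₀ h]
  exact le_max_right _ _

lemma ballProj_of_norm_le {x : E} (hx : ‖x‖ ≤ 1) : ballProj x = x := by
  rw [ballProj, max_eq_left hx, inv_one, one_smul]

end ballProj

/-- A `C¹` self-map of the ball with values in the open ball has a fixed point: otherwise the ray
from `h x` through `x` meets the sphere in a point depending differentiably on `x`. -/
lemma exists_fixedPoint_of_contDiff (h : Space3 → Space3) (hh : ContDiff ℝ 1 h)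
    (hlt : ∀ x, ‖x‖ ≤ 1 → ‖h x‖ < 1) : ∃ x, ‖x‖ ≤ 1 ∧ h x = x := by
  by_contra! hne
  -- `x + s • (x - h x)` lies on the sphere iff `a s² + 2 b s = 1 - ‖x‖²`
  let u : Space3 → Space3 := fun x ↦ x - h x
  let a : Space3 → ℝ := fun x ↦ inner ℝ (u x) (u x)
  let b : Space3 → ℝ := fun x ↦ inner ℝ x (u x)
  let disc : Space3 → ℝ := fun x ↦ b x ^ 2 + a x * (1 - ‖x‖ ^ 2)
  let s : Space3 → ℝ := fun x ↦ (-b x + √(disc x)) / a x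
  let g : Space3 → Space3 := fun x ↦ s x • u x
  have ha : ∀ x, ‖x‖ ≤ 1 → 0 < a x := fun x hx ↦
    real_inner_self_pos.mpr (sub_ne_zero.mpr (hne x hx).symm)
  have hb : ∀ x, ‖x‖ = 1 → 0 < b x := by
    intro x hx
    have h1 : inner ℝ x (h x) ≤ ‖x‖ * ‖h x‖ := real_inner_le_norm x (h x)
    have h2 : b x = 1 - inner ℝ x (h x) := by
      simp only [b, u, inner_sub_right, real_inner_self_eq_norm_sq, hx]
      norm_num
    have h3 := hlt x hx.le
    rw [hx, one_mul] at h1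
    linarith
  have hd : ∀ x, ‖x‖ ≤ 1 → 0 < disc x := by
    intro x hx
    rcases hx.lt_or_eq with h1 | h1
    · have h2 : 0 < 1 - ‖x‖ ^ 2 := by nlinarith [norm_nonneg x]
      have := mul_pos (ha x hx) h2
      have := sq_nonneg (b x)
      simp only [disc]
      linarith
    · have := hb x h1
      simp only [disc, h1]
      norm_num
      positivity
  have hg : ∀ x, ‖x‖ ≤ 1 → ContDiffAt ℝ 1 g x := by
    intro x hx
    have hu : ContDiffAt ℝ 1 u x := contDiffAt_id.sub hh.contDiffAt
    have haC : ContDiffAt ℝ 1 a x := hu.inner ℝ hu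
    have hbC : ContDiffAt ℝ 1 b x := contDiffAt_id.inner ℝ hu
    have hdC : ContDiffAt ℝ 1 disc x :=
      (hbC.pow 2).add (haC.mul (contDiffAt_const.sub (contDiffAt_id.norm_sq ℝ)))
    exact ((hbC.neg.add (hdC.sqrt (hd x hx).ne')).div haC (ha x hx).ne').smul hu
  refine no_smooth_retraction g (fderiv ℝ g) (fun x hx ↦ ?_) (fun x hx ↦ ?_) (fun x hx ↦ ?_)
    fun x hx ↦ ?_
  · exact ((hg x (by simpa using hx)).differentiableAt (by norm_num)).hasFDerivAt
  · exact ((hg x (by simpa using hx)).fderiv_right (m := 0) 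
      (by norm_num)).continuousAt.continuousWithinAt
  · have h1 : s x = 0 := by
      simp only [s, disc, hx]
      norm_num
      left
      rw [Real.sqrt_sq (hb x hx).le]
      ring
    simp only [g, h1, zero_smul]
  · have h1 : a x * s x ^ 2 + 2 * b x * s x = 1 - ‖x‖ ^ 2 := by
      have h2 := Real.sq_sqrt (hd x hx).le
      have h3 := (ha x hx).ne'
      simp only [s]
      field_simp
      linear_combination h2
    have h2 : ‖x + g x‖ ^ 2 = 1 := by
      rw [norm_add_sq_real]
      simp only [g, inner_smul_right, norm_smul, mul_pow, Real.norm_eq_abs, sq_abs]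
      have h3 : a x = ‖u x‖ ^ 2 := real_inner_self_eq_norm_sq _
      rw [← h3]
      change ‖x‖ ^ 2 + 2 * (s x * b x) + s x ^ 2 * a x = 1
      linarith
    exact (pow_eq_one_iff_of_nonneg (norm_nonneg _) two_ne_zero).mp h2

/-- Brouwer's fixed point theorem in dimension three. -/
theorem exists_fixedPoint_closedBall (h : Space3 → Space3)
    (hh : ContinuousOn h (Metric.closedBall 0 1)) (hle : ∀ x, ‖x‖ ≤ 1 → ‖h x‖ ≤ 1) :
    ∃ x, ‖x‖ ≤ 1 ∧ h x = x := by
  by_contra! hne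
  have hB : IsCompact (Metric.closedBall (0 : Space3) 1) := isCompact_closedBall 0 1
  obtain ⟨μ, hμ, hμle⟩ : ∃ μ > 0, ∀ x : Space3, ‖x‖ ≤ 1 → μ ≤ ‖h x - x‖ := by
    obtain ⟨x₀, hx₀, hmin⟩ := hB.exists_isMinOn ⟨0, by simp⟩
      (f := fun x ↦ ‖h x - x‖) (by fun_prop)
    refine ⟨‖h x₀ - x₀‖, norm_pos_iff.mpr (sub_ne_zero.mpr (hne x₀ (by simpa using hx₀))),
      fun x hx ↦ hmin (by simpa using hx)⟩
  have hcont : Continuous fun x ↦ h (ballProj x) :=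
    hh.comp_continuous continuous_ballProj fun x ↦ by simpa using norm_ballProj_le x
  obtain ⟨h₁, hC, happ, -⟩ := hcont.exists_contDiff_approx 1 (ε := fun _ ↦ μ / 4)
    continuous_const fun _ ↦ by positivity
  have happ' : ∀ x, ‖x‖ ≤ 1 → ‖h₁ x - h x‖ < μ / 4 := by
    intro x hx
    have := happ x
    rwa [dist_eq_norm, ballProj_of_norm_le hx] at this
  set c := (1 + μ / 4)⁻¹ with hc
  have hc0 : 0 < c := by positivity
  have hcmul : c * (1 + μ / 4) = 1 := inv_mul_cancel₀ (by positivity)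
  have hn : ∀ x, ‖x‖ ≤ 1 → ‖h₁ x‖ < 1 + μ / 4 := by
    intro x hx
    have h1 := norm_sub_norm_le (h₁ x) (h x)
    linarith [happ' x hx, hle x hx]
  obtain ⟨x, hx, hfix⟩ := exists_fixedPoint_of_contDiff (fun x ↦ c • h₁ x) (hC.const_smul c) (by
    intro x hx
    rw [norm_smul, Real.norm_eq_abs, abs_of_pos hc0, ← hcmul]
    exact mul_lt_mul_of_pos_left (hn x hx) hc0)
  have h1 : ‖h₁ x - x‖ ≤ μ / 4 := by
    have h2 : h₁ x = (1 + μ / 4) • x := by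
      conv_rhs => rw [← hfix, smul_smul, mul_comm, hcmul, one_smul]
    have h3 : h₁ x - x = (μ / 4) • x := by rw [h2, add_smul, one_smul]; abel
    rw [h3, norm_smul, Real.norm_eq_abs, abs_of_pos (by positivity)]
    nlinarith
  have h2 := hμle x hx
  have h3 := norm_sub_le_norm_sub_add_norm_sub (h x) (h₁ x) x
  rw [norm_sub_rev (h x) (h₁ x)] at h3
  linarith [happ' x hx]

/-- An injective continuous map of the ball sends the centre to an interior point of the image. If
not, a continuous left inverse could be perturbed to a nearby map without zeros on the image,
contradicting Brouwer's theorem. -/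
theorem mem_interior_image_closedBall (f : Space3 → Space3)
    (hf : ContinuousOn f (Metric.closedBall 0 1)) (hinj : InjOn f (Metric.closedBall 0 1)) :
    f 0 ∈ interior (f '' Metric.closedBall 0 1) := by
  by_contra hint
  have hB : IsCompact (Metric.closedBall (0 : Space3) 1) := isCompact_closedBall 0 1
  set K := f '' Metric.closedBall (0 : Space3) 1 with hK
  have hKc : IsCompact K := hB.image_of_continuousOn hf
  obtain ⟨G, hG⟩ : ∃ G : C(Space3, Space3), ∀ x, ‖x‖ ≤ 1 → G (f x) = x := by
    have : CompactSpace (Metric.closedBall (0 : Space3) 1) := isCompact_iff_compactSpace.mp hB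
    let φ : Metric.closedBall (0 : Space3) 1 → Space3 := fun x ↦ f x
    have hφ : IsClosedEmbedding φ :=
      (continuousOn_iff_continuous_domRestrict.mp hf).isClosedEmbedding fun x y hxy ↦ Subtype.ext
        (hinj x.2 y.2 hxy)
    obtain ⟨G, hG⟩ := ContinuousMap.exists_extension hφ
      (⟨fun x ↦ (x : Space3), continuous_subtype_val⟩ : C(Metric.closedBall (0 : Space3) 1, Space3))
    refine ⟨G, fun x hx ↦ ?_⟩
    exact DFunLike.congr_fun hG ⟨x, by simpa using hx⟩
  have hzero : ∀ H : Space3 → Space3, ContinuousOn H K → (∀ y ∈ K, ‖H y - G y‖ ≤ 1) →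
      ∃ y ∈ K, H y = 0 := by
    intro H hH hle
    obtain ⟨x, hx, hfix⟩ := exists_fixedPoint_closedBall (fun x ↦ x - H (f x))
      (continuousOn_id.sub (hH.comp hf (mapsTo_image _ _))) (fun x hx ↦ by
        have := hle (f x) (mem_image_of_mem _ (by simpa using hx))
        rwa [hG x hx, norm_sub_rev] at this)
    exact ⟨f x, mem_image_of_mem _ (by simpa using hx), by simpa using hfix⟩
  have hG0 : G (f 0) = 0 := hG 0 (by simp)
  obtain ⟨ε, hε, hGε⟩ : ∃ ε > 0, ∀ y, ‖y - f 0‖ < 2 * ε → ‖G y‖ < 1 / 10 := by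
    obtain ⟨ε, hε, h⟩ := Metric.continuousAt_iff.mp (G.continuous.continuousAt (x := f 0)) (1 / 10)
      (by norm_num)
    refine ⟨ε / 2, by positivity, fun y hy ↦ ?_⟩
    have := h (x := y) (by rw [dist_eq_norm]; linarith)
    rwa [hG0, dist_zero_right] at this
  obtain ⟨c, hcK, hcε⟩ : ∃ c, c ∉ K ∧ ‖c - f 0‖ < ε := by
    by_contra! hcon
    refine hint (mem_interior_iff_mem_nhds.mpr (Metric.mem_nhds_iff.mpr ⟨ε, hε, fun y hy ↦ ?_⟩))
    by_contra hy'
    exact (hcon y hy').not_gt (by simpa [dist_eq_norm] using hy)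
  set T := K ∩ {y | ε ≤ ‖y - c‖} with hT
  have hTc : IsCompact T := hKc.inter_right (isClosed_le continuous_const (by fun_prop))
  have hTG : ∀ y ∈ T, G y ≠ 0 := by
    rintro y ⟨⟨x, hx, rfl⟩, hy⟩ h0
    rw [hG x (by simpa using hx)] at h0
    rw [h0, mem_ofPred_eq, norm_sub_rev] at hy
    exact hy.not_gt hcε
  obtain ⟨δ, hδ, hδ1, hδT⟩ : ∃ δ > 0, δ ≤ 1 / 10 ∧ ∀ y ∈ T, δ ≤ ‖G y‖ := by
    rcases T.eq_empty_or_nonempty with h | h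
    · exact ⟨1 / 10, by norm_num, le_rfl, by simp [h]⟩
    · obtain ⟨y₀, hy₀, hmin⟩ := hTc.exists_isMinOn h (f := fun y ↦ ‖G y‖) (by fun_prop)
      exact ⟨min (1 / 10) ‖G y₀‖, lt_min (by norm_num) (norm_pos_iff.mpr (hTG y₀ hy₀)),
        min_le_left _ _, fun y hy ↦ (min_le_right _ _).trans (hmin hy)⟩
  obtain ⟨P, hPC, hPG, -⟩ := G.continuous.exists_contDiff_approx 1 (ε := fun _ ↦ δ / 2)
    continuous_const fun _ ↦ by positivity
  -- the image of the sphere is a null set, so a small translation makes `P` nonzero there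
  obtain ⟨v, hvδ, hvP⟩ : ∃ v : Space3, ‖v‖ < δ / 2 ∧ v ∉ P '' Metric.sphere c ε := by
    have h1 : MeasureTheory.volume (P '' Metric.sphere c ε) = 0 :=
      MeasureTheory.addHaar_image_eq_zero_of_differentiableOn_of_addHaar_eq_zero _
        (hPC.differentiable (by norm_num)).differentiableOn
        (MeasureTheory.Measure.addHaar_sphere _ _ _)
    by_contra! hcon
    have h2 : Metric.ball (0 : Space3) (δ / 2) ⊆ P '' Metric.sphere c ε := fun v hv ↦
      hcon v (by simpa using hv)
    exact (Metric.measure_ball_pos MeasureTheory.volume (0 : Space3)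
      (by positivity : 0 < δ / 2)).ne' (MeasureTheory.measure_mono_null h2 h1)
  let P₁ : Space3 → Space3 := fun y ↦ P y - v
  have hP₁G : ∀ y, ‖P₁ y - G y‖ < δ := by
    intro y
    have h1 := hPG y
    rw [dist_eq_norm] at h1
    have h2 : P₁ y - G y = (P y - G y) - v := by simp only [P₁]; abel
    rw [h2]
    linarith [norm_sub_le (P y - G y) v]
  let Φ : Space3 → Space3 := fun y ↦ c + max (ε / ‖y - c‖) 1 • (y - c)
  have hne : ∀ y ∈ K, ‖y - c‖ ≠ 0 := fun y hy h ↦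
    hcK (by rwa [← sub_eq_zero.mp (norm_eq_zero.mp h)])
  have hΦ : ContinuousOn Φ K := by
    have h1 : ContinuousOn (fun y ↦ y - c) K := by fun_prop
    have h2 : ContinuousOn (fun y ↦ max (ε / ‖y - c‖) 1) K :=
      (continuousOn_const.div (by fun_prop) hne).sup continuousOn_const
    exact continuousOn_const.add (h2.smul h1)
  obtain ⟨y, hyK, hy0⟩ := hzero (fun y ↦ P₁ (Φ y)) (by
    have : Continuous P₁ := hPC.continuous.sub continuous_const
    exact this.comp_continuousOn hΦ) (by
    intro y hy
    by_cases hyε : ε ≤ ‖y - c‖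
    · have h1 : Φ y = y := by
        simp only [Φ]
        rw [max_eq_right, one_smul, add_sub_cancel]
        exact div_le_one_of_le₀ hyε (norm_nonneg _)
      rw [h1]
      linarith [hP₁G y]
    · push Not at hyε
      have h1 : ‖Φ y - c‖ = ε := by
        have h2 : 0 < ‖y - c‖ := lt_of_le_of_ne (norm_nonneg _) (hne y hy).symm
        simp only [Φ]
        rw [add_sub_cancel_left, norm_smul, max_eq_left (by rw [le_div_iff₀ h2]; linarith),
          Real.norm_eq_abs, abs_of_pos (by positivity)]
        field_simp
      have h2 : ‖G (Φ y)‖ < 1 / 10 := hGε _ (by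
        have := norm_sub_le_norm_sub_add_norm_sub (Φ y) c (f 0)
        linarith)
      have h3 : ‖G y‖ < 1 / 10 := hGε _ (by
        have := norm_sub_le_norm_sub_add_norm_sub y c (f 0)
        linarith)
      have h4 := hP₁G (Φ y)
      have h5 : P₁ (Φ y) - G y = (P₁ (Φ y) - G (Φ y)) + G (Φ y) - G y := by abel
      rw [h5]
      have h6 := norm_sub_le (P₁ (Φ y) - G (Φ y) + G (Φ y)) (G y)
      have h7 := norm_add_le (P₁ (Φ y) - G (Φ y)) (G (Φ y))
      linarith)
  by_cases hyε : ε ≤ ‖y - c‖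
  · have h1 : Φ y = y := by
      simp only [Φ]
      rw [max_eq_right, one_smul, add_sub_cancel]
      exact div_le_one_of_le₀ hyε (norm_nonneg _)
    rw [h1] at hy0
    have h2 := hP₁G y
    rw [hy0, zero_sub, norm_neg] at h2
    exact h2.not_ge (hδT y ⟨hyK, hyε⟩)
  · push Not at hyε
    have h1 : ‖Φ y - c‖ = ε := by
      have h2 : 0 < ‖y - c‖ := lt_of_le_of_ne (norm_nonneg _) (hne y hyK).symm
      simp only [Φ]
      rw [add_sub_cancel_left, norm_smul, max_eq_left (by rw [le_div_iff₀ h2]; linarith),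
        Real.norm_eq_abs, abs_of_pos (by positivity)]
      field_simp
    exact hvP ⟨Φ y, by rwa [mem_sphere_iff_norm], sub_eq_zero.mp hy0⟩

/-- Invariance of domain in dimension three. -/
theorem isOpen_image_of_injOn {E F : Type*} [NormedAddCommGroup E] [NormedSpace ℝ E]
    [NormedAddCommGroup F] [NormedSpace ℝ F] [FiniteDimensional ℝ E] [FiniteDimensional ℝ F]
    (hE : Module.finrank ℝ E = 3) (hF : Module.finrank ℝ F = 3) {U : Set E} (hU : IsOpen U)
    {f : E → F} (hf : ContinuousOn f U) (hinj : InjOn f U) : IsOpen (f '' U) := by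
  let φ : Space3 ≃L[ℝ] E := ContinuousLinearEquiv.ofFinrankEq (by simp [hE])
  let ψ : F ≃L[ℝ] Space3 := ContinuousLinearEquiv.ofFinrankEq (by simp [hF])
  rw [isOpen_iff_mem_nhds]
  rintro _ ⟨x, hx, rfl⟩
  have hpre : (fun v : Space3 ↦ x + φ v) ⁻¹' U ∈ 𝓝 (0 : Space3) := by
    have : Continuous fun v : Space3 ↦ x + φ v := by fun_prop
    exact this.continuousAt.preimage_mem_nhds (by simpa using hU.mem_nhds hx)
  obtain ⟨r, hr, hrU⟩ := Metric.nhds_basis_closedBall.mem_iff.mp hpre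
  let α : Space3 → E := fun v ↦ x + φ (r • v)
  have hα : ∀ v ∈ Metric.closedBall (0 : Space3) 1, α v ∈ U := by
    intro v hv
    refine hrU (show r • v ∈ Metric.closedBall (0 : Space3) r from ?_)
    rw [mem_closedBall_zero_iff, norm_smul, Real.norm_eq_abs, abs_of_pos hr]
    have : ‖v‖ ≤ 1 := by simpa using hv
    exact mul_le_of_le_one_right hr.le this
  have hαc : Continuous α := by fun_prop
  have hαi : Function.Injective α := by
    intro v w hvw
    have h1 : r • v = r • w := φ.injective (add_left_cancel hvw)
    exact smul_right_injective _ hr.ne' h1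
  have h1 := mem_interior_image_closedBall (fun v ↦ ψ (f (α v)))
    (ψ.continuous.comp_continuousOn (hf.comp hαc.continuousOn hα))
    (fun v hv w hw hvw ↦ hαi (hinj (hα v hv) (hα w hw) (ψ.injective hvw)))
  rw [mem_interior_iff_mem_nhds] at h1
  have h2 := ψ.continuous.continuousAt.preimage_mem_nhds (x := f x)
    (by simpa only [α, smul_zero, map_zero, add_zero] using h1)
  refine mem_of_superset h2 ?_
  rintro y ⟨v, hv, hvy⟩
  exact ⟨α v, hα v hv, ψ.injective hvy⟩

/-! ### Continuous families of maps of the disk -/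

/-- The retraction of the plane onto the closed unit disk. -/
noncomputable def toDisk (x : ℂ) : UnitDisk :=
  ⟨ballProj x, by simpa using norm_ballProj_le x⟩

lemma continuous_toDisk : Continuous toDisk :=
  continuous_ballProj.subtype_mk _

lemma UnitDisk.norm_le (x : UnitDisk) : ‖(x : ℂ)‖ ≤ 1 := mem_closedBall_zero_iff.mp x.2

lemma coe_toDisk {x : ℂ} (hx : ‖x‖ ≤ 1) : (toDisk x : ℂ) = x := ballProj_of_norm_le hx

lemma toDisk_coe (x : UnitDisk) : toDisk x = x := Subtype.ext (coe_toDisk x.norm_le)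

/-- Invariance of domain in the plane. -/
lemma isOpen_image_of_injOn_complex {U : Set ℂ} (hU : IsOpen U) {f : ℂ → ℂ}
    (hf : ContinuousOn f U) (hinj : InjOn f U) : IsOpen (f '' U) := by
  have h1 : IsOpen ((fun q : ℝ × ℂ ↦ (q.1, f q.2)) '' (univ ×ˢ U)) := by
    refine isOpen_image_of_injOn (by simp) (by simp) (isOpen_univ.prod hU) ?_ ?_
    · exact continuousOn_fst.prodMk (hf.comp continuousOn_snd fun q hq ↦ hq.2)
    · rintro ⟨s, x⟩ hx ⟨t, y⟩ hy h
      simp only [Prod.mk.injEq] at h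
      exact Prod.ext h.1 (hinj hx.2 hy.2 h.2)
  have h2 : f '' U = (fun y : ℂ ↦ ((0 : ℝ), y)) ⁻¹'
      ((fun q : ℝ × ℂ ↦ (q.1, f q.2)) '' (univ ×ˢ U)) := by
    ext y
    simp only [mem_image, mem_preimage, mem_prod, mem_univ, true_and, Prod.exists, Prod.mk.injEq]
    exact ⟨fun ⟨x, hx, h⟩ ↦ ⟨0, x, hx, rfl, h⟩, fun ⟨_, x, hx, _, h⟩ ↦ ⟨x, hx, h⟩⟩
  rw [h2]
  exact h1.preimage (by fun_prop)

lemma isOpen_image_interior_disk {p : UnitDisk → UnitDisk} (hp : Continuous p)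
    (hinj : Function.Injective p) :
    IsOpen {y : ℂ | ∃ x : UnitDisk, ‖(x : ℂ)‖ < 1 ∧ (p x : ℂ) = y} := by
  have h1 : IsOpen ((fun x : ℂ ↦ (p (toDisk x) : ℂ)) '' Metric.ball 0 1) := by
    refine isOpen_image_of_injOn_complex Metric.isOpen_ball
      (continuous_subtype_val.comp (hp.comp continuous_toDisk)).continuousOn fun x hx y hy h ↦ ?_
    have h2 := congrArg Subtype.val (hinj (Subtype.ext h))
    rwa [coe_toDisk (by simpa using (mem_ball_zero_iff.mp hx).le),
      coe_toDisk (by simpa using (mem_ball_zero_iff.mp hy).le)] at h2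
  convert h1 using 1
  ext y
  constructor
  · rintro ⟨x, hx, rfl⟩
    exact ⟨x, by simpa using hx, by simp [toDisk_coe]⟩
  · rintro ⟨x, hx, rfl⟩
    have hx' : ‖x‖ < 1 := by simpa using hx
    exact ⟨toDisk x, by rwa [coe_toDisk hx'.le], rfl⟩

/-- An injective continuous self-map of the closed disk maps the open disk into the open disk. -/
lemma norm_lt_one_of_injective {p : UnitDisk → UnitDisk} (hp : Continuous p)
    (hinj : Function.Injective p) {x : UnitDisk} (hx : ‖(x : ℂ)‖ < 1) : ‖(p x : ℂ)‖ < 1 := by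
  have h1 : (p x : ℂ) ∈ interior (Metric.closedBall (0 : ℂ) 1) :=
    interior_maximal (by rintro _ ⟨y, -, rfl⟩; exact (p y).2)
      (isOpen_image_interior_disk hp hinj) ⟨x, hx, rfl⟩
  rw [interior_closedBall _ one_ne_zero] at h1
  simpa using h1

lemma norm_homeomorph_lt_one_iff (f : UnitDisk ≃ₜ UnitDisk) (x : UnitDisk) :
    ‖(f x : ℂ)‖ < 1 ↔ ‖(x : ℂ)‖ < 1 := by
  refine ⟨fun h ↦ ?_, norm_lt_one_of_injective f.continuous f.injective⟩
  simpa using norm_lt_one_of_injective f.symm.continuous f.symm.injective h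

/-- The points of an embedded disk which are interior in the plane are images of interior points of
the standard disk. -/
lemma norm_lt_one_of_mem_interior {p : UnitDisk → UnitDisk} (hp : IsEmbedding p) {x : UnitDisk}
    (hx : (p x : ℂ) ∈ interior ((↑) '' range p : Set ℂ)) : ‖(x : ℂ)‖ < 1 := by
  set W := interior ((↑) '' range p : Set ℂ) with hW
  have hpre : ∀ y ∈ W, ∃ x : UnitDisk, (p x : ℂ) = y := by
    intro y hy
    obtain ⟨_, ⟨x, rfl⟩, h⟩ := interior_subset hy
    exact ⟨x, h⟩
  choose! q hq using hpre
  have hqc : ContinuousOn (fun y ↦ (q y : ℂ)) W := by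
    refine continuous_subtype_val.comp_continuousOn ?_
    rw [(IsEmbedding.subtypeVal.comp hp).continuousOn_iff]
    exact continuousOn_id.congr fun y hy ↦ hq y hy
  have hqi : InjOn (fun y ↦ (q y : ℂ)) W := by
    intro y hy z hz h
    rw [← hq y hy, ← hq z hz, Subtype.ext h]
  have h1 := isOpen_image_of_injOn_complex isOpen_interior hqc hqi
  have h2 : (x : ℂ) ∈ interior (Metric.closedBall (0 : ℂ) 1) := by
    refine interior_maximal ?_ h1 ⟨p x, hx, ?_⟩
    · rintro _ ⟨y, -, rfl⟩
      exact (q y).2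
    · have := hp.injective (Subtype.ext (hq _ hx))
      simp only [this]
  rw [interior_closedBall _ one_ne_zero] at h2
  simpa using h2

/-- A parametrized form of invariance of domain, for a continuous path of embedded disks. The time
is the third coordinate. -/
lemma isOpen_image_interior_family_complex {p : ℝ → UnitDisk → UnitDisk}
    (hp : Continuous fun q : ℝ × UnitDisk ↦ p q.1 q.2) (hinj : ∀ t, Function.Injective (p t)) :
    IsOpen {q : ℝ × ℂ | ∃ x : UnitDisk, ‖(x : ℂ)‖ < 1 ∧ (p q.1 x : ℂ) = q.2} := by
  have h1 : IsOpen ((fun q : ℝ × ℂ ↦ (q.1, (p q.1 (toDisk q.2) : ℂ))) ''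
      (univ ×ˢ Metric.ball 0 1)) := by
    refine isOpen_image_of_injOn (by simp) (by simp) (isOpen_univ.prod Metric.isOpen_ball) ?_ ?_
    · refine (continuous_fst.prodMk (continuous_subtype_val.comp (hp.comp
        (continuous_fst.prodMk (continuous_toDisk.comp continuous_snd))))).continuousOn
    · rintro ⟨s, x⟩ hx ⟨t, y⟩ hy h
      simp only [Prod.mk.injEq] at h
      obtain ⟨rfl, h⟩ := h
      have h2 := congrArg Subtype.val (hinj s (Subtype.ext h))
      rw [coe_toDisk (by simpa using (mem_ball_zero_iff.mp hx.2).le),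
        coe_toDisk (by simpa using (mem_ball_zero_iff.mp hy.2).le)] at h2
      rw [h2]
  convert h1 using 1
  ext ⟨t, y⟩
  constructor
  · rintro ⟨x, hx, h⟩
    refine ⟨(t, x), ⟨mem_univ _, by simpa using hx⟩, ?_⟩
    simp only [toDisk_coe, h]
  · rintro ⟨⟨s, x⟩, ⟨-, hx⟩, h⟩
    simp only [Prod.mk.injEq] at h
    obtain ⟨rfl, rfl⟩ := h
    have hx' : ‖x‖ < 1 := by simpa using hx
    exact ⟨toDisk x, by rwa [coe_toDisk hx'.le], rfl⟩

lemma isOpen_image_interior_family {p : ℝ → UnitDisk → UnitDisk}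
    (hp : Continuous fun q : ℝ × UnitDisk ↦ p q.1 q.2) (hinj : ∀ t, Function.Injective (p t)) :
    IsOpen {q : ℝ × UnitDisk | ∃ x : UnitDisk, ‖(x : ℂ)‖ < 1 ∧ p q.1 x = q.2} := by
  have h2 : Continuous fun q : ℝ × UnitDisk ↦ (q.1, (q.2 : ℂ)) := by fun_prop
  convert (isOpen_image_interior_family_complex hp hinj).preimage h2 using 1
  ext ⟨t, y⟩
  exact exists_congr fun x ↦ and_congr_right fun _ ↦ Subtype.ext_iff

/-- The extension by the identity of the conjugate of `g` by an injection `p`. -/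
noncomputable def pushforwardMap {X Y : Type*} (p : X → Y) (g : X → X) : Y → Y :=
  Function.extend p (p ∘ g) id

lemma pushforwardMap_apply {X Y : Type*} {p : X → Y} (hp : Function.Injective p) (g : X → X)
    (x : X) :
    pushforwardMap p g (p x) = p (g x) := hp.extend_apply _ _ _

lemma pushforwardMap_of_notMem {X Y : Type*} {p : X → Y} (g : X → X) {y : Y} (hy : y ∉ range p) :
    pushforwardMap p g y = y := Function.extend_apply' _ _ _ hy

section families

variable {T X Y : Type*} [TopologicalSpace T] [TopologicalSpace X] [TopologicalSpace Y]

/-- For a continuous family of injections `p t` of a compact space, the map `(t, x) ↦ (t, p t x)` is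
a closed embedding. -/
lemma isClosedEmbedding_family [CompactSpace X] [T2Space T] [T2Space Y] {p : T → X → Y}
    (hp : Continuous fun q : T × X ↦ p q.1 q.2) (hinj : ∀ t, Function.Injective (p t)) :
    IsClosedEmbedding fun q : T × X ↦ (q.1, p q.1 q.2) := by
  have hc : Continuous fun q : T × X ↦ (q.1, p q.1 q.2) := continuous_fst.prodMk hp
  have hproper : IsProperMap fun q : T × X ↦ (q.1, p q.1 q.2) :=
    isProperMap_of_comp_of_t2 hc continuous_fst isProperMap_fst_of_compactSpace
  refine .of_continuous_injective_isClosedMap hc ?_ hproper.isClosedMap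
  rintro ⟨s, x⟩ ⟨t, y⟩ h
  simp only [Prod.mk.injEq] at h
  obtain ⟨rfl, h⟩ := h
  rw [hinj s h]

lemma continuous_family_symm [CompactSpace X] [T2Space T] [T2Space Y] {F : T → X ≃ₜ Y}
    (hF : Continuous fun q : T × X ↦ F q.1 q.2) :
    Continuous fun q : T × Y ↦ (F q.1).symm q.2 := by
  have h1 := isClosedEmbedding_family hF fun t ↦ (F t).injective
  have h2 : Continuous fun q : T × Y ↦ (q.1, (F q.1).symm q.2) := by
    rw [h1.isEmbedding.continuous_iff]
    exact continuous_id.congr fun q ↦ by simp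
  exact continuous_snd.comp h2

lemma continuous_pushforwardMap [CompactSpace X] [T2Space T] [T2Space Y] {p : T → X → Y}
    (hp : Continuous fun q : T × X ↦ p q.1 q.2) (hinj : ∀ t, Function.Injective (p t))
    {O : Set X} (hO : IsOpen {q : T × Y | ∃ x ∈ O, p q.1 x = q.2}) {g : T → X → X}
    (hg : Continuous fun q : T × X ↦ g q.1 q.2) (hgO : ∀ t, ∀ x ∉ O, g t x = x) :
    Continuous fun q : T × Y ↦ pushforwardMap (p q.1) (g q.1) q.2 := by
  have hemb := isClosedEmbedding_family hp hinj
  rw [← continuousOn_univ]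
  have hcover : (univ : Set (T × Y)) = range (fun q : T × X ↦ (q.1, p q.1 q.2)) ∪
      {q : T × Y | ∃ x ∈ O, p q.1 x = q.2}ᶜ := by
    refine (eq_univ_of_forall fun q ↦ ?_).symm
    by_cases h : ∃ x ∈ O, p q.1 x = q.2
    · obtain ⟨x, -, hx⟩ := h
      exact Or.inl ⟨(q.1, x), by simp [hx]⟩
    · exact Or.inr h
  rw [hcover]
  refine ContinuousOn.union_of_isClosed ?_ ?_ hemb.isClosed_range hO.isClosed_compl
  · rw [continuousOn_iff_continuous_domRestrict,
      ← hemb.isEmbedding.toHomeomorph.comp_continuous_iff']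
    exact (hp.comp (continuous_fst.prodMk hg)).congr fun q ↦
      (pushforwardMap_apply (hinj q.1) _ _).symm
  · refine continuous_snd.continuousOn.congr fun q hq ↦ ?_
    by_cases h : q.2 ∈ range (p q.1)
    · obtain ⟨x, hx⟩ := h
      have hxO : x ∉ O := fun h' ↦ hq ⟨x, h', hx⟩
      rw [← hx, pushforwardMap_apply (hinj _), hgO _ _ hxO]
    · exact pushforwardMap_of_notMem _ h

/-- Homeomorphisms supported in the interior of a compact space `X` are transported to `Y` along a
continuous family of embeddings whose restrictions to the interior are open. -/
lemma exists_pushforward [CompactSpace X] [T2Space T] [T2Space X] [T2Space Y] {p : T → X → Y}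
    (hp : Continuous fun q : T × X ↦ p q.1 q.2) (hinj : ∀ t, Function.Injective (p t))
    {O : Set X} (hO : IsOpen {q : T × Y | ∃ x ∈ O, p q.1 x = q.2}) {g : T → X ≃ₜ X}
    (hg : Continuous fun q : T × X ↦ g q.1 q.2) (hgO : ∀ t, ∀ x ∉ O, g t x = x) :
    ∃ H : T → Y ≃ₜ Y, (Continuous fun q : T × Y ↦ H q.1 q.2) ∧
      (∀ t x, H t (p t x) = p t (g t x)) ∧ ∀ t, ∀ y ∉ range (p t), H t y = y := by
  have hgO' : ∀ t, ∀ x ∉ O, (g t).symm x = x := fun t x hx ↦ by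
    rw [Homeomorph.symm_apply_eq, hgO t x hx]
  have h1 := continuous_pushforwardMap hp hinj hO hg hgO
  have h2 := continuous_pushforwardMap hp hinj hO (continuous_family_symm hg) hgO'
  have hcancel : ∀ (t : T) (a b : X → X), (∀ x, a (b x) = x) → ∀ y,
      pushforwardMap (p t) a (pushforwardMap (p t) b y) = y := by
    intro t a b hab y
    by_cases h : y ∈ range (p t)
    · obtain ⟨x, rfl⟩ := h
      rw [pushforwardMap_apply (hinj t), pushforwardMap_apply (hinj t), hab]
    · rw [pushforwardMap_of_notMem _ h, pushforwardMap_of_notMem _ h]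
  refine ⟨fun t ↦
    { toFun := pushforwardMap (p t) (g t)
      invFun := pushforwardMap (p t) (g t).symm
      left_inv := hcancel t _ _ (g t).symm_apply_apply
      right_inv := hcancel t _ _ (g t).apply_symm_apply
      continuous_toFun := h1.comp (continuous_const.prodMk continuous_id)
      continuous_invFun := h2.comp (continuous_const.prodMk continuous_id) }, h1, ?_, ?_⟩
  · exact fun t x ↦ pushforwardMap_apply (hinj t) _ _
  · exact fun t y hy ↦ pushforwardMap_of_notMem _ hy

end families

/-! ### The circle as a quotient of the line, and mapping tori -/

/-- The point of the circle at time `t`, for the parametrization of period `1`. -/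
noncomputable def rot (t : ℝ) : Circle := Circle.exp (2 * Real.pi * t)

lemma continuous_rot : Continuous rot := Circle.exp.continuous.comp (by fun_prop)

lemma rot_add (s t : ℝ) : rot (s + t) = rot s * rot t := by
  simp [rot, mul_add, Circle.exp_add]

lemma rot_zero : rot 0 = 1 := by simp [rot]

lemma rot_intCast (n : ℤ) : rot n = 1 := by
  rw [rot, mul_comm, Circle.exp_int_mul_two_pi]

lemma rot_one : rot 1 = 1 := by simpa using rot_intCast 1

lemma rot_eq_one_iff {t : ℝ} : rot t = 1 ↔ ∃ n : ℤ, t = n := by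
  rw [rot, Circle.exp_eq_one]
  have h := Real.pi_pos.ne'
  refine exists_congr fun n ↦ ⟨fun h1 ↦ ?_, fun h1 ↦ ?_⟩
  · have : 2 * Real.pi * t = 2 * Real.pi * n := by linarith
    exact mul_left_cancel₀ (by positivity) this
  · rw [h1]; ring

lemma rot_neg (t : ℝ) : rot (-t) = (rot t)⁻¹ := by
  rw [eq_inv_iff_mul_eq_one, ← rot_add, neg_add_cancel, rot_zero]

lemma rot_eq_rot_iff {s t : ℝ} : rot s = rot t ↔ ∃ n : ℤ, s = t + n := by
  rw [← mul_inv_eq_one, ← rot_neg, ← rot_add, rot_eq_one_iff]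
  exact exists_congr fun n ↦ ⟨fun h ↦ by linarith, fun h ↦ by linarith⟩

lemma rot_zpow (t : ℝ) (n : ℤ) : rot t ^ n = rot (n * t) := by
  rw [rot, rot, ← Circle.exp_zsmul]
  congr 1
  simp
  ring

lemma exists_rot_eq (z : Circle) : ∃ t : ℝ, rot t = z := by
  obtain ⟨s, rfl⟩ := Circle.exp_surjective z
  refine ⟨s / (2 * Real.pi), ?_⟩
  rw [rot, mul_div_cancel₀]
  have := Real.pi_pos
  positivity

lemma exists_mem_Ico_rot_eq (z : Circle) : ∃ t ∈ Ico (0 : ℝ) 1, rot t = z := by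
  obtain ⟨t, rfl⟩ := exists_rot_eq z
  refine ⟨Int.fract t, ⟨Int.fract_nonneg t, Int.fract_lt_one t⟩, ?_⟩
  exact rot_eq_rot_iff.mpr ⟨-⌊t⌋, by rw [Int.fract]; push_cast; ring⟩

lemma isOpenQuotientMap_rot : IsOpenQuotientMap rot := by
  refine ⟨exists_rot_eq, continuous_rot, ?_⟩
  have h1 : IsOpenMap Circle.exp := Circle.isCoveringMap_exp.isLocalHomeomorph.isOpenMap
  have h2 : (2 * Real.pi) ≠ 0 := by have := Real.pi_pos; positivity
  exact h1.comp (Homeomorph.mulLeft₀ _ h2).isOpenMap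

/-- A continuous isotopy from the identity to `f` identifies the mapping torus of `f` with the solid
torus. -/
lemma exists_homeomorph_mappingTorus {f : UnitDisk ≃ₜ UnitDisk} {F : ℝ → UnitDisk ≃ₜ UnitDisk}
    (hF : Continuous fun q : ℝ × UnitDisk ↦ F q.1 q.2) (h0 : ∀ x, F 0 x = x)
    (h1 : ∀ x, F 1 x = f x) :
    ∃ h : MappingTorus f ≃ₜ SolidTorus, ∀ (x : UnitDisk) (t : unitInterval),
      h (Quot.mk _ (x, t)) = (F t x, rot t) := by
  let φ : UnitDisk × unitInterval → SolidTorus := fun q ↦ (F q.2 q.1, rot q.2)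
  have hφ : Continuous φ :=
    (hF.comp (continuous_subtype_val.comp continuous_snd |>.prodMk continuous_fst)).prodMk
      (continuous_rot.comp (continuous_subtype_val.comp continuous_snd))
  let Φ : MappingTorus f → SolidTorus := Quot.lift φ (by
    rintro ⟨x, s⟩ ⟨y, t⟩ ⟨rfl, rfl, rfl⟩
    simp [φ, h0, h1, rot_one, rot_zero])
  have hΦ : Continuous Φ := continuous_quot_lift _ hφ
  have hinj : Function.Injective Φ := by
    rintro ⟨x, s⟩ ⟨y, t⟩ h
    have h2 : (F s x, rot s) = (F t y, rot t) := h
    simp only [Prod.mk.injEq] at h2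
    obtain ⟨h2, h3⟩ := h2
    obtain ⟨n, hn⟩ := rot_eq_rot_iff.mp h3
    have hs := s.2
    have ht := t.2
    have hn1 : (n : ℝ) ≤ 1 := by linarith [hs.2, ht.1]
    have hn2 : (-1 : ℝ) ≤ n := by linarith [hs.1, ht.2]
    have hn1' : n ≤ 1 := by exact_mod_cast hn1
    have hn2' : -1 ≤ n := by exact_mod_cast hn2
    obtain rfl | rfl | rfl : n = -1 ∨ n = 0 ∨ n = 1 := by omega
    · push_cast at hn
      have hs0 : s = 0 := Subtype.ext (by simp only [Icc.coe_zero]; linarith [hs.1, ht.2])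
      have ht1 : t = 1 := Subtype.ext (by simp only [Icc.coe_one]; linarith [hs.1, ht.2])
      subst hs0 ht1
      refine (Quot.sound ⟨rfl, rfl, ?_⟩).symm
      simpa [h0, h1] using h2
    · have hst : s = t := Subtype.ext (by simpa using hn)
      subst hst
      rw [(F s).injective h2]
    · push_cast at hn
      have hs1 : s = 1 := Subtype.ext (by simp only [Icc.coe_one]; linarith [hs.2, ht.1])
      have ht0 : t = 0 := Subtype.ext (by simp only [Icc.coe_zero]; linarith [hs.2, ht.1])
      subst hs1 ht0
      refine Quot.sound ⟨rfl, rfl, ?_⟩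
      simpa [h0, h1] using h2.symm
  have hsurj : Function.Surjective Φ := by
    rintro ⟨y, z⟩
    obtain ⟨t, ht, rfl⟩ := exists_mem_Ico_rot_eq z
    exact ⟨Quot.mk _ ((F t).symm y, ⟨t, ht.1, ht.2.le⟩), by
      change (F t ((F t).symm y), rot t) = _
      simp⟩
  have : CompactSpace (MappingTorus f) := inferInstanceAs (CompactSpace (Quot _))
  exact ⟨hΦ.homeoOfEquivCompactToT2 (f := Equiv.ofBijective Φ ⟨hinj, hsurj⟩), fun x t ↦ rfl⟩

/-! ### Winding numbers -/

/-- The loop `γ`, of period `2π` in the punctured plane, winds `n` times around the origin. -/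
def HasWinding (γ : ℝ → ℂ) (n : ℤ) : Prop :=
  ∃ φ : ℝ → ℝ, Continuous φ ∧ (∀ t, γ t = ‖γ t‖ * Circle.exp (φ t)) ∧
    ∀ t, φ (t + 2 * Real.pi) = φ t + 2 * Real.pi * n

/-- A continuous integer-valued function on a connected space is constant. -/
lemma exists_int_eq_of_continuous {A : Type*} [TopologicalSpace A] [PreconnectedSpace A]
    [Nonempty A] {c : A → ℝ} (hc : Continuous c) (h : ∀ a, ∃ m : ℤ, c a = m) :
    ∃ m : ℤ, ∀ a, c a = m := by
  choose m hm using h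
  have hmc : Continuous m := by
    rw [Int.isClosedEmbedding_coe_real.isInducing.continuous_iff]
    exact hc.congr hm
  obtain ⟨a₀⟩ := ‹Nonempty A›
  exact ⟨m a₀, fun a ↦ by rw [hm, PreconnectedSpace.constant ‹_› hmc (x := a) (y := a₀)]⟩

lemma exp_eq_of_norm_mul_exp_eq {z : ℂ} (hz : z ≠ 0) {a b : ℝ} (ha : z = ‖z‖ * Circle.exp a)
    (hb : z = ‖z‖ * Circle.exp b) : Circle.exp a = Circle.exp b := by
  have h1 : (‖z‖ : ℂ) ≠ 0 := by simpa using hz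
  exact Subtype.ext (mul_left_cancel₀ h1 (ha.symm.trans hb))

lemma exists_int_of_exp_eq {a b : ℝ} (h : Circle.exp a = Circle.exp b) :
    ∃ m : ℤ, (a - b) / (2 * Real.pi) = m := by
  obtain ⟨m, hm⟩ := Circle.exp_eq_exp.mp h
  refine ⟨m, ?_⟩
  have := Real.pi_pos
  rw [hm]
  field_simp
  ring

lemma HasWinding.unique {γ : ℝ → ℂ} (hγ : ∀ t, γ t ≠ 0) {m n : ℤ} (hm : HasWinding γ m)
    (hn : HasWinding γ n) : m = n := by
  obtain ⟨φ, hφ, hφγ, hφm⟩ := hm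
  obtain ⟨χ, hχ, hχγ, hχn⟩ := hn
  obtain ⟨k, hk⟩ := exists_int_eq_of_continuous (c := fun t ↦ (φ t - χ t) / (2 * Real.pi))
    (by fun_prop) fun t ↦ exists_int_of_exp_eq (exp_eq_of_norm_mul_exp_eq (hγ t) (hφγ t) (hχγ t))
  have hpi := Real.pi_pos
  have h1 := hk 0
  have h2 := hk (0 + 2 * Real.pi)
  rw [← h2, hφm, hχn, div_left_inj' (by positivity)] at h1
  have h3 : 2 * Real.pi * ((m : ℝ) - n) = 0 := by linear_combination -h1
  have h4 : (m : ℝ) - n = 0 := by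
    rcases mul_eq_zero.mp h3 with h | h
    · linarith
    · exact h
  exact_mod_cast sub_eq_zero.mp h4

/-- The intermediate loops of a homotopy of loops in the punctured plane share a winding number. -/
lemma exists_hasWinding_homotopy {H : ℝ → ℝ → ℂ} (hH : Continuous fun q : ℝ × ℝ ↦ H q.1 q.2)
    (h0 : ∀ s t, H s t ≠ 0) (hper : ∀ s t, H s (t + 2 * Real.pi) = H s t) :
    ∃ n : ℤ, ∀ s, HasWinding (H s) n := by
  have hpi := Real.pi_pos
  let u : C(ℝ × ℝ, Circle) :=
    ⟨fun q ↦ ⟨H q.1 q.2 / ‖H q.1 q.2‖, by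
      simp [Submonoid.unitSphere, h0 q.1 q.2]⟩, by
      refine Continuous.subtype_mk (hH.div (by fun_prop) fun q ↦ ?_) _
      simpa using h0 q.1 q.2⟩
  have hu : ∀ q : ℝ × ℝ, H q.1 q.2 = ‖H q.1 q.2‖ * (u q : ℂ) := by
    intro q
    have : (‖H q.1 q.2‖ : ℂ) ≠ 0 := by simpa using h0 q.1 q.2
    change _ = _ * (H q.1 q.2 / ‖H q.1 q.2‖)
    field_simp
  obtain ⟨e₀, he₀⟩ := Circle.exp_surjective (u (0, 0))
  obtain ⟨Φ, ⟨-, hΦ⟩, -⟩ :=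
    Circle.isCoveringMap_exp.existsUnique_continuousMap_lifts u (0, 0) e₀ he₀
  have hΦu : ∀ q, H q.1 q.2 = ‖H q.1 q.2‖ * Circle.exp (Φ q) := by
    intro q
    conv_lhs => rw [hu q]
    rw [← congrFun hΦ q]
    rfl
  obtain ⟨n, hn⟩ := exists_int_eq_of_continuous
    (c := fun q : ℝ × ℝ ↦ (Φ (q.1, q.2 + 2 * Real.pi) - Φ q) / (2 * Real.pi))
    (by fun_prop) fun q ↦ exists_int_of_exp_eq (by
      refine exp_eq_of_norm_mul_exp_eq (h0 q.1 q.2) ?_ (hΦu q)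
      have := hΦu (q.1, q.2 + 2 * Real.pi)
      simpa only [hper] using this)
  refine ⟨n, fun s ↦ ⟨fun t ↦ Φ (s, t), by fun_prop, fun t ↦ hΦu (s, t), fun t ↦ ?_⟩⟩
  have := hn (s, t)
  rw [div_eq_iff (by positivity)] at this
  linear_combination this

lemma HasWinding.homotopy {H : ℝ → ℝ → ℂ} (hH : Continuous fun q : ℝ × ℝ ↦ H q.1 q.2)
    (h0 : ∀ s t, H s t ≠ 0) (hper : ∀ s t, H s (t + 2 * Real.pi) = H s t) {n : ℤ} {a : ℝ}
    (ha : HasWinding (H a) n) (b : ℝ) : HasWinding (H b) n := by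
  obtain ⟨m, hm⟩ := exists_hasWinding_homotopy hH h0 hper
  rw [ha.unique (h0 a) (hm a)]
  exact hm b

/-- An odd loop has an odd winding number. -/
lemma HasWinding.odd {γ : ℝ → ℂ} (h0 : ∀ t, γ t ≠ 0) (hodd : ∀ t, γ (t + Real.pi) = -γ t) {n : ℤ}
    (h : HasWinding γ n) : Odd n := by
  have hpi := Real.pi_pos
  obtain ⟨φ, hφ, hφγ, hφn⟩ := h
  obtain ⟨k, hk⟩ := exists_int_eq_of_continuous
    (c := fun t ↦ (φ (t + Real.pi) - (φ t + Real.pi)) / (2 * Real.pi)) (by fun_prop) fun t ↦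
      exists_int_of_exp_eq (exp_eq_of_norm_mul_exp_eq (h0 (t + Real.pi)) (hφγ _) (by
        rw [hodd, norm_neg, Circle.exp_add, Circle.coe_mul, Circle.coe_exp Real.pi,
          Complex.exp_pi_mul_I]
        conv_lhs => rw [hφγ t]
        ring))
  refine ⟨k, ?_⟩
  have h1 := hk 0
  have h2 := hk Real.pi
  rw [div_eq_iff (by positivity)] at h1 h2
  have h3 := hφn 0
  rw [zero_add] at h1 h3
  rw [← two_mul] at h2
  have h4 : 2 * Real.pi * ((n : ℝ) - (2 * k + 1)) = 0 := by linear_combination h1 + h2 - h3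
  have h5 : (n : ℝ) - (2 * k + 1) = 0 := by
    rcases mul_eq_zero.mp h4 with h | h
    · linarith
    · exact h
  exact_mod_cast sub_eq_zero.mp h5

lemma add_int_mul_of_add {φ : ℝ → ℝ} {a b : ℝ} (h : ∀ t, φ (t + a) = φ t + b) (t : ℝ) (n : ℤ) :
    φ (t + n * a) = φ t + n * b := by
  induction n with
  | zero => simp
  | succ n ih =>
    have := h (t + n * a)
    push_cast at ih ⊢
    rw [show t + (n + 1) * a = t + n * a + a by ring, this, ih]
    ring
  | pred n ih =>
    have := h (t + (-(n : ℝ) - 1) * a)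
    push_cast at ih ⊢
    rw [show t + (-(n : ℝ) - 1) * a + a = t + -n * a by ring, ih] at this
    linarith

lemma HasWinding.comp {γ : ℝ → ℂ} {n d : ℤ} (h : HasWinding γ n) {θ : ℝ → ℝ} (hθ : Continuous θ)
    (hd : ∀ t, θ (t + 2 * Real.pi) = θ t + 2 * Real.pi * d) :
    HasWinding (fun t ↦ γ (θ t)) (d * n) := by
  obtain ⟨φ, hφ, hφγ, hφn⟩ := h
  refine ⟨fun t ↦ φ (θ t), hφ.comp hθ, fun t ↦ hφγ _, fun t ↦ ?_⟩
  beta_reduce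
  rw [hd, mul_comm (2 * Real.pi), add_int_mul_of_add hφn]
  push_cast
  ring

/-! ### Orientation of homeomorphisms of the disk -/

/-- The restriction of a real number to the unit interval. -/
noncomputable def clamp (s : ℝ) : ℝ := max 0 (min 1 s)

lemma continuous_clamp : Continuous clamp := by unfold clamp; fun_prop

lemma clamp_nonneg (s : ℝ) : 0 ≤ clamp s := le_max_left _ _

lemma clamp_le_one (s : ℝ) : clamp s ≤ 1 := max_le zero_le_one (min_le_left _ _)

lemma clamp_of_mem {s : ℝ} (hs : s ∈ Icc (0 : ℝ) 1) : clamp s = s := by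
  rw [clamp, min_eq_right hs.2, max_eq_right hs.1]

lemma norm_smul_exp_le {r : ℝ} (hr : |r| ≤ 1) (t : ℝ) : ‖(r : ℂ) * Circle.exp t‖ ≤ 1 := by
  simpa using hr

lemma exp_add_two_pi (t : ℝ) : Circle.exp (t + 2 * Real.pi) = Circle.exp t := by
  rw [Circle.exp_add, Circle.exp_two_pi, mul_one]

lemma boundaryCircle_injective : Function.Injective boundaryCircle := fun _ _ h ↦
  Subtype.ext (congrArg (fun x : UnitDisk ↦ (x : ℂ)) h)

lemma toDisk_exp (t : ℝ) : toDisk (Circle.exp t : ℂ) = boundaryCircle (Circle.exp t) :=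
  toDisk_coe (boundaryCircle (Circle.exp t))

lemma continuous_coe_exp : Continuous fun t : ℝ ↦ (Circle.exp t : ℂ) :=
  continuous_subtype_val.comp Circle.exp.continuous

/-- The boundary of an embedded disk winds an odd number of times around the image of the centre:
moving `p z - p 0` through `p (z / (1 + s)) - p (- s z / (1 + s))` deforms it to an odd loop. -/
lemma exists_odd_hasWinding {p : UnitDisk → UnitDisk} (hp : Continuous p)
    (hinj : Function.Injective p) : ∃ n : ℤ, Odd n ∧
      HasWinding (fun t ↦ (p (toDisk (Circle.exp t)) : ℂ) - p (toDisk 0)) n := by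
  let a : ℝ → ℝ := fun s ↦ (1 + clamp s)⁻¹
  let b : ℝ → ℝ := fun s ↦ -(clamp s * (1 + clamp s)⁻¹)
  have hpos : ∀ s, 0 < 1 + clamp s := fun s ↦ by linarith [clamp_nonneg s]
  have hac : Continuous a := Continuous.inv₀ (continuous_const.add continuous_clamp)
    fun s ↦ (hpos s).ne'
  have hbc : Continuous b := (continuous_clamp.mul hac).neg
  have ha : ∀ s, |a s| ≤ 1 := by
    intro s
    rw [abs_of_pos (inv_pos.mpr (hpos s))]
    exact inv_le_one_of_one_le₀ (by linarith [clamp_nonneg s])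
  have hb : ∀ s, |b s| ≤ 1 := by
    intro s
    simp only [b]
    rw [abs_neg, abs_of_nonneg (mul_nonneg (clamp_nonneg s) (inv_pos.mpr (hpos s)).le),
      ← div_eq_mul_inv, div_le_one (hpos s)]
    linarith
  have hab : ∀ s, a s ≠ b s := by
    intro s h
    have h1 : a s - b s = 1 := by
      have := (hpos s).ne'
      simp only [a, b]
      field_simp
      ring
    rw [h, sub_self] at h1
    exact zero_ne_one h1
  let H : ℝ → ℝ → ℂ := fun s t ↦ (p (toDisk (a s * Circle.exp t)) : ℂ) -
    p (toDisk (b s * Circle.exp t))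
  have hH : Continuous fun q : ℝ × ℝ ↦ H q.1 q.2 := by
    have h1 : ∀ c : ℝ → ℝ, Continuous c →
        Continuous fun q : ℝ × ℝ ↦ (p (toDisk (c q.1 * Circle.exp q.2)) : ℂ) := fun c hc ↦
      continuous_subtype_val.comp (hp.comp (continuous_toDisk.comp
        ((Complex.continuous_ofReal.comp (hc.comp continuous_fst)).mul
          (continuous_coe_exp.comp continuous_snd))))
    exact (h1 a hac).sub (h1 b hbc)
  have hne : ∀ s t, H s t ≠ 0 := by
    intro s t h
    have h1 := congrArg Subtype.val (hinj (Subtype.ext (sub_eq_zero.mp h)))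
    rw [coe_toDisk (norm_smul_exp_le (ha s) t), coe_toDisk (norm_smul_exp_le (hb s) t)] at h1
    exact hab s (Complex.ofReal_injective (mul_right_cancel₀ (Circle.coe_ne_zero _) h1))
  have hper : ∀ s t, H s (t + 2 * Real.pi) = H s t := by
    intro s t
    simp only [H, exp_add_two_pi]
  obtain ⟨n, hn⟩ := exists_hasWinding_homotopy hH hne hper
  refine ⟨n, (hn 1).odd (hne 1) fun t ↦ ?_, ?_⟩
  · have h1 : clamp 1 = 1 := clamp_of_mem ⟨zero_le_one, le_rfl⟩
    have h2 : b 1 = -a 1 := by simp [a, b, h1]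
    have h3 : (Circle.exp (t + Real.pi) : ℂ) = -Circle.exp t := by
      rw [Circle.exp_add, Circle.coe_mul, Circle.coe_exp Real.pi, Complex.exp_pi_mul_I]
      ring
    simp only [H, h2, h3]
    simp
  · have h1 : clamp 0 = 0 := clamp_of_mem ⟨le_rfl, zero_le_one⟩
    simpa [H, a, b, h1] using hn 0

/-- If an embedded disk is mapped to itself by a homeomorphism isotopic to the identity, then the
induced homeomorphism of the standard disk preserves orientation. -/
lemma isOrientationPreserving_of_isotopy {p : UnitDisk → UnitDisk} (hp : Continuous p)
    (hinj : Function.Injective p) {G : ℝ → UnitDisk ≃ₜ UnitDisk}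
    (hG : Continuous fun q : ℝ × UnitDisk ↦ G q.1 q.2) (hG0 : ∀ x, G 0 x = x)
    {q : UnitDisk ≃ₜ UnitDisk} (hq : ∀ x, G 1 (p x) = p (q x)) : IsOrientationPreserving q := by
  have hq1 : ∀ t, ‖(q (toDisk (Circle.exp t)) : ℂ)‖ = 1 := by
    intro t
    refine le_antisymm (UnitDisk.norm_le _) (not_lt.mp fun h ↦ ?_)
    rw [norm_homeomorph_lt_one_iff, toDisk_exp] at h
    exact h.ne (Circle.norm_coe _)
  have hqc : Continuous fun t : ℝ ↦ (q (toDisk (Circle.exp t)) : ℂ) :=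
    continuous_subtype_val.comp (q.continuous.comp (continuous_toDisk.comp continuous_coe_exp))
  -- `θ` lifts the boundary map of `q`, of degree `d`
  obtain ⟨d, hd⟩ := exists_hasWinding_homotopy
    (H := fun _ t ↦ (q (toDisk (Circle.exp t)) : ℂ)) (hqc.comp continuous_snd)
    (fun _ t ↦ norm_ne_zero_iff.mp (by rw [hq1]; exact one_ne_zero))
    (fun _ t ↦ by simp only [exp_add_two_pi])
  obtain ⟨θ, hθ, hθq, hθd⟩ := hd 0
  have hqθ : ∀ t, q (toDisk (Circle.exp t)) = toDisk (Circle.exp (θ t)) := by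
    intro t
    rw [toDisk_exp (θ t)]
    refine Subtype.ext ?_
    have := hθq t
    rw [hq1] at this
    simpa [boundaryCircle] using this
  obtain ⟨n, hn, hpn⟩ := exists_odd_hasWinding hp hinj
  have h1 : HasWinding (fun t ↦ (p (q (toDisk (Circle.exp t))) : ℂ) - p (q (toDisk 0))) n := by
    have hpc : Continuous fun t : ℝ ↦ p (toDisk (Circle.exp t)) :=
      hp.comp (continuous_toDisk.comp continuous_coe_exp)
    have h2 := HasWinding.homotopy (n := n) (a := 0)
      (H := fun s t ↦ (G s (p (toDisk (Circle.exp t))) : ℂ) - G s (p (toDisk 0))) ?_ ?_ ?_ ?_ 1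
    · simpa only [hq] using h2
    · exact (continuous_subtype_val.comp (hG.comp (continuous_fst.prodMk
        (hpc.comp continuous_snd)))).sub (continuous_subtype_val.comp
          (hG.comp (continuous_fst.prodMk continuous_const)))
    · intro s t h
      have h3 := congrArg Subtype.val (hinj ((G s).injective (Subtype.ext (sub_eq_zero.mp h))))
      rw [coe_toDisk (Circle.norm_coe _).le, coe_toDisk (by simp)] at h3
      exact Circle.coe_ne_zero _ h3
    · intro s t
      simp only [exp_add_two_pi]
    · simpa only [hG0] using hpn
  have hq0 : ‖(q (toDisk 0) : ℂ)‖ < 1 := by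
    rw [norm_homeomorph_lt_one_iff, coe_toDisk (by simp)]
    simp
  have h2 : HasWinding (fun t ↦ (p (toDisk (Circle.exp (θ t))) : ℂ) - p (toDisk 0)) n := by
    have hlt : ∀ s, ‖(clamp s : ℂ) * (q (toDisk 0) : ℂ)‖ < 1 := by
      intro s
      rw [norm_mul, Complex.norm_real, Real.norm_eq_abs, abs_of_nonneg (clamp_nonneg s)]
      nlinarith [clamp_le_one s, clamp_nonneg s, norm_nonneg (q (toDisk 0) : ℂ)]
    have h3 := HasWinding.homotopy (n := n) (a := 1)
      (H := fun s t ↦ (p (toDisk (Circle.exp (θ t))) : ℂ) -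
        p (toDisk (clamp s * (q (toDisk 0) : ℂ)))) ?_ ?_ ?_ ?_ 0
    · simpa [clamp_of_mem (show (0 : ℝ) ∈ Icc (0 : ℝ) 1 by simp)] using h3
    · refine Continuous.sub ?_ ?_
      · exact continuous_subtype_val.comp (hp.comp (continuous_toDisk.comp
          (continuous_coe_exp.comp (hθ.comp continuous_snd))))
      · exact continuous_subtype_val.comp (hp.comp (continuous_toDisk.comp
          ((Complex.continuous_ofReal.comp (continuous_clamp.comp continuous_fst)).mul
            continuous_const)))
    · intro s t h
      have h3 := congrArg Subtype.val (hinj (Subtype.ext (sub_eq_zero.mp h)))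
      rw [coe_toDisk (Circle.norm_coe _).le, coe_toDisk (hlt s).le] at h3
      have h4 := hlt s
      rw [← h3, Circle.norm_coe] at h4
      exact lt_irrefl _ h4
    · intro s t
      simp only [← hqθ, exp_add_two_pi]
    · simp only [hqθ] at h1
      simpa [clamp_of_mem (show (1 : ℝ) ∈ Icc (0 : ℝ) 1 by simp), toDisk_coe] using h1
  have h3 := hpn.comp hθ hθd
  have hne : ∀ t, (p (toDisk (Circle.exp (θ t))) : ℂ) - p (toDisk 0) ≠ 0 := by
    intro t h
    have h4 := congrArg Subtype.val (hinj (Subtype.ext (sub_eq_zero.mp h)))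
    rw [coe_toDisk (Circle.norm_coe _).le, coe_toDisk (by simp)] at h4
    exact Circle.coe_ne_zero _ h4
  have h4 : n = d * n := h2.unique hne h3
  have hn0 : n ≠ 0 := by
    rintro rfl
    simp at hn
  have hd1 : d = 1 := by
    have : (d - 1) * n = 0 := by linear_combination -h4
    rcases mul_eq_zero.mp this with h | h
    · omega
    · exact absurd h hn0
  subst hd1
  have hbd : ∀ z, ∃ w, q (boundaryCircle z) = boundaryCircle w := by
    intro z
    obtain ⟨t, rfl⟩ := Circle.exp_surjective z
    exact ⟨Circle.exp (θ t), by rw [← toDisk_exp, hqθ, toDisk_exp]⟩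
  choose g hg using hbd
  refine ⟨g, ⟨θ, hθ, fun t ↦ boundaryCircle_injective ?_, hθd⟩, hg⟩
  rw [← hg, ← toDisk_exp, hqθ, toDisk_exp]

/-- Alexander's trick: a homeomorphism of the disk fixing the boundary is isotopic to the identity,
through `x ↦ s h (x / s)`. -/
lemma exists_alexander_isotopy (h : UnitDisk ≃ₜ UnitDisk)
    (hbd : ∀ x : UnitDisk, ‖(x : ℂ)‖ = 1 → h x = x) :
    ∃ A : ℝ → UnitDisk ≃ₜ UnitDisk, (Continuous fun q : ℝ × UnitDisk ↦ A q.1 q.2) ∧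
      (∀ x, A 0 x = x) ∧ ∀ x, A 1 x = h x := by
  -- the displacement of `h`, extended by zero
  let φ : (UnitDisk ≃ₜ UnitDisk) → ℂ → ℂ := fun k x ↦ (k (toDisk x) : ℂ) - toDisk x
  have hφc : ∀ k, Continuous (φ k) := fun k ↦
    (continuous_subtype_val.comp (k.continuous.comp continuous_toDisk)).sub
      (continuous_subtype_val.comp continuous_toDisk)
  have hφ2 : ∀ k x, ‖φ k x‖ ≤ 2 := fun k x ↦ by
    have h1 := norm_sub_le (k (toDisk x) : ℂ) (toDisk x)
    linarith [UnitDisk.norm_le (k (toDisk x)), UnitDisk.norm_le (toDisk x)]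
  have hφin : ∀ (k : UnitDisk ≃ₜ UnitDisk) (x : ℂ), ‖x‖ ≤ 1 → x + φ k x = k (toDisk x) := by
    intro k x hx
    simp only [φ, coe_toDisk hx]
    ring
  have hφout : ∀ (k : UnitDisk ≃ₜ UnitDisk), (∀ x : UnitDisk, ‖(x : ℂ)‖ = 1 → k x = x) →
      ∀ x : ℂ, 1 ≤ ‖x‖ → φ k x = 0 := by
    intro k hk x hx
    have h1 : ‖(toDisk x : ℂ)‖ = 1 := by
      have h2 : ‖x‖ ≠ 0 := by positivity
      change ‖ballProj x‖ = 1
      rw [ballProj, max_eq_right hx, norm_smul, norm_inv, norm_norm, inv_mul_cancel₀ h2]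
    simp only [φ, hk _ h1, sub_self]
  let a : (UnitDisk ≃ₜ UnitDisk) → ℝ → ℂ → ℂ := fun k s x ↦ x + clamp s * φ k (x / clamp s)
  have hac : ∀ k, Continuous fun q : ℝ × ℂ ↦ a k q.1 q.2 := by
    intro k
    refine continuous_snd.add (continuous_iff_continuousAt.mpr fun q ↦ ?_)
    have hcl : Continuous fun q : ℝ × ℂ ↦ (clamp q.1 : ℂ) :=
      Complex.continuous_ofReal.comp (continuous_clamp.comp continuous_fst)
    by_cases hq : clamp q.1 = 0
    · have h1 : Tendsto (fun q : ℝ × ℂ ↦ ‖(clamp q.1 : ℂ)‖ * 2) (𝓝 q) (𝓝 0) := by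
        have h2 : Continuous fun q : ℝ × ℂ ↦ ‖(clamp q.1 : ℂ)‖ * 2 := by fun_prop
        simpa [hq] using h2.tendsto q
      rw [ContinuousAt, hq]
      simp only [Complex.ofReal_zero, zero_mul]
      refine squeeze_zero_norm (fun y ↦ ?_) h1
      rw [norm_mul]
      exact mul_le_mul_of_nonneg_left (hφ2 _ _) (norm_nonneg _)
    · have h1 : (clamp q.1 : ℂ) ≠ 0 := by exact_mod_cast hq
      exact hcl.continuousAt.mul ((hφc k).continuousAt.comp
        (continuous_snd.continuousAt.div hcl.continuousAt h1))
  have hain : ∀ (k : UnitDisk ≃ₜ UnitDisk) (s : ℝ) (x : ℂ), 0 < clamp s → ‖x‖ ≤ clamp s →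
      a k s x = clamp s * k (toDisk (x / clamp s)) := by
    intro k s x hs hx
    have h1 : (clamp s : ℂ) ≠ 0 := by exact_mod_cast hs.ne'
    have h2 : ‖x / clamp s‖ ≤ 1 := by
      rw [norm_div, Complex.norm_real, Real.norm_eq_abs, abs_of_pos hs]
      exact div_le_one_of_le₀ hx hs.le
    rw [← hφin k _ h2]
    simp only [a]
    field_simp
  have haout : ∀ (k : UnitDisk ≃ₜ UnitDisk), (∀ x : UnitDisk, ‖(x : ℂ)‖ = 1 → k x = x) →
      ∀ (s : ℝ) (x : ℂ), ¬ (0 < clamp s ∧ ‖x‖ ≤ clamp s) → a k s x = x := by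
    intro k hk s x hx
    simp only [a]
    rcases (clamp_nonneg s).eq_or_lt with h1 | h1
    · simp [← h1]
    · rw [hφout k hk, mul_zero, add_zero]
      rw [norm_div, Complex.norm_real, Real.norm_eq_abs, abs_of_pos h1, one_le_div h1]
      exact (not_le.mp fun h2 ↦ hx ⟨h1, h2⟩).le
  have hale : ∀ (k : UnitDisk ≃ₜ UnitDisk) (s : ℝ) (x : ℂ), 0 < clamp s → ‖x‖ ≤ clamp s →
      ‖a k s x‖ ≤ clamp s := by
    intro k s x hs hx
    rw [hain k s x hs hx, norm_mul, Complex.norm_real, Real.norm_eq_abs, abs_of_pos hs]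
    exact mul_le_of_le_one_right hs.le (UnitDisk.norm_le _)
  have hmem : ∀ (k : UnitDisk ≃ₜ UnitDisk), (∀ x : UnitDisk, ‖(x : ℂ)‖ = 1 → k x = x) →
      ∀ (s : ℝ) (x : UnitDisk), a k s x ∈ Metric.closedBall (0 : ℂ) 1 := by
    intro k hk s x
    rw [mem_closedBall_zero_iff]
    by_cases hx : 0 < clamp s ∧ ‖(x : ℂ)‖ ≤ clamp s
    · exact (hale k s x hx.1 hx.2).trans (clamp_le_one s)
    · rw [haout k hk s x hx]
      exact x.norm_le
  have hcancel : ∀ (k l : UnitDisk ≃ₜ UnitDisk), (∀ x : UnitDisk, ‖(x : ℂ)‖ = 1 → k x = x) →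
      (∀ x : UnitDisk, ‖(x : ℂ)‖ = 1 → l x = x) → (∀ x, k (l x) = x) →
      ∀ (s : ℝ) (x : ℂ), a k s (a l s x) = x := by
    intro k l hk hl hkl s x
    by_cases hx : 0 < clamp s ∧ ‖x‖ ≤ clamp s
    · have h1 : (clamp s : ℂ) ≠ 0 := by exact_mod_cast hx.1.ne'
      rw [hain k s _ hx.1 (hale l s x hx.1 hx.2), hain l s x hx.1 hx.2, mul_div_cancel_left₀ _ h1,
        toDisk_coe, hkl, coe_toDisk, mul_div_cancel₀ _ h1]
      rw [norm_div, Complex.norm_real, Real.norm_eq_abs, abs_of_pos hx.1]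
      exact div_le_one_of_le₀ hx.2 hx.1.le
    · rw [haout l hl s x hx, haout k hk s x hx]
  have hbd' : ∀ x : UnitDisk, ‖(x : ℂ)‖ = 1 → h.symm x = x := fun x hx ↦ by
    rw [Homeomorph.symm_apply_eq, hbd x hx]
  refine ⟨fun s ↦
    { toFun := fun x ↦ ⟨a h s x, hmem h hbd s x⟩
      invFun := fun x ↦ ⟨a h.symm s x, hmem h.symm hbd' s x⟩
      left_inv := fun x ↦ Subtype.ext (hcancel h.symm h hbd' hbd h.symm_apply_apply s x)
      right_inv := fun x ↦ Subtype.ext (hcancel h h.symm hbd hbd' h.apply_symm_apply s x)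
      continuous_toFun := ((hac h).comp
        (continuous_const.prodMk continuous_subtype_val)).subtype_mk _
      continuous_invFun := ((hac h.symm).comp
        (continuous_const.prodMk continuous_subtype_val)).subtype_mk _ }, ?_, ?_, ?_⟩
  · exact ((hac h).comp (continuous_fst.prodMk
      (continuous_subtype_val.comp continuous_snd))).subtype_mk _
  · intro x
    refine Subtype.ext (haout h hbd 0 x ?_)
    simp [clamp]
  · intro x
    have h1 : clamp 1 = 1 := clamp_of_mem ⟨zero_le_one, le_rfl⟩
    refine Subtype.ext ((hain h 1 x (by simp [h1]) (by simpa [h1] using x.norm_le)).trans ?_)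
    simp [h1, toDisk_coe]

/-- An increasing lift `θ` of a degree one map of the circle is joined to the identity by the maps
`t + s (θ t - t)`; the corresponding maps of concentric circles form an isotopy of the disk. -/
lemma exists_radial_isotopy {θ : ℝ → ℝ} (hθ : Continuous θ) (hmono : StrictMono θ)
    (hper : ∀ t, θ (t + 2 * Real.pi) = θ t + 2 * Real.pi) :
    ∃ A : ℝ → UnitDisk ≃ₜ UnitDisk, (Continuous fun q : ℝ × UnitDisk ↦ A q.1 q.2) ∧
      (∀ x, A 0 x = x) ∧ ∀ t, A 1 (boundaryCircle (Circle.exp t)) =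
        boundaryCircle (Circle.exp (θ t)) := by
  have hpi := Real.pi_pos
  let Δ : ℂ → ℝ := fun x ↦ θ x.arg - x.arg
  have hδper : ∀ (t : ℝ) (n : ℤ),
      θ (t + n * (2 * Real.pi)) - (t + n * (2 * Real.pi)) = θ t - t := by
    intro t n
    rw [add_int_mul_of_add hper]
    ring
  have hΔ : ∀ (r t : ℝ), 0 < r → Δ (r * Circle.exp t) = θ t - t := by
    intro r t hr
    obtain ⟨n, hn⟩ : ∃ n : ℤ, (r * Circle.exp t : ℂ).arg = t + n * (2 * Real.pi) := by
      refine Circle.exp_eq_exp.mp ?_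
      rw [Complex.arg_real_mul _ hr, Circle.exp_arg]
    simp only [Δ, hn, hδper]
  have hΔc : ContinuousOn Δ {0}ᶜ := by
    intro x hx
    refine ContinuousAt.continuousWithinAt ?_
    by_cases hs : x ∈ Complex.slitPlane
    · have h1 := Complex.continuousAt_arg hs
      exact (hθ.continuousAt.comp h1).sub h1
    · have hs' : -x ∈ Complex.slitPlane := by
        rw [Complex.mem_slitPlane_iff] at hs ⊢
        push Not at hs
        left
        have h2 : x.re ≠ 0 := fun h ↦ hx (Complex.ext h hs.2)
        have := lt_of_le_of_ne hs.1 h2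
        simpa using this
      have h1 : ContinuousAt (fun y : ℂ ↦ (-y).arg + Real.pi) x :=
        ((Complex.continuousAt_arg hs').comp continuous_neg.continuousAt).add continuousAt_const
      refine ((hθ.continuousAt.comp h1).sub h1).congr ?_
      filter_upwards [isOpen_compl_singleton.mem_nhds hx] with y hy
      have hy0 : 0 < ‖y‖ := norm_pos_iff.mpr hy
      have h2 : y = ‖y‖ * Circle.exp ((-y).arg + Real.pi) := by
        rw [Circle.exp_add, Circle.coe_mul, Circle.coe_exp Real.pi, Complex.exp_pi_mul_I,
          Circle.coe_exp]
        have := Complex.norm_mul_exp_arg_mul_I (-y)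
        rw [norm_neg] at this
        rw [← mul_assoc, this]
        ring
      conv_rhs => rw [h2, hΔ _ _ hy0]
      rfl
  let θs : ℝ → ℝ → ℝ := fun s t ↦ t + clamp s * (θ t - t)
  have hθsper : ∀ s t, θs s (t + 2 * Real.pi) = θs s t + 2 * Real.pi := by
    intro s t
    simp only [θs, hper]
    ring
  have hθsc : ∀ s, Continuous (θs s) := fun s ↦ by fun_prop
  have hθsmono : ∀ s, StrictMono (θs s) := by
    intro s t u htu
    have h1 := hmono htu
    have h2 : θs s u - θs s t = (1 - clamp s) * (u - t) + clamp s * (θ u - θ t) := by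
      simp only [θs]; ring
    have h3 : 0 < θs s u - θs s t := by
      rw [h2]
      rcases (clamp_nonneg s).eq_or_lt with h | h
      · rw [← h]; linarith
      · have h4 := mul_pos h (sub_pos.mpr h1)
        have h5 := mul_nonneg (sub_nonneg.mpr (clamp_le_one s)) (sub_pos.mpr htu).le
        linarith
    linarith
  have hθssurj : ∀ s, Function.Surjective (θs s) := by
    intro s y
    obtain ⟨n, hn⟩ := exists_nat_ge (|y - θs s 0| / (2 * Real.pi))
    rw [div_le_iff₀ (by positivity)] at hn
    have h1 := add_int_mul_of_add (hθsper s) 0 n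
    have h2 := add_int_mul_of_add (hθsper s) 0 (-n)
    have h3 := abs_le.mp hn
    have h4 : y ∈ Icc (θs s (0 + (-n : ℤ) * (2 * Real.pi)))
        (θs s (0 + (n : ℤ) * (2 * Real.pi))) := by
      rw [h1, h2]
      push_cast
      constructor <;> linarith
    obtain ⟨t, -, ht⟩ := mem_range_of_exists_le_of_exists_ge (hθsc s) ⟨_, h4.1⟩ ⟨_, h4.2⟩ |>.imp
      fun t ht ↦ (⟨trivial, ht⟩ : True ∧ _)
    exact ⟨t, ht⟩
  let a : ℝ → ℂ → ℂ := fun s x ↦ x * Circle.exp (clamp s * Δ x)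
  have hapolar : ∀ s r t : ℝ, 0 ≤ r → a s (r * Circle.exp t) = r * Circle.exp (θs s t) := by
    intro s r t hr
    rcases hr.eq_or_lt with h | h
    · simp [a, ← h]
    · simp only [a, hΔ r t h, θs, Circle.exp_add, Circle.coe_mul]
      ring
  have hpolar : ∀ x : ℂ, ∃ t : ℝ, x = ‖x‖ * Circle.exp t := fun x ↦
    ⟨x.arg, by rw [Circle.coe_exp, Complex.norm_mul_exp_arg_mul_I]⟩
  have hanorm : ∀ s x, ‖a s x‖ = ‖x‖ := fun s x ↦ by
    rw [norm_mul, Circle.norm_coe, mul_one]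
  have hac : Continuous fun q : ℝ × ℂ ↦ a q.1 q.2 := by
    refine continuous_iff_continuousAt.mpr fun q ↦ ?_
    by_cases hq : q.2 = 0
    · have h1 : Tendsto (fun q : ℝ × ℂ ↦ ‖q.2‖) (𝓝 q) (𝓝 0) := by
        have h2 : Continuous fun q : ℝ × ℂ ↦ ‖q.2‖ := by fun_prop
        simpa [hq] using h2.tendsto q
      rw [ContinuousAt]
      have h2 : a q.1 q.2 = 0 := by simp [a, hq]
      rw [h2]
      exact squeeze_zero_norm (fun y ↦ (hanorm _ _).le) h1
    · have h1 : ContinuousAt (fun q : ℝ × ℂ ↦ Δ q.2) q :=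
        (hΔc.continuousAt (isOpen_compl_singleton.mem_nhds hq)).comp continuousAt_snd
      refine continuousAt_snd.mul (continuous_coe_exp.continuousAt.comp ?_)
      exact (continuous_clamp.comp continuous_fst).continuousAt.mul h1
  have hainj : ∀ s, Function.Injective (a s) := by
    intro s x y h
    have hn : ‖x‖ = ‖y‖ := by rw [← hanorm s x, h, hanorm]
    obtain ⟨t, ht⟩ := hpolar x
    obtain ⟨u, hu⟩ := hpolar y
    rcases (norm_nonneg x).eq_or_lt with h0 | h0
    · rw [norm_eq_zero.mp h0.symm, norm_eq_zero.mp (hn.symm.trans h0.symm)]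
    · rw [ht, hu, hapolar _ _ _ (norm_nonneg x), hapolar _ _ _ (norm_nonneg y), ← hn] at h
      have h1 : (‖x‖ : ℂ) ≠ 0 := by exact_mod_cast h0.ne'
      obtain ⟨n, hn'⟩ := Circle.exp_eq_exp.mp (Subtype.ext (mul_left_cancel₀ h1 h))
      rw [← add_int_mul_of_add (hθsper s)] at hn'
      have h2 := (hθsmono s).injective hn'
      rw [ht, hu, ← hn, h2, Circle.exp_eq_exp.mpr ⟨n, rfl⟩]
  have hasurj : ∀ s, Function.Surjective (a s) := by
    intro s y
    obtain ⟨u, hu⟩ := hpolar y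
    obtain ⟨t, ht⟩ := hθssurj s u
    exact ⟨‖y‖ * Circle.exp t, by rw [hapolar _ _ _ (norm_nonneg y), ht, ← hu]⟩
  let A : ℝ → UnitDisk → UnitDisk := fun s x ↦ ⟨a s x, by
    rw [mem_closedBall_zero_iff, hanorm]; exact x.norm_le⟩
  have hAc : Continuous fun q : ℝ × UnitDisk ↦ A q.1 q.2 :=
    (hac.comp (continuous_fst.prodMk (continuous_subtype_val.comp continuous_snd))).subtype_mk _
  have hAbij : ∀ s, Function.Bijective (A s) := by
    refine fun s ↦ ⟨fun x y h ↦ Subtype.ext (hainj s (congrArg Subtype.val h)), fun y ↦ ?_⟩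
    obtain ⟨x, hx⟩ := hasurj s y
    exact ⟨⟨x, by rw [mem_closedBall_zero_iff, ← hanorm s, hx]; exact y.norm_le⟩, Subtype.ext hx⟩
  have hAc' : ∀ s, Continuous (A s) := fun s ↦ hAc.comp (continuous_const.prodMk continuous_id)
  refine ⟨fun s ↦ Continuous.homeoOfEquivCompactToT2 (f := Equiv.ofBijective (A s) (hAbij s))
    (hAc' s), hAc, fun x ↦ Subtype.ext ?_, fun t ↦ Subtype.ext ?_⟩
  · change a 0 x = x
    simp [a, clamp]
  · change a 1 (Circle.exp t) = Circle.exp (θ t)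
    have := hapolar 1 1 t zero_le_one
    simpa [θs, clamp_of_mem (show (1 : ℝ) ∈ Icc (0 : ℝ) 1 by simp)] using this

/-- An orientation preserving homeomorphism of the disk is isotopic to the identity. -/
theorem IsOrientationPreserving.exists_isotopy {f : UnitDisk ≃ₜ UnitDisk}
    (hf : IsOrientationPreserving f) : ∃ F : ℝ → UnitDisk ≃ₜ UnitDisk,
      (Continuous fun q : ℝ × UnitDisk ↦ F q.1 q.2) ∧ (∀ x, F 0 x = x) ∧ ∀ x, F 1 x = f x := by
  obtain ⟨g, ⟨θ, hθ, hθg, hθper⟩, hg⟩ := hf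
  have hpi := Real.pi_pos
  have hper : ∀ t, θ (t + 2 * Real.pi) = θ t + 2 * Real.pi := by simpa using hθper
  have hinj : Function.Injective θ := by
    intro s t hst
    have h1 : g (Circle.exp s) = g (Circle.exp t) := by rw [hθg, hθg, hst]
    have h2 : f (boundaryCircle (Circle.exp s)) = f (boundaryCircle (Circle.exp t)) := by
      rw [hg, hg, h1]
    obtain ⟨n, hn⟩ := Circle.exp_eq_exp.mp (boundaryCircle_injective (f.injective h2))
    have h3 := add_int_mul_of_add hper t n
    rw [← hn, hst] at h3
    have h4 : (n : ℝ) * (2 * Real.pi) = 0 := by linarith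
    rw [hn, h4, add_zero]
  have hmono : StrictMono θ := by
    refine (hθ.strictMono_of_inj hinj).resolve_right fun h ↦ ?_
    have h1 := h (show (0 : ℝ) < 0 + 2 * Real.pi by linarith)
    rw [hper] at h1
    linarith
  obtain ⟨A, hA, hA0, hA1⟩ := exists_radial_isotopy hθ hmono hper
  obtain ⟨B, hB, hB0, hB1⟩ := exists_alexander_isotopy (f.trans (A 1).symm) (by
    intro x hx
    obtain ⟨t, ht⟩ := Circle.exp_surjective ⟨x, by simpa [Submonoid.unitSphere] using hx⟩
    have h1 : x = boundaryCircle (Circle.exp t) := Subtype.ext (by rw [ht]; rfl)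
    rw [Homeomorph.trans_apply, Homeomorph.symm_apply_eq, h1, hA1, hg, hθg])
  refine ⟨fun s ↦ (B s).trans (A s), ?_, fun x ↦ ?_, fun x ↦ ?_⟩
  · exact hA.comp (continuous_fst.prodMk hB)
  · simp [hA0, hB0]
  · simp [hB1]

/-- An isotopy from the identity to `f` over `[0, 1]` extends to all times, with
`F (t + 1) = F t ∘ f`. -/
lemma exists_isotopy_real {f : UnitDisk ≃ₜ UnitDisk} {F : ℝ → UnitDisk ≃ₜ UnitDisk}
    (hF : Continuous fun q : ℝ × UnitDisk ↦ F q.1 q.2) (h0 : ∀ x, F 0 x = x)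
    (h1 : ∀ x, F 1 x = f x) :
    ∃ G : ℝ → UnitDisk ≃ₜ UnitDisk, (Continuous fun q : ℝ × UnitDisk ↦ G q.1 q.2) ∧
      (∀ x, G 0 x = x) ∧ ∀ (n : ℤ) (t : ℝ) (x : UnitDisk), G (t + n) x = G t ((f ^ n) x) := by
  let G : ℝ → UnitDisk ≃ₜ UnitDisk := fun t ↦ (f ^ ⌊t⌋).trans (F (Int.fract t))
  have hG : ∀ (n : ℤ) (t : ℝ), t ∈ Icc (n : ℝ) (n + 1) → ∀ x, G t x = F (t - n) ((f ^ n) x) := by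
    intro n t ht x
    rcases ht.2.lt_or_eq with h | h
    · have : ⌊t⌋ = n := Int.floor_eq_iff.mpr ⟨ht.1, h⟩
      simp only [G, Homeomorph.trans_apply, Int.fract, this]
    · have h2 : ⌊t⌋ = n + 1 := by rw [h]; simp
      have h3 : t - n = 1 := by rw [h]; ring
      have h4 : Int.fract t = 0 := by rw [Int.fract, h2, h]; push_cast; ring
      simp only [G, Homeomorph.trans_apply, h2, h3, h4, h0, h1]
      rw [add_comm, zpow_add, zpow_one]
      rfl
  have hcont : ∀ n : ℤ, ContinuousOn (fun q : ℝ × UnitDisk ↦ G q.1 q.2)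
      (Icc (n : ℝ) (n + 1) ×ˢ univ) := by
    intro n
    refine ContinuousOn.congr (f := fun q : ℝ × UnitDisk ↦ F (q.1 - n) ((f ^ n) q.2)) ?_ ?_
    · exact (hF.comp ((continuous_fst.sub continuous_const).prodMk
        ((f ^ n).continuous.comp continuous_snd))).continuousOn
    · exact fun q hq ↦ hG n q.1 hq.1 q.2
  refine ⟨G, continuous_iff_continuousAt.mpr fun q ↦ ?_, fun x ↦ ?_, fun n t x ↦ ?_⟩
  · obtain ⟨n, hn1, hn2⟩ : ∃ n : ℤ, (n : ℝ) < q.1 ∧ q.1 < n + 2 :=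
      ⟨⌈q.1⌉ - 1, by push_cast; linarith [Int.ceil_lt_add_one q.1], by
        push_cast; linarith [Int.le_ceil q.1]⟩
    have h2 := (hcont n).union_of_isClosed (hcont (n + 1)) (isClosed_Icc.prod isClosed_univ)
      (isClosed_Icc.prod isClosed_univ)
    refine h2.continuousAt ?_
    rw [← union_prod]
    refine prod_mem_nhds (mem_of_superset (Ioo_mem_nhds hn1 hn2) fun t ht ↦ ?_) univ_mem
    push_cast
    rcases le_total t (n + 1) with h | h
    · exact Or.inl ⟨ht.1.le, h⟩
    · exact Or.inr ⟨h, by linarith [ht.2]⟩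
  · simp [G, h0]
  · simp only [G, Homeomorph.trans_apply, Int.floor_add_intCast, Int.fract_add_intCast, zpow_add]
    rfl

/-! ### Nested disks permuted by a homeomorphism -/

lemma zpow_add_apply {X : Type*} [TopologicalSpace X] (f : X ≃ₜ X) (m n : ℤ) (x : X) :
    (f ^ (m + n)) x = (f ^ m) ((f ^ n) x) := by
  rw [zpow_add]; rfl

lemma image_zpow_of_cyclic {f : UnitDisk ≃ₜ UnitDisk} {k : ℕ} {d : ZMod k → Set UnitDisk}
    (h : ∀ i, f '' d i = d (i + 1)) (n : ℤ) (i : ZMod k) : (f ^ n) '' d i = d (i + n) := by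
  induction n generalizing i with
  | zero =>
    rw [Int.cast_zero, add_zero, zpow_zero]
    exact image_id _
  | succ n ih =>
    have : ⇑(f ^ ((n : ℤ) + 1)) = ⇑(f ^ (n : ℤ)) ∘ f := funext fun x ↦ by
      rw [zpow_add_apply, zpow_one]; rfl
    rw [this, image_comp, h, ih]
    congr 1
    push_cast
    ring
  | pred n ih =>
    have h1 : f '' d (i - 1) = d i := by rw [h]; congr 1; ring
    have : ⇑(f ^ (-(n : ℤ))) = ⇑(f ^ (-(n : ℤ) - 1)) ∘ f := funext fun x ↦ by
      have := zpow_add_apply f (-(n : ℤ) - 1) 1 x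
      rw [sub_add_cancel, zpow_one] at this
      exact this
    have h2 := ih (i - 1)
    rw [this, image_comp, h1] at h2
    rw [h2]
    congr 1
    push_cast
    ring

/-- A finite disjoint union of disks which `f` permutes cyclically, described by a parametrization
`p` of the disk containing a base point `c` and by the number `k` of disks. -/
structure DiskCycle (f : UnitDisk ≃ₜ UnitDisk) (U : Set UnitDisk) (c : UnitDisk) (k : ℕ)
    (p : UnitDisk → UnitDisk) : Prop where
  pos : 0 < k
  isEmbedding : IsEmbedding p
  mem : c ∈ range p
  image_eq : (f ^ (k : ℤ)) '' range p = range p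
  dvd : ∀ i : ℤ, ∀ x y, (f ^ i) (p x) = p y → (k : ℤ) ∣ i
  eq_iUnion : U = ⋃ i : ℤ, (f ^ i) '' range p
  exists_compl : ∃ V, IsClosed V ∧ Disjoint (range p) V ∧ U = range p ∪ V

lemma CyclicallyPermutesDisks.exists_diskCycle {f : UnitDisk ≃ₜ UnitDisk} {U : Set UnitDisk}
    (h : CyclicallyPermutesDisks f U) {c : UnitDisk} (hc : c ∈ U) :
    ∃ k p, DiskCycle f U c k p := by
  obtain ⟨k, d, hk, hd, hdisj, hU, hf⟩ := h
  have : NeZero k := ⟨hk.ne'⟩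
  rw [hU] at hc
  obtain ⟨j, hj⟩ := mem_iUnion.mp hc
  obtain ⟨e⟩ := hd j
  have hp : IsEmbedding fun x ↦ (e.symm x : UnitDisk) :=
    IsEmbedding.subtypeVal.comp e.symm.isEmbedding
  have hrange : range (fun x ↦ (e.symm x : UnitDisk)) = d j := by
    have : (fun x ↦ (e.symm x : UnitDisk)) = Subtype.val ∘ e.symm := rfl
    rw [this, range_comp, e.symm.range_coe, image_univ, Subtype.range_coe]
  refine ⟨k, fun x ↦ e.symm x, hk, hp, by rwa [hrange], ?_, ?_, ?_, ?_⟩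
  · rw [hrange, image_zpow_of_cyclic hf]
    simp
  · intro i x y hxy
    have h1 : (f ^ i) (e.symm x : UnitDisk) ∈ d (j + i) := by
      rw [← image_zpow_of_cyclic hf]
      exact mem_image_of_mem _ (e.symm x).2
    rw [hxy] at h1
    have h2 : j + i = j := by
      by_contra hne
      exact (hdisj hne).le_bot ⟨h1, (e.symm y).2⟩
    exact (ZMod.intCast_zmod_eq_zero_iff_dvd i k).mp (by simpa using h2)
  · rw [hU, hrange]
    refine Subset.antisymm (iUnion_subset fun i ↦ ?_) (iUnion_subset fun i ↦ ?_)
    · obtain ⟨n, hn⟩ := ZMod.intCast_surjective (i - j)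
      refine subset_iUnion_of_subset n ?_
      rw [image_zpow_of_cyclic hf, hn, add_sub_cancel]
    · rw [image_zpow_of_cyclic hf]
      exact subset_iUnion _ _
  · refine ⟨⋃ i ∈ {i | i ≠ j}, d i, ?_, ?_, ?_⟩
    · refine (toFinite _).isClosed_biUnion fun i _ ↦ ?_
      obtain ⟨e'⟩ := hd i
      have : CompactSpace (d i) := e'.symm.compactSpace
      exact (isCompact_iff_compactSpace.mpr this).isClosed
    · rw [hrange, disjoint_iUnion₂_right]
      exact fun i hi ↦ hdisj (Ne.symm hi)
    · rw [hrange, hU]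
      ext x
      simp only [mem_iUnion, mem_union, exists_prop]
      refine ⟨fun ⟨i, hi⟩ ↦ ?_, ?_⟩
      · by_cases hij : i = j
        · exact Or.inl (hij ▸ hi)
        · exact Or.inr ⟨i, hij, hi⟩
      · rintro (h | ⟨i, -, h⟩)
        · exact ⟨j, h⟩
        · exact ⟨i, h⟩

namespace DiskCycle

variable {f : UnitDisk ≃ₜ UnitDisk} {U U' : Set UnitDisk} {c : UnitDisk} {k k' : ℕ}
  {p p' : UnitDisk → UnitDisk}

lemma isPreconnected_range (h : DiskCycle f U c k p) : IsPreconnected (range p) := by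
  have : PreconnectedSpace UnitDisk :=
    isPreconnected_iff_preconnectedSpace.mp (convex_closedBall (0 : ℂ) 1).isPreconnected
  exact _root_.isPreconnected_range h.isEmbedding.continuous

lemma isCompact_range (h : DiskCycle f U c k p) : IsCompact (range p) :=
  _root_.isCompact_range h.isEmbedding.continuous

lemma range_subset (h : DiskCycle f U c k p) : range p ⊆ U := by
  obtain ⟨V, -, -, hU⟩ := h.exists_compl
  rw [hU]
  exact subset_union_left

lemma isClosed (h : DiskCycle f U c k p) : IsClosed U := by
  obtain ⟨V, hV, -, hU⟩ := h.exists_compl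
  rw [hU]
  exact h.isCompact_range.isClosed.union hV

lemma zpow_mem (h : DiskCycle f U c k p) {x : UnitDisk} (hx : x ∈ U) (i : ℤ) : (f ^ i) x ∈ U := by
  rw [h.eq_iUnion] at hx ⊢
  obtain ⟨j, y, hy, rfl⟩ := mem_iUnion.mp hx
  exact mem_iUnion.mpr ⟨i + j, y, hy, zpow_add_apply f i j y⟩

/-- Translating by a multiple of `k` does not change the disk. -/
lemma image_zpow_add_mul (h : DiskCycle f U c k p) (i j : ℤ) :
    (f ^ (i + k * j)) '' range p = (f ^ i) '' range p := by
  have h1 : ∀ n : ℕ, (f ^ ((k : ℤ) * n)) '' range p = range p := by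
    intro n
    induction n with
    | zero =>
      rw [Nat.cast_zero, mul_zero, zpow_zero]
      exact image_id _
    | succ n ih =>
      have : ⇑(f ^ ((k : ℤ) * (n + 1 : ℕ))) = ⇑(f ^ ((k : ℤ) * n)) ∘ ⇑(f ^ (k : ℤ)) :=
          funext fun x ↦ by
        rw [Nat.cast_add, mul_add, Nat.cast_one, mul_one, zpow_add_apply]; rfl
      rw [this, image_comp, h.image_eq, ih]
  have h2 : (f ^ ((k : ℤ) * j)) '' range p = range p := by
    obtain ⟨n, rfl | rfl⟩ := j.eq_nat_or_neg
    · exact h1 n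
    · conv_lhs => rw [← h1 n]
      rw [← image_comp]
      have : ⇑(f ^ ((k : ℤ) * -n)) ∘ ⇑(f ^ ((k : ℤ) * n)) = id := funext fun x ↦ by
        rw [Function.comp_apply, ← zpow_add_apply]
        simp
      rw [this, image_id]
  have h3 : ⇑(f ^ (i + k * j)) = ⇑(f ^ i) ∘ ⇑(f ^ ((k : ℤ) * j)) :=
    funext fun x ↦ zpow_add_apply f _ _ x
  rw [h3, image_comp, h2]

/-- The first disk of a finer cycle is contained in the planar interior of that of a coarser
one. -/
lemma mem_interior_range (h : DiskCycle f U c k p) (h' : DiskCycle f U' c k' p')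
    (hint : ∀ x ∈ U', (x : ℂ) ∈ interior ((↑) '' U : Set ℂ)) {x : UnitDisk} (hx : x ∈ range p') :
    (x : ℂ) ∈ interior ((↑) '' range p : Set ℂ) := by
  have hsub : U' ⊆ U := fun y hy ↦ by
    obtain ⟨z, hz, hzy⟩ := interior_subset (hint y hy)
    rwa [← Subtype.ext hzy]
  obtain ⟨V, hV, hdisj, hU⟩ := h.exists_compl
  have hrange : range p' ⊆ range p := by
    by_contra hnot
    obtain ⟨y, hy, hy'⟩ := not_subset.mp hnot
    have hcover : range p' ⊆ range p ∪ V := hU ▸ h'.range_subset.trans hsub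
    obtain ⟨z, -, hz⟩ := isPreconnected_closed_iff.mp h'.isPreconnected_range _ _
      h.isCompact_range.isClosed hV hcover ⟨c, h'.mem, h.mem⟩
      ⟨y, hy, (hcover hy).resolve_left hy'⟩
    exact hdisj.le_bot hz
  have hVc : IsClosed ((↑) '' V : Set ℂ) :=
    (hV.isCompact.image continuous_subtype_val).isClosed
  refine mem_interior.mpr ⟨interior ((↑) '' U : Set ℂ) ∩ ((↑) '' V : Set ℂ)ᶜ, ?_,
    isOpen_interior.inter hVc.isOpen_compl, hint x (h'.range_subset hx), ?_⟩
  · rintro y ⟨hy, hyV⟩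
    obtain ⟨z, hz, rfl⟩ := interior_subset hy
    rw [hU] at hz
    exact ⟨z, hz.resolve_right fun h ↦ hyV ⟨z, h, rfl⟩, rfl⟩
  · rintro ⟨z, hz, hzx⟩
    rw [Subtype.ext hzx] at hz
    exact hdisj.le_bot ⟨hrange hx, hz⟩

end DiskCycle

lemma uncountable_nat_bool : Uncountable (ℕ → Bool) := by
  refine ⟨fun h ↦ ?_⟩
  obtain ⟨g, hg⟩ := exists_surjective_nat (ℕ → Bool)
  obtain ⟨n, hn⟩ := hg fun n ↦ !(g n n)
  have := congrFun hn n
  simp at this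

/-- A sequence of ever finer cycles of nested disks, with the numbers of disks strictly increasing.
The sequence starts with the whole disk, and the disks of each generation shrink to points. -/
structure NestedCycles (f : UnitDisk ≃ₜ UnitDisk) (C : Set UnitDisk) (k : ℕ → ℕ)
    (p : ℕ → UnitDisk → UnitDisk) : Prop where
  k_zero : k 0 = 1
  p_zero : p 0 = id
  pos : ∀ n, 0 < k n
  isEmbedding : ∀ n, IsEmbedding (p n)
  image_eq : ∀ n, (f ^ (k n : ℤ)) '' range (p n) = range (p n)
  dvd : ∀ n, ∀ i : ℤ, ∀ x y, (f ^ i) (p n x) = p n y → (k n : ℤ) ∣ i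
  nested : ∀ n x, ∃ y : UnitDisk, ‖(y : ℂ)‖ < 1 ∧ p (n + 1) x = p n y
  exists_mul : ∀ n, ∃ w : ℤ, 1 < w ∧ (k (n + 1) : ℤ) = w * k n
  small : ∀ ε > 0, ∃ N, ∀ n ≥ N, ∀ (i : ℤ) (x y), dist ((f ^ i) (p n x)) ((f ^ i) (p n y)) < ε
  mem_iff : ∀ x, x ∈ C ↔ ∀ n, ∃ (i : ℤ) (y : UnitDisk), x = (f ^ i) (p n y)

section cycles

variable {f : UnitDisk ≃ₜ UnitDisk} {C : Set UnitDisk} {U : ℕ → Set UnitDisk} {c : UnitDisk}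
  {k : ℕ → ℕ} {p : ℕ → UnitDisk → UnitDisk}

lemma antitone_of_interior
    (hint : ∀ n, ∀ x ∈ U (n + 1), (x : ℂ) ∈ interior ((↑) '' U n : Set ℂ)) : Antitone U := by
  refine antitone_nat_of_succ_le fun n y hy ↦ ?_
  obtain ⟨z, hz, hzy⟩ := interior_subset (hint n y hy)
  rwa [← Subtype.ext hzy]

lemma antitone_range_cycles (h : ∀ n, DiskCycle f (U n) c (k n) (p n))
    (hint : ∀ n, ∀ x ∈ U (n + 1), (x : ℂ) ∈ interior ((↑) '' U n : Set ℂ)) :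
    Antitone fun n ↦ range (p n) := by
  refine antitone_nat_of_succ_le fun n y hy ↦ ?_
  obtain ⟨z, hz, hzy⟩ := interior_subset ((h n).mem_interior_range (h (n + 1)) (hint n) hy)
  rwa [← Subtype.ext hzy]

/-- Distinct points of the Cantor set are eventually separated by the disks, as `U n` is eventually
contained in a union of two disjoint open sets containing one point each. -/
lemma exists_separating_cycle (hC : IsCantorSet C) (hU : (⋂ n, U n) = C)
    (h : ∀ n, DiskCycle f (U n) c (k n) (p n))
    (hint : ∀ n, ∀ x ∈ U (n + 1), (x : ℂ) ∈ interior ((↑) '' U n : Set ℂ))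
    {x y : UnitDisk} (hx : x ∈ C) (hy : y ∈ C) (hxy : x ≠ y) :
    ∃ n, ∀ i : ℤ, ¬ (x ∈ (f ^ i) '' range (p n) ∧ y ∈ (f ^ i) '' range (p n)) := by
  obtain ⟨e⟩ := hC
  have : CompactSpace C := e.symm.compactSpace
  obtain ⟨m, hm⟩ : ∃ m, e ⟨x, hx⟩ m ≠ e ⟨y, hy⟩ m := by
    by_contra! hcon
    exact hxy (congrArg Subtype.val (e.injective (funext hcon)))
  have hχ : Continuous fun z : C ↦ e z m := (continuous_apply m).comp e.continuous
  have hK : ∀ b : Bool, IsCompact (Subtype.val '' {z : C | e z m = b}) := fun b ↦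
    (((isClosed_discrete {b}).preimage hχ).isCompact).image continuous_subtype_val
  obtain ⟨O₁, O₂, hO₁, hO₂, h1, h2, hdisj⟩ :=
    SeparatedNhds.of_isCompact_isCompact (hK (e ⟨x, hx⟩ m)) (hK (e ⟨y, hy⟩ m)) (by
      rw [Set.disjoint_left]
      rintro _ ⟨z, hz, rfl⟩ ⟨z', hz', h⟩
      rw [Subtype.ext h] at hz'
      exact hm (hz.symm.trans hz'))
  have hCO : ∀ z ∈ C, z ∈ O₁ ∪ O₂ := by
    intro z hz
    by_cases hzx : e ⟨z, hz⟩ m = e ⟨x, hx⟩ m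
    · exact Or.inl (h1 ⟨⟨z, hz⟩, hzx, rfl⟩)
    · refine Or.inr (h2 ⟨⟨z, hz⟩, ?_, rfl⟩)
      change e ⟨z, hz⟩ m = e ⟨y, hy⟩ m
      revert hzx hm
      cases e ⟨z, hz⟩ m <;> cases e ⟨x, hx⟩ m <;> cases e ⟨y, hy⟩ m <;> simp
  obtain ⟨n, hn⟩ := exists_subset_nhds_of_isCompact (antitone_of_interior hint).directed_ge
    (fun n ↦ (h n).isClosed.isCompact) (U := O₁ ∪ O₂) fun z hz ↦
      (hO₁.union hO₂).mem_nhds (hCO z (hU ▸ hz))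
  refine ⟨n, fun i ⟨hxi, hyi⟩ ↦ ?_⟩
  have hsub : (f ^ i) '' range (p n) ⊆ O₁ ∪ O₂ := by
    refine Subset.trans ?_ hn
    rintro _ ⟨z, hz, rfl⟩
    exact (h n).zpow_mem ((h n).range_subset hz) i
  have h3 := ((h n).isPreconnected_range.image _
    (f ^ i).continuous.continuousOn).subset_left_of_subset_union hO₁ hO₂ hdisj hsub
    ⟨x, hxi, h1 ⟨⟨x, hx⟩, rfl, rfl⟩⟩
  exact hdisj.le_bot ⟨h3 hyi, h2 ⟨⟨y, hy⟩, rfl, rfl⟩⟩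

/-- The disks of the `n`-th cycle become uniformly small. -/
lemma cycles_small (hC : IsCantorSet C) (hU : (⋂ n, U n) = C)
    (h : ∀ n, DiskCycle f (U n) c (k n) (p n))
    (hint : ∀ n, ∀ x ∈ U (n + 1), (x : ℂ) ∈ interior ((↑) '' U n : Set ℂ)) {ε : ℝ} (hε : 0 < ε) :
    ∃ N, ∀ n ≥ N, ∀ (i : ℤ) (x y), dist ((f ^ i) (p n x)) ((f ^ i) (p n y)) < ε := by
  by_contra! hcon
  choose m hm i x y hxy using hcon
  obtain ⟨⟨a, b⟩, φ, hφ, hlim⟩ := CompactSpace.tendsto_subseq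
    (fun n ↦ ((f ^ i n) (p (m n) (x n)), (f ^ i n) (p (m n) (y n))))
  have hanti := antitone_range_cycles h hint
  have hsame : ∀ n, ∃ j : ℤ, a ∈ (f ^ j) '' range (p n) ∧ b ∈ (f ^ j) '' range (p n) := by
    intro n
    have hclosed : IsClosed (⋃ j ∈ Finset.range (k n), ((f ^ (j : ℤ)) '' range (p n)) ×ˢ
        ((f ^ (j : ℤ)) '' range (p n))) := by
      refine isClosed_biUnion_finset fun j _ ↦ ?_
      have h1 := ((f ^ (j : ℤ)).isClosed_image).mpr (h n).isCompact_range.isClosed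
      exact h1.prod h1
    have hmem := hclosed.mem_of_tendsto hlim (by
      filter_upwards [eventually_ge_atTop n] with l hl
      have hk : (k n : ℤ) ≠ 0 := by exact_mod_cast (h n).pos.ne'
      have hmod := Int.emod_nonneg (i (φ l)) hk
      have hlt := Int.emod_lt_of_pos (i (φ l)) (by exact_mod_cast (h n).pos : (0 : ℤ) < k n)
      have himage : (f ^ i (φ l)) '' range (p n) =
          (f ^ (((i (φ l) % k n).toNat : ℕ) : ℤ)) '' range (p n) := by
        rw [Int.toNat_of_nonneg hmod]
        conv_lhs => rw [← Int.emod_add_mul_ediv (i (φ l)) (k n)]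
        exact (h n).image_zpow_add_mul _ _
      have hle : n ≤ m (φ l) := (hl.trans (hφ.id_le l)).trans (hm (φ l))
      refine mem_biUnion (x := (i (φ l) % k n).toNat) ?_ ?_
      · simp only [Finset.coe_range, mem_Iio]
        omega
      · rw [← himage]
        exact ⟨mem_image_of_mem _ (hanti hle (mem_range_self _)),
          mem_image_of_mem _ (hanti hle (mem_range_self _))⟩)
    obtain ⟨j, -, hj⟩ := mem_iUnion₂.mp hmem
    exact ⟨j, hj.1, hj.2⟩
  have hab : ε ≤ dist a b := by
    refine ge_of_tendsto (Tendsto.dist ((continuous_fst.tendsto _).comp hlim)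
      ((continuous_snd.tendsto _).comp hlim)) (Eventually.of_forall fun l ↦ hxy (φ l))
  have hCmem : ∀ z, (∀ n, ∃ j : ℤ, z ∈ (f ^ j) '' range (p n)) → z ∈ C := by
    intro z hz
    rw [← hU]
    refine mem_iInter.mpr fun n ↦ ?_
    obtain ⟨j, hj⟩ := hz n
    rw [(h n).eq_iUnion]
    exact mem_iUnion.mpr ⟨j, hj⟩
  have hne : a ≠ b := by
    rintro rfl
    rw [dist_self] at hab
    exact hab.not_gt hε
  obtain ⟨n, hn⟩ := exists_separating_cycle hC hU h hint
    (hCmem a fun n ↦ (hsame n).imp fun _ h ↦ h.1) (hCmem b fun n ↦ (hsame n).imp fun _ h ↦ h.2) hne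
  obtain ⟨j, hj⟩ := hsame n
  exact hn j hj

lemma cycles_dvd (h : ∀ n, DiskCycle f (U n) c (k n) (p n))
    (hint : ∀ n, ∀ x ∈ U (n + 1), (x : ℂ) ∈ interior ((↑) '' U n : Set ℂ)) {m n : ℕ}
    (hmn : m ≤ n) : k m ∣ k n := by
  have hanti := antitone_range_cycles h hint
  obtain ⟨x, hx⟩ := hanti hmn (h n).mem
  have h1 : (f ^ (k n : ℤ)) c ∈ range (p n) := by
    rw [← (h n).image_eq]
    exact mem_image_of_mem _ (h n).mem
  obtain ⟨y, hy⟩ := hanti hmn h1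
  exact_mod_cast (h m).dvd (k n) x y (by rw [hx, hy])

/-- The numbers of disks are unbounded: otherwise the Cantor set would be contained in an orbit
of `f`. -/
lemma cycles_unbounded (hC : IsCantorSet C) (hU : (⋂ n, U n) = C)
    (h : ∀ n, DiskCycle f (U n) c (k n) (p n))
    (hint : ∀ n, ∀ x ∈ U (n + 1), (x : ℂ) ∈ interior ((↑) '' U n : Set ℂ)) (n : ℕ) :
    ∃ m > n, k n < k m := by
  by_contra! hcon
  have hanti := antitone_range_cycles h hint
  have hk : ∀ m ≥ n, k m = k n := by
    intro m hm
    rcases hm.lt_or_eq with h1 | h1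
    · exact le_antisymm (hcon m h1) (Nat.le_of_dvd (h m).pos (cycles_dvd h hint hm))
    · rw [h1]
  have hsub : C ⊆ range fun i : ℤ ↦ (f ^ i) c := by
    intro y hy
    have hyU : ∀ m, y ∈ U m := fun m ↦ mem_iInter.mp (hU ▸ hy) m
    have hyn := hyU n
    rw [(h n).eq_iUnion] at hyn
    obtain ⟨i, hi⟩ := mem_iUnion.mp hyn
    have hym : ∀ m ≥ n, y ∈ (f ^ i) '' range (p m) := by
      intro m hm
      have hym := hyU m
      rw [(h m).eq_iUnion] at hym
      obtain ⟨j, a, ha, hja⟩ := mem_iUnion.mp hym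
      obtain ⟨b, hb, hib⟩ := hi
      obtain ⟨a', ha'⟩ := hanti hm ha
      obtain ⟨b', hb'⟩ := hb
      obtain ⟨l, hl⟩ : (k n : ℤ) ∣ j - i := by
        refine (h n).dvd (j - i) a' b' ?_
        rw [ha', hb', sub_eq_neg_add, zpow_add_apply, hja, ← hib, ← zpow_add_apply]
        simp
      rw [← hk m hm] at hl
      have := (h m).image_zpow_add_mul i l
      rw [← hl, add_sub_cancel] at this
      rw [← this]
      exact ⟨a, ha, hja⟩
    refine ⟨i, ?_⟩
    by_contra hne
    have hcC : (f ^ i) c ∈ C := by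
      rw [← hU]
      exact mem_iInter.mpr fun m ↦ (h m).zpow_mem ((h m).range_subset (h m).mem) i
    obtain ⟨m, hm⟩ := exists_separating_cycle hC hU h hint hcC hy hne
    refine hm i ⟨mem_image_of_mem _ (h m).mem, ?_⟩
    exact image_mono (hanti (le_max_left m n)) (hym (max m n) (le_max_right m n))
  have hcount : C.Countable := (countable_range _).mono hsub
  obtain ⟨e⟩ := hC
  have := uncountable_nat_bool
  have := hcount.to_subtype
  have : Countable (ℕ → Bool) := e.surjective.countable
  exact not_countable (α := ℕ → Bool) this

end cycles

lemma FactorsThroughNestedDisks.exists_nestedCycles {f : UnitDisk ≃ₜ UnitDisk} {C : Set UnitDisk}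
    (hC : IsCantorSet C) (h : FactorsThroughNestedDisks f C) : ∃ k p, NestedCycles f C k p := by
  obtain ⟨-, U, hint, hU, hcyc⟩ := h
  obtain ⟨c, hc⟩ : C.Nonempty := by
    obtain ⟨e⟩ := hC
    exact ⟨_, (e.symm fun _ ↦ true).2⟩
  choose k p h using fun n ↦ (hcyc n).exists_diskCycle (mem_iInter.mp (hU ▸ hc) n)
  have hanti := antitone_range_cycles h hint
  choose next hnext using cycles_unbounded hC hU h hint
  let φ : ℕ → ℕ := fun n ↦ next^[n + 1] 0
  have hφ : ∀ n, φ n < φ (n + 1) ∧ k (φ n) < k (φ (n + 1)) := by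
    intro n
    have : φ (n + 1) = next (φ n) := Function.iterate_succ_apply' next (n + 1) 0
    rw [this]
    exact hnext (φ n)
  have hφmono : StrictMono φ := strictMono_nat_of_lt_succ fun n ↦ (hφ n).1
  have hφ0 : 0 < φ 0 ∧ k 0 < k (φ 0) := hnext 0
  refine ⟨fun n ↦ n.casesOn 1 fun n ↦ k (φ n), fun n ↦ n.casesOn id fun n ↦ p (φ n),
    ⟨rfl, rfl, ?_, ?_, ?_, ?_, ?_, ?_, ?_, ?_⟩⟩
  · rintro (_ | n)
    · exact one_pos
    · exact (h (φ n)).pos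
  · rintro (_ | n)
    · exact .id
    · exact (h (φ n)).isEmbedding
  · rintro (_ | n)
    · change (f ^ ((1 : ℕ) : ℤ)) '' range id = range id
      rw [range_id, image_univ, (f ^ ((1 : ℕ) : ℤ)).range_coe]
    · exact (h (φ n)).image_eq
  · rintro (_ | n)
    · exact fun i _ _ _ ↦ one_dvd i
    · exact (h (φ n)).dvd
  · rintro (_ | n) x
    · refine ⟨p (φ 0) x, ?_, rfl⟩
      have h1 : (p (φ 0) x : ℂ) ∈ interior ((↑) '' U (φ 0 - 1) : Set ℂ) := by
        refine hint _ _ ?_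
        rw [Nat.sub_add_cancel hφ0.1]
        exact (h (φ 0)).range_subset (mem_range_self x)
      have h2 : ((↑) '' U (φ 0 - 1) : Set ℂ) ⊆ Metric.closedBall 0 1 := by
        rintro _ ⟨y, -, rfl⟩
        exact y.2
      have h3 := interior_mono h2 h1
      rw [interior_closedBall _ one_ne_zero] at h3
      simpa using h3
    · have h1 : p (φ (n + 1)) x ∈ range (p (φ n + 1)) := hanti (hφ n).1 (mem_range_self x)
      have h2 := (h (φ n)).mem_interior_range (h (φ n + 1)) (hint (φ n)) h1
      obtain ⟨_, ⟨y, rfl⟩, hy⟩ := interior_subset h2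
      rw [← hy] at h2
      exact ⟨y, norm_lt_one_of_mem_interior (h (φ n)).isEmbedding h2, (Subtype.ext hy).symm⟩
  · rintro (_ | n)
    · refine ⟨k (φ 0), ?_, ?_⟩
      · have := (h 0).pos
        have := hφ0.2
        omega
      · change (k (φ 0) : ℤ) = k (φ 0) * ((1 : ℕ) : ℤ)
        simp
    · obtain ⟨w, hw⟩ := cycles_dvd h hint (hφ n).1.le
      refine ⟨w, ?_, ?_⟩
      · have h1 := (hφ n).2
        rw [hw] at h1
        have : 1 < w := by
          by_contra hcon
          have := Nat.mul_le_mul_left (k (φ n)) (not_lt.mp hcon)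
          omega
        exact_mod_cast this
      · change (k (φ (n + 1)) : ℤ) = w * k (φ n)
        rw [hw]
        push_cast
        ring
  · intro ε hε
    obtain ⟨N, hN⟩ := cycles_small hC hU h hint hε
    refine ⟨N + 1, ?_⟩
    rintro (_ | n) hn
    · omega
    · exact hN (φ n) ((Nat.le_of_succ_le_succ hn).trans (hφmono.id_le n))
  · intro x
    rw [← hU]
    constructor
    · rintro hx (_ | n)
      · exact ⟨0, x, by simp⟩
      · have h1 := mem_iInter.mp hx (φ n)
        rw [(h (φ n)).eq_iUnion] at h1
        obtain ⟨i, _, ⟨y, rfl⟩, hy⟩ := mem_iUnion.mp h1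
        exact ⟨i, y, hy.symm⟩
    · intro hx
      refine mem_iInter.mpr fun n ↦ antitone_of_interior hint (hφmono.id_le n) ?_
      obtain ⟨i, y, hy⟩ := hx (n + 1)
      rw [(h (φ n)).eq_iUnion]
      exact mem_iUnion.mpr ⟨i, _, mem_range_self y, hy.symm⟩

/-! ### Solid tori swept out by cyclically permuted disks -/

/-- A map with period `1` in the time variable descends to the circle. -/
lemma exists_continuous_descend {X Y : Type*} [TopologicalSpace X] [TopologicalSpace Y]
    {g : X × ℝ → Y} (hg : Continuous g) (hper : ∀ x s, g (x, s + 1) = g (x, s)) :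
    ∃ G : X × Circle → Y, Continuous G ∧ ∀ x s, G (x, rot s) = g (x, s) := by
  choose t ht using exists_rot_eq
  have hG : ∀ x s, g (x, t (rot s)) = g (x, s) := by
    intro x s
    obtain ⟨n, hn⟩ := rot_eq_rot_iff.mp (ht (rot s))
    have h1 := fun r ↦ (show Function.Periodic (fun s ↦ g (x, s)) 1 from hper x).int_mul n r
    rw [hn]
    simpa using h1 s
  refine ⟨fun q ↦ g (q.1, t q.2), ?_, hG⟩
  have hq := (IsOpenQuotientMap.id (X := X)).prodMap isOpenQuotientMap_rot
  rw [hq.isQuotientMap.continuous_iff]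
  exact hg.congr fun q ↦ (hG q.1 q.2).symm

/-- The mapping torus of `f ^ k` restricted to an embedded disk with period `k`, as a solid torus
winding `k` times around. -/
lemma exists_swept_torus {f : UnitDisk ≃ₜ UnitDisk} {F : ℝ → UnitDisk ≃ₜ UnitDisk}
    (hF : Continuous fun q : ℝ × UnitDisk ↦ F q.1 q.2) (hF0 : ∀ x, F 0 x = x)
    (hFf : ∀ (n : ℤ) (t : ℝ) (x : UnitDisk), F (t + n) x = F t ((f ^ n) x))
    {p : UnitDisk → UnitDisk} (hp : IsEmbedding p) {k : ℕ} (hk : 0 < k)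
    (himage : (f ^ (k : ℤ)) '' range p = range p)
    (hdvd : ∀ i : ℤ, ∀ x y, (f ^ i) (p x) = p y → (k : ℤ) ∣ i) :
    ∃ (ψ : SolidTorus → SolidTorus) (R : ℝ → UnitDisk ≃ₜ UnitDisk), IsEmbedding ψ ∧
      ∀ x s, ψ (x, rot s) = (F (k * s) (p (R s x)), rot (k * s)) := by
  let e := hp.toHomeomorph
  let q : UnitDisk ≃ₜ UnitDisk := (e.trans ((f ^ (k : ℤ)).image (range p))).trans
    ((Homeomorph.setCongr himage).trans e.symm)
  have hq : ∀ x, p (q x) = (f ^ (k : ℤ)) (p x) := by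
    intro x
    have h1 : ∀ y : range p, p (e.symm y) = y := fun y ↦ congrArg Subtype.val (e.apply_symm_apply y)
    exact h1 _
  have hFk : Continuous fun q : ℝ × UnitDisk ↦ F (k * q.1) q.2 :=
    hF.comp ((continuous_const.mul continuous_fst).prodMk continuous_snd)
  have hor : IsOrientationPreserving q :=
    isOrientationPreserving_of_isotopy hp.continuous hp.injective (G := fun s ↦ F (k * s))
      hFk (fun x ↦ by simp [hF0]) (fun x ↦ by
        have := hFf k 0 (p x)
        rw [zero_add, hF0, Int.cast_natCast] at this
        rw [hq, mul_one, this])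
  obtain ⟨Q₀, hQ₀, hQ₀0, hQ₀1⟩ := hor.exists_isotopy
  obtain ⟨Q, hQ, -, hQq⟩ := exists_isotopy_real hQ₀ hQ₀0 hQ₀1
  have hQs : ∀ s x, (Q (s + 1)).symm x = q.symm ((Q s).symm x) := by
    intro s x
    have := hQq 1 s (q.symm ((Q s).symm x))
    rw [Int.cast_one, zpow_one, Homeomorph.apply_symm_apply, Homeomorph.apply_symm_apply] at this
    rw [Homeomorph.symm_apply_eq, this]
  let g : UnitDisk × ℝ → SolidTorus := fun r ↦ (F (k * r.2) (p ((Q r.2).symm r.1)), rot (k * r.2))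
  have hg : Continuous g := by
    refine Continuous.prodMk ?_ (continuous_rot.comp (continuous_const.mul continuous_snd))
    exact hFk.comp (continuous_snd.prodMk (hp.continuous.comp
      ((continuous_family_symm hQ).comp (continuous_snd.prodMk continuous_fst))))
  have hper : ∀ x s, g (x, s + 1) = g (x, s) := by
    intro x s
    have h1 : (k : ℝ) * (s + 1) = k * s + (k : ℤ) := by push_cast; ring
    have h2 : rot (k * s + (k : ℤ)) = rot (k * s) := rot_eq_rot_iff.mpr ⟨k, rfl⟩
    simp only [g, h1, h2, hQs, hFf, ← hq, Homeomorph.apply_symm_apply]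
  obtain ⟨ψ, hψ, hψg⟩ := exists_continuous_descend hg hper
  refine ⟨ψ, fun s ↦ (Q s).symm, ?_, hψg⟩
  have hinj : Function.Injective ψ := by
    rintro ⟨x, z⟩ ⟨y, z'⟩ h
    obtain ⟨s, rfl⟩ := exists_rot_eq z
    obtain ⟨t, rfl⟩ := exists_rot_eq z'
    have h1 := h
    rw [hψg, hψg] at h1
    simp only [g, Prod.mk.injEq] at h1
    obtain ⟨n, hn⟩ := rot_eq_rot_iff.mp h1.2
    rw [hn, hFf] at h1
    obtain ⟨j, rfl⟩ := hdvd n _ _ ((F (k * t)).injective h1.1)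
    have hst : rot s = rot t := by
      refine rot_eq_rot_iff.mpr ⟨j, ?_⟩
      have hk0 : (k : ℝ) ≠ 0 := by exact_mod_cast hk.ne'
      push_cast at hn
      exact mul_left_cancel₀ hk0 (by linear_combination hn)
    rw [hst] at h ⊢
    rw [hψg, hψg] at h
    simp only [g, Prod.mk.injEq, and_true] at h
    rw [(Q t).symm.injective (hp.injective ((F (k * t)).injective h))]
  exact (hψ.isClosedEmbedding hinj).isEmbedding

/-- The suspension of a Cantor set which is the intersection of nested cycles of disks is a standard
solenoid: the disks of the `n`-th generation sweep out the `n`-th solid torus. -/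
theorem NestedCycles.isStandardSolenoid {f : UnitDisk ≃ₜ UnitDisk} {C : Set UnitDisk} {k : ℕ → ℕ}
    {p : ℕ → UnitDisk → UnitDisk} (h : NestedCycles f C k p) {F : ℝ → UnitDisk ≃ₜ UnitDisk}
    (hF : Continuous fun q : ℝ × UnitDisk ↦ F q.1 q.2) (hF0 : ∀ x, F 0 x = x)
    (hFf : ∀ (n : ℤ) (t : ℝ) (x : UnitDisk), F (t + n) x = F t ((f ^ n) x)) :
    IsStandardSolenoid {y : SolidTorus | ∃ x ∈ C, ∃ t : ℝ, y = (F t x, rot t)} := by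
  have hex : ∀ n, ∃ (ψ : SolidTorus → SolidTorus) (R : ℝ → UnitDisk ≃ₜ UnitDisk), IsEmbedding ψ ∧
      (∀ x s, ψ (x, rot s) = (F (k n * s) (p n (R s x)), rot (k n * s))) ∧ (n = 0 → ψ = id) := by
    intro n
    rcases Nat.eq_zero_or_pos n with rfl | hn
    · refine ⟨id, fun s ↦ (F s).symm, .id, fun x s ↦ ?_, fun _ ↦ rfl⟩
      simp [h.k_zero, h.p_zero]
    · obtain ⟨ψ, R, h1, h2⟩ := exists_swept_torus hF hF0 hFf (h.isEmbedding n) (h.pos n)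
        (h.image_eq n) (h.dvd n)
      exact ⟨ψ, R, h1, h2, fun h ↦ absurd h hn.ne'⟩
  choose ψ R hψ hψR hψ0 using hex
  choose w hw1 hwk using h.exists_mul
  have hstep : ∀ n (x : SolidTorus), ∃ y : SolidTorus, ‖(y.1 : ℂ)‖ < 1 ∧ ψ (n + 1) x = ψ n y ∧
      y.2 = x.2 ^ w n := by
    rintro n ⟨x, z⟩
    obtain ⟨s, rfl⟩ := exists_rot_eq z
    obtain ⟨y, hy, hpy⟩ := h.nested n (R (n + 1) s x)
    refine ⟨((R n (w n * s)).symm y, rot (w n * s)), ?_, ?_, ?_⟩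
    · exact (norm_homeomorph_lt_one_iff _ y).mpr hy
    · have hk : (k (n + 1) : ℝ) * s = k n * (w n * s) := by
        have : (k (n + 1) : ℝ) = w n * k n := by exact_mod_cast hwk n
        rw [this]
        ring
      rw [hψR, hψR, Homeomorph.apply_symm_apply, hpy, hk]
    · exact (rot_zpow s (w n)).symm
  choose e he1 heψ he2 using hstep
  have hiter : ∀ n, iteratedBraid e n = ψ n := by
    intro n
    induction n with
    | zero => exact (hψ0 0 rfl).symm
    | succ n ih =>
      funext x
      change iteratedBraid e n (e n x) = _
      rw [ih, heψ]
  refine ⟨e, w, fun n ↦ ⟨hw1 n, ?_, he1 n, he2 n⟩, ?_, ?_⟩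
  · have hc : ψ n ∘ e n = ψ (n + 1) := funext fun x ↦ (heψ n x).symm
    refine IsEmbedding.of_comp ?_ (hψ n).continuous (hc ▸ hψ (n + 1))
    rw [(hψ n).continuous_iff, hc]
    exact (hψ (n + 1)).continuous
  · simp_rw [hiter]
    rw [Metric.tendstoUniformly_iff]
    intro ε hε
    -- uniform continuity of the isotopy over one period controls all times
    have hunif : ∃ δ > 0, ∀ t ∈ Icc (0 : ℝ) 1, ∀ x y : UnitDisk, dist x y < δ →
        dist (F t x) (F t y) < ε / 2 := by
      have h1 : UniformContinuousOn (fun q : ℝ × UnitDisk ↦ F q.1 q.2) (Icc (0 : ℝ) 1 ×ˢ univ) :=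
        (isCompact_Icc.prod isCompact_univ).uniformContinuousOn_of_continuous hF.continuousOn
      obtain ⟨δ, hδ, h2⟩ := Metric.uniformContinuousOn_iff.mp h1 (ε / 2) (half_pos hε)
      refine ⟨δ, hδ, fun t ht x y hxy ↦ h2 (t, x) ⟨ht, mem_univ _⟩ (t, y) ⟨ht, mem_univ _⟩ ?_⟩
      rw [Prod.dist_eq, max_lt_iff]
      exact ⟨by simpa using hδ, hxy⟩
    obtain ⟨δ, hδ, hFδ⟩ := hunif
    obtain ⟨N, hN⟩ := h.small δ hδ
    filter_upwards [eventually_ge_atTop N] with n hn z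
    obtain ⟨s, rfl⟩ := exists_rot_eq z
    have hle : Metric.diam (ψ n '' {p : SolidTorus | p.2 = rot s}) ≤ ε / 2 := by
      refine Metric.diam_le_of_forall_dist_le (by positivity) ?_
      rintro _ ⟨⟨x, z⟩, rfl, rfl⟩ _ ⟨⟨y, z'⟩, hz', rfl⟩
      obtain rfl : z' = rot s := hz'
      rw [hψR, hψR, Prod.dist_eq, dist_self, max_le_iff]
      refine ⟨?_, by positivity⟩
      have h1 : (k n : ℝ) * s = Int.fract ((k n : ℝ) * s) + (⌊(k n : ℝ) * s⌋ : ℤ) :=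
        (Int.fract_add_floor _).symm
      rw [h1, hFf, hFf]
      exact (hFδ _ ⟨Int.fract_nonneg _, (Int.fract_lt_one _).le⟩ _ _ (hN n hn _ _ _)).le
    rw [Real.dist_eq, zero_sub, abs_neg, abs_of_nonneg Metric.diam_nonneg]
    linarith
  · simp_rw [hiter]
    ext ⟨y, z⟩
    simp only [mem_ofPred_eq, mem_iInter, mem_range]
    constructor
    · rintro ⟨x, hx, t, hxt⟩ n
      obtain ⟨i, v, hv⟩ := (h.mem_iff x).mp hx n
      have hk0 : (k n : ℝ) ≠ 0 := by exact_mod_cast (h.pos n).ne'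
      refine ⟨((R n ((t + i) / k n)).symm v, rot ((t + i) / k n)), ?_⟩
      rw [hψR, Homeomorph.apply_symm_apply, mul_div_cancel₀ _ hk0, hFf, ← hv, hxt,
        rot_eq_rot_iff.mpr ⟨i, rfl⟩]
    · intro hy
      obtain ⟨t, rfl⟩ := exists_rot_eq z
      refine ⟨(F t).symm y, (h.mem_iff _).mpr fun n ↦ ?_, t, by simp⟩
      obtain ⟨⟨v, z⟩, hv⟩ := hy n
      obtain ⟨s, rfl⟩ := exists_rot_eq z
      rw [hψR, Prod.mk.injEq] at hv
      obtain ⟨i, hi⟩ := rot_eq_rot_iff.mp hv.2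
      refine ⟨i, R n s v, ?_⟩
      rw [Homeomorph.symm_apply_eq, ← hv.1, hi, hFf]

/-- A neighbourhood of the shape of a mapping torus exhibits a solenoid as tame. -/
theorem isTame_of_mappingTorus {S N : Set Sphere3} (hN : S ⊆ N) {C : Set UnitDisk}
    {f : UnitDisk ≃ₜ UnitDisk} (hC : IsCantorSet C) (hf : FactorsThroughNestedDisks f C)
    (h : PairHomeomorphic ((↑) ⁻¹' S : Set N) (mappingTorusOf f C)) : IsTame S := by
  obtain ⟨k, p, hkp⟩ := hf.exists_nestedCycles hC
  obtain ⟨F₀, hF₀, hF₀0, hF₀1⟩ := hf.1.exists_isotopy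
  obtain ⟨F, hF, hF0, hFf⟩ := exists_isotopy_real hF₀ hF₀0 hF₀1
  have hF1 : ∀ x, F 1 x = f x := fun x ↦ by
    have := hFf 1 0 x
    rwa [zero_add, hF0, Int.cast_one, zpow_one] at this
  obtain ⟨H, hH⟩ := exists_homeomorph_mappingTorus hF hF0 hF1
  obtain ⟨φ, hφ⟩ := h
  refine ⟨fun x ↦ (φ.symm (H.symm x) : Sphere3), H '' mappingTorusOf f C,
    IsEmbedding.subtypeVal.comp (φ.symm.isEmbedding.comp H.symm.isEmbedding), ?_, ?_⟩
  · refine ⟨_, ?_, Homeomorph.refl _, image_id _⟩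
    convert hkp.isStandardSolenoid hF hF0 hFf using 1
    ext ⟨y, z⟩
    constructor
    · rintro ⟨_, ⟨⟨x, t⟩, ⟨hx, -⟩, rfl⟩, hxy⟩
      rw [hH] at hxy
      exact ⟨x, hx, t, hxy.symm⟩
    · rintro ⟨x, hx, t, hxy⟩
      have hfz : ∀ n : ℤ, (f ^ n) x ∈ C := by
        refine fun n ↦ (hkp.mem_iff _).mpr fun m ↦ ?_
        obtain ⟨i, v, hv⟩ := (hkp.mem_iff x).mp hx m
        exact ⟨n + i, v, by rw [zpow_add_apply, ← hv]⟩
      refine ⟨_, ⟨((f ^ ⌊t⌋) x, ⟨Int.fract t, Int.fract_nonneg t, (Int.fract_lt_one t).le⟩),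
        ⟨hfz _, mem_univ _⟩, rfl⟩, ?_⟩
      rw [hH, ← hFf, Int.fract_add_floor, hxy, Prod.mk.injEq]
      exact ⟨rfl, rot_eq_rot_iff.mpr ⟨-⌊t⌋, by
        have := Int.fract_add_floor t
        push_cast
        linarith⟩⟩
  · rw [← hφ]
    ext y
    simp only [mem_image, exists_exists_and_eq_and, Homeomorph.symm_apply_apply]
    constructor
    · rintro ⟨x, hx, rfl⟩
      exact hx
    · intro hy
      exact ⟨⟨y, hN hy⟩, hy, rfl⟩

/-! ### A characterization of the Cantor set -/

section cantor

variable {X : Type*}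

/-- The piece of `V` on the side `b` of the set `s`. -/
def splitPiece (s V : Set X) (b : Bool) : Set X := if b then V ∩ s else V \ s

/-- The pieces of the space obtained by splitting successively, the piece `V` of generation `n`
being split by `s n V`, and following the sides prescribed by `a`. -/
def splitScheme (s : ℕ → Set X → Set X) (a : ℕ → Bool) : ℕ → Set X
  | 0 => univ
  | n + 1 => splitPiece (s n (splitScheme s a n)) (splitScheme s a n) (a n)

open Classical in
/-- The pieces of the splitting scheme which contain `x`. -/
noncomputable def splitPieceOf (s : ℕ → Set X → Set X) (x : X) : ℕ → Set X
  | 0 => univ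
  | n + 1 => splitPiece (s n (splitPieceOf s x n)) (splitPieceOf s x n)
      (decide (x ∈ s n (splitPieceOf s x n)))

variable [TopologicalSpace X]

/-- Brouwer's characterization of the Cantor set: a compact space with a sequence of clopen sets
separating its points, and without isolated points. The space is split successively, the `n`-th
clopen set of the sequence being used in generation `n` for all pieces which it splits. -/
theorem nonempty_homeomorph_nat_bool [CompactSpace X] [Nonempty X] (B : ℕ → Set X)
    (hB : ∀ n, IsClopen (B n)) (hsep : ∀ x y, x ≠ y → ∃ n, x ∈ B n ∧ y ∉ B n)
    (hperf : ∀ V : Set X, IsClopen V → V.Nonempty → V.Nontrivial) :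
    Nonempty (X ≃ₜ (ℕ → Bool)) := by
  classical
  have hs : ∀ (n : ℕ) (V : Set X), ∃ W : Set X, IsClopen W ∧
      (IsClopen V → V.Nonempty → (V ∩ W).Nonempty ∧ (V \ W).Nonempty) ∧
      ((V ∩ B n).Nonempty → (V \ B n).Nonempty → W = B n) := by
    intro n V
    by_cases h : (V ∩ B n).Nonempty ∧ (V \ B n).Nonempty
    · exact ⟨B n, hB n, fun _ _ ↦ h, fun _ _ ↦ rfl⟩
    · by_cases hV : IsClopen V ∧ V.Nonempty
      · obtain ⟨x, hx, y, hy, hxy⟩ := hperf V hV.1 hV.2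
        obtain ⟨m, hxm, hym⟩ := hsep x y hxy
        exact ⟨B m, hB m, fun _ _ ↦ ⟨⟨x, hx, hxm⟩, ⟨y, hy, hym⟩⟩, fun h1 h2 ↦ absurd ⟨h1, h2⟩ h⟩
      · exact ⟨∅, isClopen_empty, fun h1 h2 ↦ absurd ⟨h1, h2⟩ hV, fun h1 h2 ↦ absurd ⟨h1, h2⟩ h⟩
  choose s hsc hsplit hsB using hs
  have hA : ∀ a n, IsClopen (splitScheme s a n) ∧ (splitScheme s a n).Nonempty := by
    intro a n
    induction n with
    | zero => exact ⟨isClopen_univ, univ_nonempty⟩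
    | succ n ih =>
      have h1 := hsplit n _ ih.1 ih.2
      simp only [splitScheme, splitPiece]
      split_ifs
      · exact ⟨ih.1.inter (hsc n _), h1.1⟩
      · exact ⟨ih.1.diff (hsc n _), h1.2⟩
  let code : X → ℕ → Bool := fun x n ↦ decide (x ∈ s n (splitPieceOf s x n))
  have hV : ∀ x n, splitPieceOf s x n = splitScheme s (code x) n := by
    intro x n
    induction n with
    | zero => rfl
    | succ n ih =>
      simp only [splitPieceOf, splitScheme, ← ih]
      rfl
  have hmem : ∀ x n, x ∈ splitPieceOf s x n := by
    intro x n
    induction n with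
    | zero => trivial
    | succ n ih =>
      simp only [splitPieceOf, splitPiece, decide_eq_true_eq]
      split_ifs with h
      · exact ⟨ih, h⟩
      · exact ⟨ih, h⟩
  have hloc : ∀ n x, ∀ᶠ y in 𝓝 x,
      splitPieceOf s y n = splitPieceOf s x n ∧ code y n = code x n := by
    have hstep : ∀ n x, (∀ᶠ y in 𝓝 x, splitPieceOf s y n = splitPieceOf s x n) →
        ∀ᶠ y in 𝓝 x, code y n = code x n := by
      intro n x h
      have h1 : ∀ᶠ y in 𝓝 x, (y ∈ s n (splitPieceOf s x n) ↔ x ∈ s n (splitPieceOf s x n)) := by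
        by_cases hx : x ∈ s n (splitPieceOf s x n)
        · filter_upwards [(hsc n _).isOpen.mem_nhds hx] with y hy
          simp [hx, hy]
        · filter_upwards [(hsc n _).compl.isOpen.mem_nhds hx] with y hy
          simp only [hx, iff_false]
          exact hy
      filter_upwards [h, h1] with y hy1 hy2
      simp only [code, hy1, decide_eq_decide]
      exact hy2
    intro n
    induction n with
    | zero =>
      intro x
      have h0 : ∀ᶠ y in 𝓝 x, splitPieceOf s y 0 = splitPieceOf s x 0 :=
        Eventually.of_forall fun _ ↦ rfl
      exact h0.and (hstep 0 x h0)
    | succ n ih =>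
      intro x
      have h1 : ∀ᶠ y in 𝓝 x, splitPieceOf s y (n + 1) = splitPieceOf s x (n + 1) := by
        filter_upwards [ih x] with y hy
        have h2 : splitPieceOf s y (n + 1) =
          splitPiece (s n (splitPieceOf s y n)) (splitPieceOf s y n) (code y n) := rfl
        rw [h2, hy.1, hy.2]
        rfl
      exact h1.and (hstep _ x h1)
  have hcont : Continuous code := by
    refine continuous_pi fun n ↦ ?_
    refine (IsLocallyConstant.iff_eventually_eq _ |>.mpr fun x ↦ ?_).continuous
    exact (hloc n x).mono fun y hy ↦ hy.2
  have hinj : Function.Injective code := by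
    intro x y hxy
    by_contra hne
    obtain ⟨n, hxn, hyn⟩ := hsep x y hne
    have h1 : splitPieceOf s x n = splitPieceOf s y n := by rw [hV, hV, hxy]
    have h2 := hsB n (splitPieceOf s x n) ⟨x, hmem x n, hxn⟩ ⟨y, h1 ▸ hmem y n, hyn⟩
    have h3 := congrFun hxy n
    simp only [code, ← h1, h2, hxn, hyn] at h3
    simp at h3
  have hsurj : Function.Surjective code := by
    intro a
    have hsub : ∀ n, splitScheme s a (n + 1) ⊆ splitScheme s a n := by
      intro n
      simp only [splitScheme, splitPiece]
      split_ifs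
      · exact inter_subset_left
      · exact sdiff_subset
    obtain ⟨x, hx⟩ := IsCompact.nonempty_iInter_of_sequence_nonempty_isCompact_isClosed
      (splitScheme s a) hsub (fun n ↦ (hA a n).2) (hA a 0).1.isClosed.isCompact
      fun n ↦ (hA a n).1.isClosed
    rw [mem_iInter] at hx
    have hstep : ∀ n, splitPieceOf s x n = splitScheme s a n → code x n = a n := by
      intro n h
      have h1 := hx (n + 1)
      simp only [splitScheme, splitPiece] at h1
      simp only [code, h]
      cases ha : a n <;> rw [ha] at h1
      · simpa using h1.2
      · simpa using h1.2
    have hall : ∀ n, splitPieceOf s x n = splitScheme s a n := by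
      intro n
      induction n with
      | zero => rfl
      | succ n ih =>
        have h2 : splitPieceOf s x (n + 1) =
          splitPiece (s n (splitPieceOf s x n)) (splitPieceOf s x n) (code x n) := rfl
        rw [h2, hstep n ih, ih]
        rfl
    exact ⟨x, funext fun n ↦ hstep n (hall n)⟩
  exact ⟨hcont.homeoOfEquivCompactToT2 (f := Equiv.ofBijective code ⟨hinj, hsurj⟩)⟩

end cantor

/-! ### Pushing small round disks along paths -/

/-- A radial homeomorphism of the disk squeezing a given concentric disk into a small one. -/
lemma exists_radial_squeeze {r : ℝ} (hr : r < 1) {ε : ℝ} (hε : 0 < ε) :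
    ∃ S : UnitDisk ≃ₜ UnitDisk, (∀ x : UnitDisk, ‖(x : ℂ)‖ = 1 → S x = x) ∧
      ∀ x : UnitDisk, ‖(x : ℂ)‖ ≤ r → ‖(S x : ℂ)‖ ≤ ε := by
  obtain ⟨m, hm⟩ : ∃ m : ℕ, (max r 0) ^ m < ε := exists_pow_lt_of_lt_one hε (by simp [hr])
  have hnorm : ∀ x : ℂ, ‖((‖x‖ ^ m : ℝ) : ℂ) * x‖ = ‖x‖ ^ (m + 1) := by
    intro x
    rw [norm_mul, Complex.norm_real, Real.norm_eq_abs, abs_of_nonneg (by positivity), pow_succ]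
  let s : UnitDisk → UnitDisk := fun x ↦ ⟨((‖(x : ℂ)‖ ^ m : ℝ) : ℂ) * x, by
    rw [mem_closedBall_zero_iff, hnorm]
    exact pow_le_one₀ (norm_nonneg _) x.norm_le⟩
  have hsc : Continuous s := by
    refine Continuous.subtype_mk ?_ _
    fun_prop
  have hinj : Function.Injective s := by
    intro x y h
    have h1 : ((‖(x : ℂ)‖ ^ m : ℝ) : ℂ) * x = ((‖(y : ℂ)‖ ^ m : ℝ) : ℂ) * y :=
      congrArg Subtype.val h
    have h2 : ‖(x : ℂ)‖ = ‖(y : ℂ)‖ := by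
      have h3 := congrArg norm h1
      rw [hnorm, hnorm] at h3
      exact (pow_left_inj₀ (norm_nonneg _) (norm_nonneg _) (Nat.succ_ne_zero m)).mp h3
    rw [h2] at h1
    refine Subtype.ext ?_
    rcases (norm_nonneg (y : ℂ)).eq_or_lt with h3 | h3
    · rw [norm_eq_zero.mp h3.symm, norm_eq_zero.mp (h2.trans h3.symm)]
    · refine mul_left_cancel₀ ?_ h1
      exact_mod_cast (pow_pos h3 m).ne'
  have hsurj : Function.Surjective s := by
    intro y
    rcases (norm_nonneg (y : ℂ)).eq_or_lt with h3 | h3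
    · refine ⟨y, Subtype.ext ?_⟩
      change ((‖(y : ℂ)‖ ^ m : ℝ) : ℂ) * y = y
      rw [norm_eq_zero.mp h3.symm, mul_zero]
    · -- the norm of the preimage is the `m + 1`-st root of the norm of `y`
      set ρ : ℝ := ‖(y : ℂ)‖ ^ (((m + 1 : ℕ) : ℝ)⁻¹) with hρ
      have hρ0 : 0 < ρ := Real.rpow_pos_of_pos h3 _
      have hρm : ρ ^ (m + 1) = ‖(y : ℂ)‖ :=
        Real.rpow_inv_natCast_pow (norm_nonneg _) (Nat.succ_ne_zero m)
      have hy0 : (‖(y : ℂ)‖ : ℂ) ≠ 0 := by exact_mod_cast h3.ne'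
      have hn : ‖((ρ : ℂ) / ‖(y : ℂ)‖) * y‖ = ρ := by
        rw [norm_mul, norm_div, Complex.norm_real, Complex.norm_real, norm_norm, Real.norm_eq_abs,
          abs_of_pos hρ0, div_mul_cancel₀ _ h3.ne']
      have hρ1 : ρ ≤ 1 := Real.rpow_le_one (norm_nonneg _) y.norm_le (by positivity)
      refine ⟨⟨((ρ : ℂ) / ‖(y : ℂ)‖) * y, by rw [mem_closedBall_zero_iff, hn]; exact hρ1⟩,
        Subtype.ext ?_⟩
      change ((‖((ρ : ℂ) / ‖(y : ℂ)‖) * y‖ ^ m : ℝ) : ℂ) * (((ρ : ℂ) / ‖(y : ℂ)‖) * y) = y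
      have h4 : ((ρ : ℂ)) ^ (m + 1) = (‖(y : ℂ)‖ : ℂ) := by exact_mod_cast hρm
      rw [hn, Complex.ofReal_pow, ← mul_assoc, ← mul_div_assoc, ← pow_succ, h4, div_self hy0,
        one_mul]
  refine ⟨hsc.homeoOfEquivCompactToT2 (f := Equiv.ofBijective s ⟨hinj, hsurj⟩), fun x hx ↦ ?_,
    fun x hx ↦ ?_⟩
  · refine Subtype.ext ?_
    change ((‖(x : ℂ)‖ ^ m : ℝ) : ℂ) * x = x
    simp [hx]
  · change ‖((‖(x : ℂ)‖ ^ m : ℝ) : ℂ) * x‖ ≤ ε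
    rw [hnorm, pow_succ]
    have h1 : ‖(x : ℂ)‖ ^ m ≤ (max r 0) ^ m :=
      pow_le_pow_left₀ (norm_nonneg _) (hx.trans (le_max_left _ _)) m
    exact (mul_le_of_le_one_right (by positivity) x.norm_le).trans (h1.trans hm.le)

lemma abs_clamp_sub_clamp_le (a b : ℝ) : |clamp a - clamp b| ≤ |a - b| := by
  unfold clamp
  exact (abs_max_sub_max_le_max 0 _ 0 _).trans (max_le (by simp)
    ((abs_min_sub_min_le_max 1 a 1 b).trans (max_le (by simp) le_rfl)))

section push

variable {ι : Type*} [Fintype ι]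

/-- A displacement of the plane which is constant equal to `u i` on the disk of radius `ρ` about
`a i`, and vanishes off the disks of radius `2 ρ`. -/
noncomputable def bumpDisplacement (ρ : ℝ) (a u : ι → ℂ) (y : ℂ) : ℂ :=
  ∑ i, clamp (2 - ‖y - a i‖ / ρ) * u i

lemma bumpDisplacement_lipschitz {ρ : ℝ} (hρ : 0 < ρ) {a u : ι → ℂ} (hu : ∑ i, ‖u i‖ ≤ ρ / 2)
    (y y' : ℂ) :
    ‖bumpDisplacement ρ a u y - bumpDisplacement ρ a u y'‖ ≤ 1 / 2 * ‖y - y'‖ := by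
  rw [bumpDisplacement, bumpDisplacement, ← Finset.sum_sub_distrib]
  have h1 : ∀ i, ‖(clamp (2 - ‖y - a i‖ / ρ) * u i - clamp (2 - ‖y' - a i‖ / ρ) * u i : ℂ)‖ ≤
      ‖y - y'‖ / ρ * ‖u i‖ := by
    intro i
    rw [← sub_mul, norm_mul, ← Complex.ofReal_sub, Complex.norm_real, Real.norm_eq_abs]
    refine mul_le_mul_of_nonneg_right ((abs_clamp_sub_clamp_le _ _).trans ?_) (norm_nonneg _)
    have h2 : 2 - ‖y - a i‖ / ρ - (2 - ‖y' - a i‖ / ρ) = (‖y' - a i‖ - ‖y - a i‖) / ρ := by ring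
    rw [h2, abs_div, abs_of_pos hρ]
    refine div_le_div_of_nonneg_right ?_ hρ.le
    have h3 := abs_norm_sub_norm_le (y' - a i) (y - a i)
    rwa [sub_sub_sub_cancel_right, norm_sub_rev y' y] at h3
  calc _ ≤ ∑ i, ‖y - y'‖ / ρ * ‖u i‖ := norm_sum_le_of_le _ fun i _ ↦ h1 i
    _ = ‖y - y'‖ / ρ * ∑ i, ‖u i‖ := by rw [Finset.mul_sum]
    _ ≤ ‖y - y'‖ / ρ * (ρ / 2) := mul_le_mul_of_nonneg_left hu (by positivity)
    _ = 1 / 2 * ‖y - y'‖ := by field_simp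

lemma bumpDisplacement_of_near {ρ : ℝ} (hρ : 0 < ρ) {a u : ι → ℂ}
    (hsep : ∀ i j, i ≠ j → 3 * ρ ≤ ‖a i - a j‖) {i : ι} {v : ℂ} (hv : ‖v‖ ≤ ρ) :
    bumpDisplacement ρ a u (a i + v) = u i := by
  rw [bumpDisplacement, Finset.sum_eq_single i]
  · have h1 : clamp (2 - ‖a i + v - a i‖ / ρ) = 1 := by
      rw [add_sub_cancel_left]
      have : ‖v‖ / ρ ≤ 1 := div_le_one_of_le₀ hv hρ.le
      rw [clamp, min_eq_left (by linarith), max_eq_right zero_le_one]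
    rw [h1, Complex.ofReal_one, one_mul]
  · intro j _ hj
    have h1 : clamp (2 - ‖a i + v - a j‖ / ρ) = 0 := by
      have h2 : 2 * ρ ≤ ‖a i + v - a j‖ := by
        have h3 := hsep i j hj.symm
        have h4 := norm_sub_norm_le (a i - a j) (-v)
        rw [norm_neg, sub_neg_eq_add, show a i - a j + v = a i + v - a j by ring] at h4
        linarith
      have h3 : 2 ≤ ‖a i + v - a j‖ / ρ := by rwa [le_div_iff₀ hρ]
      rw [clamp, max_eq_left]
      exact (min_le_right _ _).trans (by linarith)
    rw [h1, Complex.ofReal_zero, zero_mul]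
  · simp

lemma bumpDisplacement_of_far {ρ : ℝ} (hρ : 0 < ρ) {a u : ι → ℂ} {y : ℂ}
    (hy : ∀ i, 2 * ρ ≤ ‖y - a i‖) : bumpDisplacement ρ a u y = 0 := by
  refine Finset.sum_eq_zero fun i _ ↦ ?_
  have h3 : 2 ≤ ‖y - a i‖ / ρ := by rw [le_div_iff₀ hρ]; exact hy i
  have h1 : clamp (2 - ‖y - a i‖ / ρ) = 0 := by
    rw [clamp, max_eq_left]
    exact (min_le_right _ _).trans (by linarith)
  rw [h1, Complex.ofReal_zero, zero_mul]

/-- The displacements of a family of small displacements of disks are homeomorphisms, being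
perturbations of the identity with Lipschitz constant less than one. -/
lemma exists_bump_homeomorph {ρ : ℝ} (hρ : 0 < ρ) {a u : ℝ → ι → ℂ} (ha : ∀ i, Continuous (a · i))
    (hu : ∀ i, Continuous (u · i)) (husmall : ∀ t, ∑ i, ‖u t i‖ ≤ ρ / 2)
    (hdisk : ∀ t i (y : ℂ), ‖y - a t i‖ < 2 * ρ → ‖y‖ < 1) :
    ∃ R : ℝ → UnitDisk ≃ₜ UnitDisk, (Continuous fun q : ℝ × UnitDisk ↦ R q.1 q.2) ∧
      ∀ t x, (R t x : ℂ) = x + bumpDisplacement ρ (a t) (u t) x := by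
  let h : ℝ → ℂ → ℂ := fun t y ↦ y + bumpDisplacement ρ (a t) (u t) y
  have hfar : ∀ t y, 1 ≤ ‖y‖ → h t y = y := by
    intro t y hy
    have : bumpDisplacement ρ (a t) (u t) y = 0 :=
      bumpDisplacement_of_far hρ fun i ↦ not_lt.mp fun h ↦ hy.not_gt (hdisk t i y h)
    simp only [h, this, add_zero]
  have hc : Continuous fun q : ℝ × ℂ ↦ h q.1 q.2 := by
    refine continuous_snd.add (continuous_finsetSum _ fun i _ ↦ ?_)
    refine Continuous.mul (Complex.continuous_ofReal.comp (continuous_clamp.comp ?_))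
      ((hu i).comp continuous_fst)
    exact continuous_const.sub
      (((continuous_snd.sub ((ha i).comp continuous_fst)).norm).div_const _)
  have hbij : ∀ t, Function.Bijective (h t) := by
    intro t
    have happ : ApproximatesLinearOn (h t)
        ((ContinuousLinearEquiv.refl ℝ ℂ : ℂ ≃L[ℝ] ℂ) : ℂ →L[ℝ] ℂ) univ (1 / 2) := by
      intro x _ y _
      have h1 : h t x - h t y - ((ContinuousLinearEquiv.refl ℝ ℂ : ℂ ≃L[ℝ] ℂ) : ℂ →L[ℝ] ℂ) (x - y) =
          bumpDisplacement ρ (a t) (u t) x - bumpDisplacement ρ (a t) (u t) y := by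
        simp only [h, ContinuousLinearEquiv.coe_coe, ContinuousLinearEquiv.refl_apply]
        ring
      rw [h1]
      simpa using bumpDisplacement_lipschitz hρ (husmall t) x y
    refine (happ.toHomeomorph _ (Or.inr ?_)).bijective
    have : ‖((ContinuousLinearEquiv.refl ℝ ℂ).symm : ℂ →L[ℝ] ℂ)‖₊ = 1 := by simp
    rw [this, inv_one]
    exact NNReal.half_lt_self one_ne_zero
  have hmaps : ∀ t (x : ℂ), ‖x‖ ≤ 1 ↔ ‖h t x‖ ≤ 1 := by
    intro t x
    constructor
    · intro hx
      by_contra hcon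
      have h1 : h t x = x := (hbij t).1 (hfar t _ (not_le.mp hcon).le)
      rw [h1] at hcon
      exact hcon hx
    · intro hx
      by_contra hcon
      rw [hfar t x (not_le.mp hcon).le] at hx
      exact hcon hx
  let r : ℝ → UnitDisk → UnitDisk := fun t x ↦ ⟨h t x, by
    rw [mem_closedBall_zero_iff, ← hmaps]; exact x.norm_le⟩
  have hrc : Continuous fun q : ℝ × UnitDisk ↦ r q.1 q.2 :=
    (hc.comp (continuous_fst.prodMk (continuous_subtype_val.comp continuous_snd))).subtype_mk _
  have hrbij : ∀ t, Function.Bijective (r t) := by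
    refine fun t ↦ ⟨fun x y hxy ↦ Subtype.ext ((hbij t).1 (congrArg Subtype.val hxy)), fun y ↦ ?_⟩
    obtain ⟨x, hx⟩ := (hbij t).2 y
    exact ⟨⟨x, by rw [mem_closedBall_zero_iff, hmaps t, hx]; exact y.norm_le⟩, Subtype.ext hx⟩
  exact ⟨fun t ↦ Continuous.homeoOfEquivCompactToT2 (f := Equiv.ofBijective (r t) (hrbij t))
    (hrc.comp (continuous_const.prodMk continuous_id)), hrc, fun t x ↦ rfl⟩

/-- Finitely many disjoint round disks moving by translations are carried along by an isotopy. -/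
lemma exists_pushing_isotopy {ρ : ℝ} (hρ : 0 < ρ) {c : ℝ → ι → ℂ} (hc : ∀ i, Continuous (c · i))
    (hsep : ∀ t i j, i ≠ j → 3 * ρ ≤ ‖c t i - c t j‖)
    (hdisk : ∀ t i (y : ℂ), ‖y - c t i‖ < 2 * ρ → ‖y‖ < 1) :
    ∃ P : ℝ → UnitDisk ≃ₜ UnitDisk, (Continuous fun q : ℝ × UnitDisk ↦ P q.1 q.2) ∧
      (∀ x, P 0 x = x) ∧ (∀ t, ∀ x : UnitDisk, ‖(x : ℂ)‖ = 1 → P t x = x) ∧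
      ∀ t ∈ Icc (0 : ℝ) 1, ∀ i (v : ℂ), ‖v‖ ≤ ρ →
        P t (toDisk (c 0 i + v)) = toDisk (c t i + v) := by
  obtain ⟨δ, hδ, hcδ⟩ : ∃ δ > 0, ∀ s ∈ Icc (0 : ℝ) 1, ∀ t ∈ Icc (0 : ℝ) 1, dist s t < δ →
      ∑ i, ‖c s i - c t i‖ ≤ ρ / 2 := by
    have h1 : UniformContinuousOn c (Icc 0 1) :=
      isCompact_Icc.uniformContinuousOn_of_continuous (continuous_pi hc).continuousOn
    obtain ⟨δ, hδ, h2⟩ := Metric.uniformContinuousOn_iff.mp h1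
      (ρ / (2 * (Fintype.card ι + 1))) (by positivity)
    refine ⟨δ, hδ, fun s hs t ht hst ↦ ?_⟩
    have h3 : ∀ i, ‖c s i - c t i‖ ≤ ρ / (2 * (Fintype.card ι + 1)) := fun i ↦ by
      rw [← dist_eq_norm]
      exact (dist_le_pi_dist _ _ i).trans (h2 s hs t ht hst).le
    refine (Finset.sum_le_card_nsmul _ _ _ fun i _ ↦ h3 i).trans ?_
    rw [Finset.card_univ, nsmul_eq_mul, mul_div_assoc', div_le_div_iff₀ (by positivity) two_pos]
    nlinarith
  obtain ⟨M, hM⟩ := exists_nat_gt (1 / δ)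
  have hM0 : (0 : ℝ) < M := lt_trans (by positivity) hM
  have hMδ : 1 / (M : ℝ) < δ := by
    rw [div_lt_comm₀ hδ hM0] at hM
    exact hM
  -- the motion up to time `m / M` is realized by composing `m` small displacements
  have key : ∀ m : ℕ, ∃ P : ℝ → UnitDisk ≃ₜ UnitDisk,
      (Continuous fun q : ℝ × UnitDisk ↦ P q.1 q.2) ∧ (∀ x, P 0 x = x) ∧
      (∀ t, ∀ x : UnitDisk, ‖(x : ℂ)‖ = 1 → P t x = x) ∧ ∀ t i (v : ℂ), ‖v‖ ≤ ρ →
        P t (toDisk (c 0 i + v)) = toDisk (c (min (clamp t) (m / M)) i + v) := by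
    intro m
    induction m with
    | zero =>
      refine ⟨fun _ ↦ Homeomorph.refl _, continuous_snd, fun _ ↦ rfl, fun _ _ _ ↦ rfl,
        fun t i v hv ↦ ?_⟩
      rw [Nat.cast_zero, zero_div, min_eq_right (clamp_nonneg t)]
      rfl
    | succ m ih =>
      obtain ⟨P, hP, hP0, hPb, hPc⟩ := ih
      let τ : ℕ → ℝ → ℝ := fun n t ↦ min (clamp t) (n / M)
      have hτ : ∀ n, Continuous (τ n) := fun n ↦ continuous_clamp.min continuous_const
      have hτmem : ∀ n t, τ n t ∈ Icc (0 : ℝ) 1 := fun n t ↦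
        ⟨le_min (clamp_nonneg t) (by positivity), (min_le_left _ _).trans (clamp_le_one t)⟩
      have hτdist : ∀ t, dist (τ (m + 1) t) (τ m t) < δ := by
        intro t
        refine lt_of_le_of_lt ?_ hMδ
        have h2 : ((m + 1 : ℕ) / M : ℝ) - m / M = 1 / M := by push_cast; ring
        have h3 : (0 : ℝ) < 1 / M := by positivity
        refine (abs_min_sub_min_le_max (clamp t) _ (clamp t) _).trans (max_le ?_ ?_)
        · rw [sub_self, abs_zero]
          exact h3.le
        · rw [h2, abs_of_pos h3]
      obtain ⟨R, hR, hRx⟩ := exists_bump_homeomorph hρ (a := fun t i ↦ c (τ m t) i)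
        (u := fun t i ↦ c (τ (m + 1) t) i - c (τ m t) i) (fun i ↦ (hc i).comp (hτ m))
        (fun i ↦ ((hc i).comp (hτ (m + 1))).sub ((hc i).comp (hτ m)))
        (fun t ↦ hcδ _ (hτmem _ t) _ (hτmem _ t) (hτdist t)) (fun t i y ↦ hdisk _ i y)
      refine ⟨fun t ↦ (P t).trans (R t), hR.comp (continuous_fst.prodMk hP), fun x ↦ ?_,
        fun t x hx ↦ ?_, fun t i v hv ↦ ?_⟩
      · rw [Homeomorph.trans_apply, hP0]
        refine Subtype.ext ?_
        have h1 : ∀ n, τ n 0 = 0 := fun n ↦ by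
          have : clamp 0 = 0 := clamp_of_mem ⟨le_rfl, zero_le_one⟩
          simp only [τ, this]
          exact min_eq_left (by positivity)
        rw [hRx]
        simp [bumpDisplacement, h1]
      · rw [Homeomorph.trans_apply, hPb t x hx]
        refine Subtype.ext ?_
        rw [hRx, bumpDisplacement_of_far hρ, add_zero]
        intro i
        by_contra hcon
        exact (hdisk _ i _ (not_le.mp hcon)).ne hx
      · rw [Homeomorph.trans_apply, hPc t i v hv]
        have hin : ∀ n, ‖c (τ n t) i + v‖ ≤ 1 := fun n ↦
          (hdisk (τ n t) i _ (by rw [add_sub_cancel_left]; linarith)).le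
        refine Subtype.ext ?_
        rw [hRx, coe_toDisk (hin m), coe_toDisk (hin (m + 1)),
          bumpDisplacement_of_near hρ (hsep _) hv]
        ring
  obtain ⟨P, hP, hP0, hPb, hPc⟩ := key M
  refine ⟨P, hP, hP0, hPb, fun t ht i v hv ↦ ?_⟩
  rw [hPc t i v hv, div_self hM0.ne', clamp_of_mem ht, min_eq_left ht.2]

end push

/-! ### Extendable braids -/

/-- A continuous path of homeomorphisms of the disk which starts at the identity and fixes the
boundary. -/
structure IsDiskIsotopy (F : ℝ → UnitDisk ≃ₜ UnitDisk) : Prop where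
  continuous : Continuous fun q : ℝ × UnitDisk ↦ F q.1 q.2
  zero : ∀ x, F 0 x = x
  boundary : ∀ t, ∀ x : UnitDisk, ‖(x : ℂ)‖ = 1 → F t x = x

lemma exists_rot_div_of_zpow_eq_one {w : ℤ} (hw : 0 < w) {η : Circle} (h : η ^ w = 1) :
    ∃ i : ℕ, (i : ℤ) < w ∧ η = rot (i / w) := by
  have hw' : (0 : ℝ) < w := by exact_mod_cast hw
  obtain ⟨t, ht, rfl⟩ := exists_mem_Ico_rot_eq η
  rw [rot_zpow] at h
  obtain ⟨n, hn⟩ := rot_eq_one_iff.mp h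
  have h0 : 0 ≤ n := by
    have : (0 : ℝ) ≤ n := by rw [← hn]; exact mul_nonneg hw'.le ht.1
    exact_mod_cast this
  have h1 : n < w := by
    have : (n : ℝ) < w := by rw [← hn]; exact mul_lt_of_lt_one_right hw' ht.2
    exact_mod_cast this
  obtain ⟨m, rfl⟩ := Int.eq_ofNat_of_zero_le h0
  refine ⟨m, h1, ?_⟩
  congr 1
  rw [eq_div_iff hw'.ne', mul_comm, hn, Int.cast_natCast]

lemma rot_div_zpow {w : ℕ} (hw : 0 < w) (t : ℝ) : rot (t / w) ^ (w : ℤ) = rot t := by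
  have hw' : (w : ℝ) ≠ 0 := by exact_mod_cast hw.ne'
  rw [rot_zpow, Int.cast_natCast, mul_div_cancel₀ _ hw']

lemma rot_add_div_injective {w : ℕ} (t : ℝ) :
    Function.Injective fun i : Fin w ↦ rot ((i + t) / w) := by
  intro i j h
  have hw : (0 : ℝ) < w := by exact_mod_cast i.pos
  obtain ⟨n, hn⟩ := rot_eq_rot_iff.mp h
  have h1 : (i : ℝ) = j + n * w := by
    field_simp at hn
    linarith
  have h2 : (i : ℤ) = j + n * w := by exact_mod_cast h1
  have h3 : ((i : ℤ)) % w = (j : ℤ) % w := by rw [h2, Int.add_mul_emod_self_right]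
  refine Fin.ext ?_
  rw [Int.emod_eq_of_lt (by positivity) (by exact_mod_cast i.2),
    Int.emod_eq_of_lt (by positivity) (by exact_mod_cast j.2)] at h3
  exact_mod_cast h3

/-- Isotopies of the disk, fixed on the boundary, are transported along finitely many moving
embedded disks which remain disjoint. -/
lemma exists_pushforward_disks {ι : Type*} [Finite ι] {p : ℝ → ι → UnitDisk → UnitDisk}
    (hp : ∀ i, Continuous fun q : ℝ × UnitDisk ↦ p q.1 i q.2)
    (hinj : ∀ t i j x y, p t i x = p t j y → i = j ∧ x = y) {g : ℝ → ι → UnitDisk ≃ₜ UnitDisk}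
    (hg : ∀ i, Continuous fun q : ℝ × UnitDisk ↦ g q.1 i q.2)
    (hgb : ∀ t i, ∀ x : UnitDisk, ‖(x : ℂ)‖ = 1 → g t i x = x) :
    ∃ H : ℝ → UnitDisk ≃ₜ UnitDisk, (Continuous fun q : ℝ × UnitDisk ↦ H q.1 q.2) ∧
      (∀ t i x, H t (p t i x) = p t i (g t i x)) ∧
      ∀ t y, (∀ i, y ∉ range (p t i)) → H t y = y := by
  let _ : TopologicalSpace ι := ⊥
  have : DiscreteTopology ι := ⟨rfl⟩
  have hswap : ∀ {Z : Type} [TopologicalSpace Z] {F : ℝ → ι → UnitDisk → Z},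
      (∀ i, Continuous fun q : ℝ × UnitDisk ↦ F q.1 i q.2) →
      Continuous fun q : ℝ × (ι × UnitDisk) ↦ F q.1 q.2.1 q.2.2 := by
    intro Z _ F hF
    have h1 : Continuous fun r : ι × (ℝ × UnitDisk) ↦ F r.2.1 r.1 r.2.2 :=
      continuous_prod_of_discrete_left.mpr hF
    exact h1.comp ((continuous_fst.comp continuous_snd).prodMk
      (continuous_fst.prodMk (continuous_snd.comp continuous_snd)))
  let G : ℝ → (ι × UnitDisk) ≃ₜ (ι × UnitDisk) := fun t ↦
    { toFun := fun q ↦ (q.1, g t q.1 q.2)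
      invFun := fun q ↦ (q.1, (g t q.1).symm q.2)
      left_inv := fun q ↦ by simp
      right_inv := fun q ↦ by simp
      continuous_toFun := continuous_prod_of_discrete_left.mpr fun i ↦
        continuous_const.prodMk (g t i).continuous
      continuous_invFun := continuous_prod_of_discrete_left.mpr fun i ↦
        continuous_const.prodMk (g t i).symm.continuous }
  obtain ⟨H, h1, h2, h3⟩ := exists_pushforward (T := ℝ) (X := ι × UnitDisk) (Y := UnitDisk)
    (p := fun t q ↦ p t q.1 q.2) (hswap hp)
    (fun t q r h ↦ Prod.ext (hinj t _ _ _ _ h).1 (hinj t _ _ _ _ h).2)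
    (O := {q | ‖(q.2 : ℂ)‖ < 1}) (by
      have : {q : ℝ × UnitDisk | ∃ x ∈ {q : ι × UnitDisk | ‖(q.2 : ℂ)‖ < 1}, p q.1 x.1 x.2 = q.2} =
          ⋃ i, {q : ℝ × UnitDisk | ∃ x : UnitDisk, ‖(x : ℂ)‖ < 1 ∧ p q.1 i x = q.2} := by
        ext q
        simp only [mem_ofPred_eq, mem_iUnion, Prod.exists]
      rw [this]
      exact isOpen_iUnion fun i ↦ isOpen_image_interior_family (hp i)
        fun t x y h ↦ (hinj t _ _ _ _ h).2)
    (g := G) (continuous_fst.comp continuous_snd |>.prodMk (hswap (F := fun t i x ↦ g t i x) hg))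
    (fun t q hq ↦ Prod.ext rfl (hgb t _ _ (le_antisymm q.2.norm_le (not_lt.mp hq))))
  refine ⟨H, h1, fun t i x ↦ h2 t (i, x), fun t y hy ↦ h3 t y ?_⟩
  rintro ⟨q, hq⟩
  exact hy q.1 ⟨q.2, hq⟩

/-- The motion of the disks in which a braid meets the meridian disk at time `t`, for `t` from `0`
to `1`, extends to an isotopy of the meridian disk, fixed on the boundary. -/
def IsExtendableBraid (e : SolidTorus → SolidTorus) (w : ℤ) : Prop :=
  ∃ K : ℝ → UnitDisk ≃ₜ UnitDisk, IsDiskIsotopy K ∧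
    ∀ t ∈ Icc (0 : ℝ) 1, ∀ η : Circle, η ^ w = 1 → ∀ x,
      K t (e (x, η)).1 = (e (x, η * rot (t / w))).1

namespace IsThickBraid

variable {e : SolidTorus → SolidTorus} {w : ℤ}

lemma eq_of_zpow_eq (he : IsThickBraid e w) {x y : UnitDisk} {z z' : Circle} (hz : z ^ w = z' ^ w)
    (h : (e (x, z)).1 = (e (y, z')).1) : x = y ∧ z = z' := by
  have h1 : e (x, z) = e (y, z') := Prod.ext h (by rw [he.fibre, he.fibre]; exact hz)
  exact Prod.mk.injEq _ _ _ _ ▸ he.isEmbedding.injective h1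

/-- Round disks about the images of the centers of the meridian disks are contained in the images
of the meridian disks. -/
lemma exists_radius (he : IsThickBraid e w) : ∃ ρ > 0, ∀ (z : Circle) (y : ℂ),
    ‖y - (e (toDisk 0, z)).1‖ < ρ → ∃ x : UnitDisk, ‖(x : ℂ)‖ < 1 ∧ ((e (x, z)).1 : ℂ) = y := by
  let p : ℝ → UnitDisk → UnitDisk := fun t x ↦ (e (x, rot t)).1
  have hp : Continuous fun q : ℝ × UnitDisk ↦ p q.1 q.2 :=
    continuous_fst.comp (he.isEmbedding.continuous.comp
      (continuous_snd.prodMk (continuous_rot.comp continuous_fst)))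
  have hinj : ∀ t, Function.Injective (p t) := fun t x y h ↦ (he.eq_of_zpow_eq rfl h).1
  have hV := isOpen_image_interior_family_complex hp hinj
  have hK : IsCompact ((fun t : ℝ ↦ (t, (p t (toDisk 0) : ℂ))) '' Icc 0 1) := by
    refine isCompact_Icc.image (continuous_id.prodMk (continuous_subtype_val.comp
      (hp.comp (continuous_id.prodMk continuous_const))))
  obtain ⟨ρ, hρ, hsub⟩ := hK.exists_thickening_subset_open hV (by
    rintro _ ⟨t, -, rfl⟩
    exact ⟨toDisk 0, by rw [coe_toDisk (by simp)]; simp, rfl⟩)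
  refine ⟨ρ, hρ, fun z y hy ↦ ?_⟩
  obtain ⟨t, ht, rfl⟩ := exists_mem_Ico_rot_eq z
  refine hsub (a := (t, y)) (Metric.mem_thickening_iff.mpr ⟨_, ⟨t, ⟨ht.1, ht.2.le⟩, rfl⟩, ?_⟩)
  rw [Prod.dist_eq, dist_self, max_eq_right dist_nonneg, dist_eq_norm]
  exact hy

/-- A thick braid can be shrunk to an extendable one, which still contains the image of a given
thinner solid torus. The new braid meets the meridian disks in preimages of round disks under
homeomorphisms supported in the image of the given braid. -/
lemma exists_extendable (he : IsThickBraid e w) (hw : 1 < w) {r : ℝ} (hr : r < 1) :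
    ∃ e' : SolidTorus → SolidTorus, IsThickBraid e' w ∧ IsExtendableBraid e' w ∧
      (∀ x z, ∃ y, e' (x, z) = e (y, z)) ∧
      ∀ (x : UnitDisk) (z : Circle), ‖(x : ℂ)‖ ≤ r →
        ∃ y : UnitDisk, ‖(y : ℂ)‖ < 1 ∧ e' (y, z) = e (x, z) := by
  obtain ⟨w, rfl⟩ := Int.eq_ofNat_of_zero_le (zero_le_one.trans hw.le)
  have hw0 : 0 < w := by omega
  have hec := he.isEmbedding.continuous
  obtain ⟨ρ₀, hρ₀, hball₀⟩ := he.exists_radius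
  obtain ⟨ρ, hρ, hball⟩ : ∃ ρ > 0, ∀ (z : Circle) (y : ℂ), ‖y - (e (toDisk 0, z)).1‖ < 3 * ρ →
      ∃ x : UnitDisk, ‖(x : ℂ)‖ < 1 ∧ ((e (x, z)).1 : ℂ) = y :=
    ⟨ρ₀ / 3, by positivity, fun z y hy ↦ hball₀ z y (by linarith)⟩
  obtain ⟨ε, hε, hεe⟩ : ∃ ε > 0, ∀ (x : UnitDisk) (z : Circle), ‖(x : ℂ)‖ ≤ ε →
      ‖((e (x, z)).1 - (e (toDisk 0, z)).1 : ℂ)‖ < ρ := by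
    obtain ⟨δ, hδ, h⟩ := Metric.uniformContinuous_iff.mp
      (CompactSpace.uniformContinuous_of_continuous hec) ρ hρ
    refine ⟨δ / 2, half_pos hδ, fun x z hx ↦ ?_⟩
    have h1 := h (a := (x, z)) (b := (toDisk 0, z)) (by
      rw [Prod.dist_eq, dist_self, max_eq_left dist_nonneg, Subtype.dist_eq, coe_toDisk (by simp),
        dist_zero_right]
      linarith)
    rw [Prod.dist_eq, max_lt_iff, Subtype.dist_eq, dist_eq_norm] at h1
    exact h1.1
  -- `e (S x, z)` lies in the round disk of radius `ρ` about `e (0, z)` for `‖x‖ ≤ r`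
  obtain ⟨S, hSb, hS⟩ := exists_radial_squeeze hr hε
  let c : Circle → ℂ := fun z ↦ (e (toDisk 0, z)).1
  have hc : Continuous c := continuous_subtype_val.comp (continuous_fst.comp
    (hec.comp (continuous_const.prodMk continuous_id)))
  have hnear : ∀ z (x : UnitDisk), ‖c z + ρ * x - c z‖ ≤ ρ := fun z x ↦ by
    rw [add_sub_cancel_left, norm_mul, Complex.norm_real, Real.norm_eq_abs, abs_of_pos hρ]
    exact mul_le_of_le_one_right hρ.le x.norm_le
  -- `q` is the braid formed by these round disks, in the coordinates given by `e`
  have hq : ∀ p : SolidTorus, ∃ x : UnitDisk, ‖(x : ℂ)‖ < 1 ∧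
      ((e (x, p.2)).1 : ℂ) = c p.2 + ρ * p.1 := fun p ↦
    hball _ _ ((hnear _ _).trans_lt (by linarith))
  choose q hq1 hqe using hq
  have hle : ∀ p : SolidTorus, ‖c p.2 + ρ * p.1‖ ≤ 1 := fun p ↦ by
    rw [← hqe]; exact UnitDisk.norm_le _
  have hqe' : ∀ p : SolidTorus, e (q p, p.2) = (toDisk (c p.2 + ρ * p.1), p.2 ^ (w : ℤ)) :=
    fun p ↦ Prod.ext (Subtype.ext (by rw [hqe, coe_toDisk (hle p)])) (he.fibre _)
  have hqc : Continuous q := by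
    have h1 : Continuous fun p : SolidTorus ↦ (q p, p.2) := by
      rw [he.isEmbedding.continuous_iff]
      refine Continuous.congr (f := fun p : SolidTorus ↦
        (toDisk (c p.2 + ρ * p.1), p.2 ^ (w : ℤ))) ?_ fun p ↦ (hqe' p).symm
      refine (continuous_toDisk.comp ((hc.comp continuous_snd).add (continuous_const.mul
        (continuous_subtype_val.comp continuous_fst)))).prodMk (continuous_snd.zpow _)
    exact continuous_fst.comp h1
  let e' : SolidTorus → SolidTorus := fun p ↦ e (S.symm (q p), p.2)
  have he'c : Continuous e' := hec.comp ((S.symm.continuous.comp hqc).prodMk continuous_snd)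
  have he'i : Function.Injective e' := by
    intro p p' h
    have h1 := he.isEmbedding.injective h
    simp only [Prod.mk.injEq, EmbeddingLike.apply_eq_iff_eq] at h1
    obtain ⟨h1, h2⟩ := h1
    have h3 := hqe p
    rw [h1, h2, hqe p'] at h3
    refine Prod.ext (Subtype.ext ?_) h2
    have h4 : (ρ : ℂ) ≠ 0 := by exact_mod_cast hρ.ne'
    exact (mul_left_cancel₀ h4 (add_left_cancel h3)).symm
  refine ⟨e', ⟨(he'c.isClosedEmbedding he'i).isEmbedding, fun p ↦ he.mem_interior _,
    fun p ↦ he.fibre _⟩, ?_, ?_, ?_⟩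
  · let p : ℝ → Fin w → UnitDisk → UnitDisk := fun t i x ↦ (e (x, rot ((i + t) / w))).1
    have hp : ∀ i, Continuous fun q : ℝ × UnitDisk ↦ p q.1 i q.2 := fun i ↦
      continuous_fst.comp (hec.comp (continuous_snd.prodMk (continuous_rot.comp
        ((continuous_const.add continuous_fst).div_const _))))
    have hpow : ∀ (t : ℝ) (i : Fin w), rot ((i + t) / w) ^ (w : ℤ) = rot t := fun t i ↦ by
      rw [rot_div_zpow hw0, add_comm]
      exact rot_eq_rot_iff.mpr ⟨i, by simp⟩
    have hinj : ∀ t i j x y, p t i x = p t j y → i = j ∧ x = y := fun t i j x y h ↦ by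
      have h1 := he.eq_of_zpow_eq (by rw [hpow, hpow]) h
      exact ⟨rot_add_div_injective t h1.2, h1.1⟩
    obtain ⟨E, hE, hEp, hEid⟩ := exists_pushforward_disks hp hinj (g := fun _ _ ↦ S)
      (fun i ↦ S.continuous.comp continuous_snd) (fun _ _ x hx ↦ hSb x hx)
    obtain ⟨P, hP, hP0, hPb, hPc⟩ := exists_pushing_isotopy hρ
      (c := fun t (i : Fin w) ↦ c (rot ((i + t) / w)))
      (fun i ↦ hc.comp (continuous_rot.comp ((continuous_const.add continuous_id).div_const _)))
      (fun t i j hij ↦ by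
        by_contra! hcon
        rw [norm_sub_rev] at hcon
        obtain ⟨x, hx, hx'⟩ := hball _ _ hcon
        exact hij (hinj t i j x (toDisk 0) (Subtype.ext hx')).1)
      (fun t i y hy ↦ by
        obtain ⟨x, -, rfl⟩ := hball _ y (hy.trans (by linarith))
        exact he.mem_interior _)
    have hEb : ∀ t, ∀ x : UnitDisk, ‖(x : ℂ)‖ = 1 → E t x = x := by
      intro t x hx
      refine hEid t x fun i ↦ ?_
      rintro ⟨y, rfl⟩
      exact (he.mem_interior _).ne hx
    -- `E t` maps the disks of the new braid at time `t` to round disks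
    have hround : ∀ (t : ℝ) (i : Fin w) x, E t (e' (x, rot ((i + t) / w))).1 =
        toDisk (c (rot ((i + t) / w)) + ρ * x) := by
      intro t i x
      have h1 := hEp t i (S.symm (q (x, rot ((i + t) / w))))
      rw [Homeomorph.apply_symm_apply] at h1
      refine h1.trans (Subtype.ext ?_)
      rw [coe_toDisk (hle (x, rot ((i + t) / w))), ← hqe]
    refine ⟨fun t ↦ ((E 0).trans (P t)).trans (E t).symm, ⟨?_, fun x ↦ ?_, fun t x hx ↦ ?_⟩,
      fun t ht η hη x ↦ ?_⟩
    · exact (continuous_family_symm hE).comp (continuous_fst.prodMk (hP.comp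
        (continuous_fst.prodMk ((E 0).continuous.comp continuous_snd))))
    · simp [hP0]
    · simp only [Homeomorph.trans_apply]
      rw [hEb 0 x hx, hPb t x hx, Homeomorph.symm_apply_eq, hEb t x hx]
    · obtain ⟨i, hi, rfl⟩ := exists_rot_div_of_zpow_eq_one (by exact_mod_cast hw0) hη
      obtain ⟨i, rfl⟩ : ∃ j : Fin w, (j : ℕ) = i := ⟨⟨i, by exact_mod_cast hi⟩, rfl⟩
      simp only [Homeomorph.trans_apply, Int.cast_natCast]
      have h0 := hround 0 i x
      rw [add_zero] at h0
      have h1 := hPc t ht i (ρ * x) (by simpa using hnear 1 x)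
      simp only [add_zero] at h1
      rw [h0, h1, Homeomorph.symm_apply_eq, ← rot_add, ← add_div, hround]
  · exact fun x z ↦ ⟨S.symm (q (x, z)), rfl⟩
  · intro x z hx
    have h1 := hεe (S x) z (hS x hx)
    set v : ℂ := ((e (S x, z)).1 - (e (toDisk 0, z)).1 : ℂ) / ρ with hv
    have hρ' : (ρ : ℂ) ≠ 0 := by exact_mod_cast hρ.ne'
    have hv1 : ‖v‖ < 1 := by
      rw [hv, norm_div, Complex.norm_real, Real.norm_eq_abs, abs_of_pos hρ, div_lt_one hρ]
      exact h1
    have hvD : (toDisk v : ℂ) = v := coe_toDisk hv1.le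
    refine ⟨toDisk v, by rw [hvD]; exact hv1, ?_⟩
    have h2 : q (toDisk v, z) = S x := by
      refine (he.eq_of_zpow_eq (z := z) (z' := z) rfl (Subtype.ext ?_)).1
      rw [hqe (toDisk v, z), hvD, hv, mul_div_cancel₀ _ hρ']
      exact add_sub_cancel _ _
    change e (S.symm (q (toDisk v, z)), z) = e (x, z)
    rw [h2, Homeomorph.symm_apply_apply]

end IsThickBraid

/-! ### Replacing braids by extendable ones -/

lemma IsThickBraid.exists_norm_le {e : SolidTorus → SolidTorus} {w : ℤ} (he : IsThickBraid e w) :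
    ∃ r < 1, ∀ p, ‖((e p).1 : ℂ)‖ ≤ r := by
  have hc : Continuous fun p ↦ ‖((e p).1 : ℂ)‖ :=
    (continuous_subtype_val.comp (continuous_fst.comp he.isEmbedding.continuous)).norm
  obtain ⟨p, -, hp⟩ := isCompact_univ.exists_isMaxOn (univ_nonempty (α := SolidTorus))
    hc.continuousOn
  exact ⟨_, he.mem_interior p, fun q ↦ hp (mem_univ q)⟩

lemma isEmbedding_iteratedBraid {e : ℕ → SolidTorus → SolidTorus} {w : ℕ → ℤ}
    (he : ∀ n, IsThickBraid (e n) (w n)) (n : ℕ) : IsEmbedding (iteratedBraid e n) := by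
  induction n with
  | zero => exact .id
  | succ n ih => exact ih.comp (he n).isEmbedding

/-- A standard solenoid is the intersection of solid tori obtained by composing extendable braids.
The new solid tori are interleaved with the given ones. -/
lemma IsStandardSolenoid.exists_extendable {S : Set SolidTorus} (hS : IsStandardSolenoid S) :
    ∃ (e : ℕ → SolidTorus → SolidTorus) (w : ℕ → ℤ),
      (∀ n, 1 < w n ∧ IsThickBraid (e n) (w n)) ∧ (∀ n, IsExtendableBraid (e n) (w n)) ∧
      TendstoUniformly
        (fun n (z : Circle) ↦ Metric.diam (iteratedBraid e n '' {p : SolidTorus | p.2 = z}))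
        (fun _ ↦ 0) atTop ∧
      S = ⋂ n, range (iteratedBraid e n) := by
  obtain ⟨e, w, he, hdiam, rfl⟩ := hS
  have hemb := isEmbedding_iteratedBraid fun n ↦ (he n).2
  let P : ℕ → (SolidTorus → SolidTorus) → Prop := fun n ψ ↦ IsEmbedding ψ ∧
    (∀ x z, ∃ y, ψ (x, z) = iteratedBraid e n (y, z)) ∧
    ∀ p : SolidTorus, ∃ q : SolidTorus, ‖(q.1 : ℂ)‖ < 1 ∧ q.2 = p.2 ^ w n ∧
      ψ q = iteratedBraid e (n + 1) p
  have hP0 : P 0 id := ⟨.id, fun x z ↦ ⟨x, rfl⟩, fun p ↦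
    ⟨e 0 p, (he 0).2.mem_interior p, (he 0).2.fibre p, rfl⟩⟩
  have hstep : ∀ n ψ, P n ψ → ∃ b, IsThickBraid b (w n) ∧ IsExtendableBraid b (w n) ∧
      P (n + 1) (ψ ∘ b) := by
    rintro n ψ ⟨hψ, -, hψe⟩
    choose b hb1 hb2 hb3 using hψe
    have hcomp : ψ ∘ b = iteratedBraid e (n + 1) := funext hb3
    have hb : IsThickBraid b (w n) := by
      refine ⟨IsEmbedding.of_comp ?_ hψ.continuous (hcomp ▸ hemb (n + 1)), hb1, hb2⟩
      rw [hψ.continuous_iff, hcomp]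
      exact (hemb (n + 1)).continuous
    obtain ⟨r, hr, her⟩ := (he (n + 1)).2.exists_norm_le
    obtain ⟨b', hb', hext, hsub, hsup⟩ := hb.exists_extendable (he n).1 hr
    refine ⟨b', hb', hext, hψ.comp hb'.isEmbedding, fun x z ↦ ?_, fun p ↦ ?_⟩
    · obtain ⟨y, hy⟩ := hsub x z
      exact ⟨y, by rw [Function.comp_apply, hy, hb3]⟩
    · obtain ⟨y, hy, hy'⟩ := hsup (e (n + 1) p).1 (e (n + 1) p).2 (her p)
      refine ⟨(y, (e (n + 1) p).2), hy, (he (n + 1)).2.fibre p, ?_⟩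
      rw [Function.comp_apply, hy', hb3]
      rfl
  choose! b hb hbext hbP using hstep
  let ψ : ℕ → SolidTorus → SolidTorus := fun n ↦ Nat.rec id (fun n φ ↦ φ ∘ b n φ) n
  have hψ : ∀ n, P n (ψ n) := by
    intro n
    induction n with
    | zero => exact hP0
    | succ n ih => exact hbP n _ ih
  let e' : ℕ → SolidTorus → SolidTorus := fun n ↦ b n (ψ n)
  have hiter : ∀ n, iteratedBraid e' n = ψ n := by
    intro n
    induction n with
    | zero => rfl
    | succ n ih =>
      change iteratedBraid e' n ∘ e' n = _
      rw [ih]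
  refine ⟨e', w, fun n ↦ ⟨(he n).1, hb n _ (hψ n)⟩, fun n ↦ hbext n _ (hψ n), ?_, ?_⟩
  · simp_rw [hiter]
    rw [Metric.tendstoUniformly_iff] at hdiam ⊢
    intro ε hε
    filter_upwards [hdiam ε hε] with n hn z
    refine lt_of_le_of_lt ?_ (hn z)
    rw [Real.dist_eq, Real.dist_eq, zero_sub, zero_sub, abs_neg, abs_neg,
      abs_of_nonneg Metric.diam_nonneg, abs_of_nonneg Metric.diam_nonneg]
    refine Metric.diam_mono ?_ (isCompact_univ.isBounded.subset (subset_univ _))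
    rintro _ ⟨⟨x, z⟩, hz, rfl⟩
    obtain ⟨y, hy⟩ := (hψ n).2.1 x z
    exact ⟨(y, z), hz, hy.symm⟩
  · simp_rw [hiter]
    refine Subset.antisymm (fun x hx ↦ mem_iInter.mpr fun n ↦ ?_) (iInter_mono fun n ↦ ?_)
    · obtain ⟨p, rfl⟩ := mem_iInter.mp hx (n + 1)
      obtain ⟨q, -, -, hq⟩ := (hψ n).2.2 p
      exact ⟨q, hq⟩
    · rintro _ ⟨⟨x, z⟩, rfl⟩
      obtain ⟨y, hy⟩ := (hψ n).2.1 x z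
      exact ⟨(y, z), hy.symm⟩

/-! ### Gluing the isotopies of extendable braids -/

lemma iteratedBraid_succ' (e : ℕ → SolidTorus → SolidTorus) (n : ℕ) :
    iteratedBraid e (n + 1) = e 0 ∘ iteratedBraid (fun j ↦ e (j + 1)) n := by
  induction n with
  | zero => rfl
  | succ n ih =>
    change iteratedBraid e (n + 1) ∘ e (n + 1) = _
    rw [ih]
    rfl

/-- The winding number of the composition of the first `n` braids. -/
def iteratedWinding (w : ℕ → ℤ) (n : ℕ) : ℤ := ∏ j ∈ Finset.range n, w j

lemma iteratedWinding_succ (w : ℕ → ℤ) (n : ℕ) :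
    iteratedWinding w (n + 1) = iteratedWinding w n * w n := Finset.prod_range_succ _ _

lemma iteratedWinding_succ' (w : ℕ → ℤ) (n : ℕ) :
    iteratedWinding w (n + 1) = w 0 * iteratedWinding (fun j ↦ w (j + 1)) n := by
  rw [iteratedWinding, Finset.prod_range_succ', mul_comm]
  rfl

lemma iteratedWinding_pos {w : ℕ → ℤ} (hw : ∀ n, 1 < w n) (n : ℕ) : 0 < iteratedWinding w n :=
  Finset.prod_pos fun j _ ↦ zero_lt_one.trans (hw j)

lemma iteratedBraid_snd {e : ℕ → SolidTorus → SolidTorus} {w : ℕ → ℤ}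
    (he : ∀ n, IsThickBraid (e n) (w n)) (n : ℕ) (p : SolidTorus) :
    (iteratedBraid e n p).2 = p.2 ^ iteratedWinding w n := by
  induction n generalizing p with
  | zero => simp [iteratedBraid, iteratedWinding]
  | succ n ih =>
    change (iteratedBraid e n (e n p)).2 = _
    rw [ih, (he n).fibre, ← zpow_mul, iteratedWinding_succ, mul_comm]

/-- The disk in which the `n`-th solid torus meets a meridian disk at time `s` on the core of the
`n`-th solid torus. -/
def braidDisk (e : ℕ → SolidTorus → SolidTorus) (n : ℕ) (s : ℝ) : Set UnitDisk :=
  range fun x ↦ (iteratedBraid e n (x, rot s)).1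

lemma braidDisk_zero (e : ℕ → SolidTorus → SolidTorus) (s : ℝ) : braidDisk e 0 s = univ :=
  range_id

lemma braidDisk_congr (e : ℕ → SolidTorus → SolidTorus) (n : ℕ) {s t : ℝ} (h : rot s = rot t) :
    braidDisk e n s = braidDisk e n t := by
  rw [braidDisk, h]
  rfl

lemma iteratedBraid_rot {e : ℕ → SolidTorus → SolidTorus} {w : ℕ → ℤ}
    (he : ∀ n, IsThickBraid (e n) (w n)) (n : ℕ) (x : UnitDisk) (s : ℝ) :
    iteratedBraid e n (x, rot s) =
      ((iteratedBraid e n (x, rot s)).1, rot (iteratedWinding w n * s)) :=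
  Prod.ext rfl (by rw [iteratedBraid_snd he, rot_zpow])

lemma braidDisk_succ {e : ℕ → SolidTorus → SolidTorus} {w : ℕ → ℤ}
    (he : ∀ n, IsThickBraid (e n) (w n)) (n : ℕ) (s : ℝ) :
    braidDisk e (n + 1) s =
      (fun y ↦ (e 0 (y, rot (iteratedWinding (fun j ↦ w (j + 1)) n * s))).1) ''
        braidDisk (fun j ↦ e (j + 1)) n s := by
  rw [braidDisk, braidDisk, ← range_comp]
  congr 1
  funext x
  rw [iteratedBraid_succ', Function.comp_apply, Function.comp_apply,
    ← iteratedBraid_rot fun j ↦ he (j + 1)]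

/-- An isotopy of the disk extending the motion of the disks of a braid can be modified inside these
disks: for an isotopy `A` of the disk, the motion of the braid is composed with the part of `A`
which takes place while passing from one meridian disk to the next one. -/
lemma IsThickBraid.exists_refined_isotopy {e : SolidTorus → SolidTorus} {w : ℤ}
    (he : IsThickBraid e w) (hw : 1 < w) {K : ℝ → UnitDisk ≃ₜ UnitDisk} (hK : IsDiskIsotopy K)
    (hKe : ∀ t ∈ Icc (0 : ℝ) 1, ∀ η : Circle, η ^ w = 1 → ∀ x,
      K t (e (x, η)).1 = (e (x, η * rot (t / w))).1)
    {A : ℝ → UnitDisk ≃ₜ UnitDisk} (hA : IsDiskIsotopy A) :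
    ∃ B : ℝ → UnitDisk ≃ₜ UnitDisk, IsDiskIsotopy B ∧
      (∀ t ∈ Icc (0 : ℝ) 1, ∀ i : ℕ, (i : ℤ) < w → ∀ x, B t (e (x, rot (i / w))).1 =
        (e (A ((i + t) / w) ((A (i / w)).symm x), rot ((i + t) / w))).1) ∧
      ∀ t y, (∀ i : ℕ, (i : ℤ) < w → ∀ x, (e (x, rot (i / w))).1 ≠ y) → B t y = K t y := by
  obtain ⟨w, rfl⟩ := Int.eq_ofNat_of_zero_le (zero_le_one.trans hw.le)
  have hw0 : 0 < w := by omega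
  have hec := he.isEmbedding.continuous
  have hpow : ∀ i : Fin w, rot (i / w) ^ (w : ℤ) = 1 := fun i ↦ by
    rw [rot_div_zpow hw0]
    simpa using rot_intCast i
  obtain ⟨H, hH, hHp, hHid⟩ := exists_pushforward_disks
    (p := fun _ (i : Fin w) x ↦ (e (x, rot (i / w))).1)
    (fun i ↦ continuous_fst.comp (hec.comp (continuous_snd.prodMk continuous_const)))
    (fun t i j x y h ↦ by
      have h1 := he.eq_of_zpow_eq (by rw [hpow, hpow]) h
      exact ⟨rot_add_div_injective 0 (by simpa using h1.2), h1.1⟩)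
    (g := fun t i ↦ (A (i / w)).symm.trans (A ((i + t) / w)))
    (fun i ↦ hA.continuous.comp (((continuous_const.add continuous_fst).div_const _).prodMk
      ((A (i / w)).symm.continuous.comp continuous_snd)))
    (fun t i x hx ↦ by
      rw [Homeomorph.trans_apply, (Homeomorph.symm_apply_eq _).mpr (hA.boundary _ x hx).symm,
        hA.boundary _ x hx])
  refine ⟨fun t ↦ (H t).trans (K t), ⟨hK.continuous.comp (continuous_fst.prodMk hH), fun x ↦ ?_,
    fun t x hx ↦ ?_⟩, fun t ht i hi x ↦ ?_, fun t y hy ↦ ?_⟩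
  · rw [Homeomorph.trans_apply, hK.zero]
    by_cases hx : ∃ i, x ∈ range fun y ↦ (e (y, rot ((i : Fin w) / w))).1
    · obtain ⟨i, y, rfl⟩ := hx
      rw [hHp]
      simp
    · exact hHid 0 x (not_exists.mp hx)
  · rw [Homeomorph.trans_apply, hHid t x, hK.boundary t x hx]
    rintro i ⟨y, rfl⟩
    exact (he.mem_interior _).ne hx
  · obtain ⟨i, rfl⟩ : ∃ j : Fin w, (j : ℕ) = i := ⟨⟨i, by exact_mod_cast hi⟩, rfl⟩
    simp only [Int.cast_natCast]
    rw [Homeomorph.trans_apply, hHp t i x, hKe t ht _ (hpow i), Int.cast_natCast, ← rot_add,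
      ← add_div]
    rfl
  · rw [Homeomorph.trans_apply, hHid t y]
    rintro i ⟨x, hx⟩
    exact hy i (by exact_mod_cast i.2) x (by simpa using hx)

section glue

variable {e : ℕ → SolidTorus → SolidTorus} {w : ℕ → ℤ}

lemma mul_div_iteratedWinding (hw : ∀ n, 1 < w n) (n : ℕ) (t : ℝ) :
    (iteratedWinding w n : ℝ) * (t / iteratedWinding w n) = t := by
  have : (iteratedWinding w n : ℝ) ≠ 0 := by exact_mod_cast (iteratedWinding_pos hw n).ne'
  rw [mul_div_cancel₀ _ this]

/-- The isotopies of finitely many extendable braids are combined to isotopies which move the disks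
of the iterated braids around, and which stabilize off these disks. The index `k` is the number of
braids which have been dropped at the beginning of the sequence. -/
lemma exists_glued_isotopies (hw : ∀ n, 1 < w n) (he : ∀ n, IsThickBraid (e n) (w n))
    (hext : ∀ n, IsExtendableBraid (e n) (w n)) :
    ∃ A : ℕ → ℕ → ℝ → UnitDisk ≃ₜ UnitDisk, (∀ m k, IsDiskIsotopy (A m k)) ∧
      (∀ n m k, n ≤ m → ∀ t ∈ Icc (0 : ℝ) 1, ∀ s : ℝ,
        rot (iteratedWinding (fun j ↦ w (j + k)) n * s) = 1 →
        A m k t '' braidDisk (fun j ↦ e (j + k)) n s =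
          braidDisk (fun j ↦ e (j + k)) n (s + t / iteratedWinding (fun j ↦ w (j + k)) n)) ∧
      ∀ n m k, n ≤ m → ∀ t ∈ Icc (0 : ℝ) 1, ∀ x,
        (∀ s : ℝ, rot (iteratedWinding (fun j ↦ w (j + k)) n * s) = 1 →
          x ∉ braidDisk (fun j ↦ e (j + k)) n s) → A m k t x = A n k t x := by
  choose K hK hKe using hext
  have hstep := fun k (A : ℝ → UnitDisk ≃ₜ UnitDisk) (hA : IsDiskIsotopy A) ↦
    (he k).exists_refined_isotopy (hw k) (hK k) (hKe k) hA
  choose! B hB hBe hBid using hstep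
  let A : ℕ → ℕ → ℝ → UnitDisk ≃ₜ UnitDisk := fun m ↦
    Nat.rec (fun _ _ ↦ Homeomorph.refl _) (fun _ a k ↦ B k (a (k + 1))) m
  have hAiso : ∀ m k, IsDiskIsotopy (A m k) := by
    intro m
    induction m with
    | zero => exact fun k ↦ ⟨continuous_snd, fun _ ↦ rfl, fun _ _ _ ↦ rfl⟩
    | succ m ih => exact fun k ↦ hB k _ (ih (k + 1))
  have hshift : ∀ {Z : Type} (f : ℕ → Z) (k : ℕ),
      (fun j ↦ f (j + 1 + k)) = fun j ↦ f (j + (k + 1)) :=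
    fun f k ↦ funext fun j ↦ by rw [add_assoc, add_comm 1 k]
  have hwin : ∀ n k, (iteratedWinding (fun j ↦ w (j + k)) (n + 1) : ℝ) =
      w k * iteratedWinding (fun j ↦ w (j + (k + 1))) n := fun n k ↦ by
    rw [iteratedWinding_succ', hshift w k, zero_add, Int.cast_mul]
  have hdisk : ∀ n k s, braidDisk (fun j ↦ e (j + k)) (n + 1) s =
      (fun y ↦ (e k (y, rot (iteratedWinding (fun j ↦ w (j + (k + 1))) n * s))).1) ''
        braidDisk (fun j ↦ e (j + (k + 1))) n s := fun n k s ↦ by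
    rw [braidDisk_succ fun j ↦ he (j + k), hshift w k, hshift e k, zero_add]
  have htime : ∀ k (i : ℕ), (i : ℤ) < w k → ∀ t ∈ Icc (0 : ℝ) 1, (i + t) / w k ∈ Icc (0 : ℝ) 1 := by
    intro k i hi t ht
    have h0 : (0 : ℝ) < w k := by exact_mod_cast zero_lt_one.trans (hw k)
    have h1 : (i : ℝ) + 1 ≤ w k := by exact_mod_cast hi
    exact ⟨div_nonneg (add_nonneg (Nat.cast_nonneg i) ht.1) h0.le,
      (div_le_one h0).mpr (by linarith [ht.2])⟩
  have hmove : ∀ n m k, n ≤ m → ∀ t ∈ Icc (0 : ℝ) 1, ∀ s : ℝ,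
      rot (iteratedWinding (fun j ↦ w (j + k)) n * s) = 1 →
      A m k t '' braidDisk (fun j ↦ e (j + k)) n s =
        braidDisk (fun j ↦ e (j + k)) n (s + t / iteratedWinding (fun j ↦ w (j + k)) n) := by
    intro n
    induction n with
    | zero => intro m k _ t _ s _; simp only [braidDisk_zero, image_univ, (A m k t).range_coe]
    | succ n ih =>
      intro m k hm t ht s hs
      obtain ⟨m, rfl⟩ := Nat.exists_eq_add_of_le' (n := m) (m := 1) (by omega)
      have hw0 : (0 : ℝ) < w k := by exact_mod_cast zero_lt_one.trans (hw k)
      set W := iteratedWinding (fun j ↦ w (j + (k + 1))) n with hW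
      have hW0 : (0 : ℝ) < W := by exact_mod_cast iteratedWinding_pos (fun j ↦ hw (j + (k + 1))) n
      rw [hwin, ← hW] at hs ⊢
      obtain ⟨i, hi, hWs⟩ := exists_rot_div_of_zpow_eq_one (zero_lt_one.trans (hw k))
        (η := rot (W * s)) (by rw [rot_zpow, ← mul_assoc, hs])
      -- the disk of the shifted sequence, moved back to the meridian disk at time `0`
      set s₀ : ℝ := s - i / w k / W with hs₀
      have hs₀W : rot (W * s₀) = 1 := by
        rw [hs₀, mul_sub, mul_div_cancel₀ _ hW0.ne', sub_eq_add_neg, rot_add, rot_neg, hWs,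
          mul_inv_cancel]
      have h1 := ih m (k + 1) (by omega) _
        (by simpa using htime k i hi 0 ⟨le_rfl, zero_le_one⟩) s₀ hs₀W
      have h2 := ih m (k + 1) (by omega) _ (htime k i hi t ht) s₀ hs₀W
      rw [← hW] at h1 h2
      rw [hs₀, sub_add_cancel] at h1
      have h3 : s - i / w k / W + (i + t) / w k / W = s + t / (w k * W) := by
        field_simp
        ring
      rw [hs₀, h3] at h2
      have h4 : rot (W * (s + t / (w k * W))) = rot ((i + t) / w k) := by
        have : (W : ℝ) * (s + t / (w k * W)) = W * s + t / w k := by field_simp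
        rw [this, rot_add, hWs, ← rot_add, ← add_div]
      rw [hdisk, hdisk, ← hW, hWs, h4, ← h2, ← h1, ← hs₀]
      ext y
      simp only [mem_image, exists_exists_and_eq_and]
      refine exists_congr fun z ↦ and_congr_right fun _ ↦ ?_
      have h5 := hBe k _ (hAiso m (k + 1)) t ht i hi (A m (k + 1) (i / w k) z)
      rw [Homeomorph.symm_apply_apply] at h5
      change B k (A m (k + 1)) t _ = y ↔ _
      rw [h5]
  refine ⟨A, hAiso, hmove, ?_⟩
  intro n
  induction n with
  | zero =>
    intro m k _ t _ x hx
    exact absurd (by simp [braidDisk_zero]) (hx 0 (by simp [rot_zero]))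
  | succ n ih =>
    intro m k hm t ht x hx
    obtain ⟨m, rfl⟩ := Nat.exists_eq_add_of_le' (n := m) (m := 1) (by omega)
    change B k (A m (k + 1)) t x = B k (A n (k + 1)) t x
    by_cases hxe : ∃ i : ℕ, (i : ℤ) < w k ∧ ∃ y, (e k (y, rot (i / w k))).1 = x
    · obtain ⟨i, hi, y, rfl⟩ := hxe
      have hi0 : (i : ℝ) / w k ∈ Icc (0 : ℝ) 1 := by
        simpa using htime k i hi 0 ⟨le_rfl, zero_le_one⟩
      have hw0 : (0 : ℝ) < w k := by exact_mod_cast zero_lt_one.trans (hw k)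
      set W := iteratedWinding (fun j ↦ w (j + (k + 1))) n with hW
      have hW0 : (0 : ℝ) < W := by exact_mod_cast iteratedWinding_pos (fun j ↦ hw (j + (k + 1))) n
      rw [hBe k _ (hAiso m (k + 1)) t ht i hi, hBe k _ (hAiso n (k + 1)) t ht i hi]
      set z := (A n (k + 1) (i / w k)).symm y with hz
      have hyz : A n (k + 1) (i / w k) z = y := (A n (k + 1) (i / w k)).apply_symm_apply y
      have hznot : ∀ s : ℝ, rot (W * s) = 1 → z ∉ braidDisk (fun j ↦ e (j + (k + 1))) n s := by
        intro s hs hzs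
        have h1 : y ∈ braidDisk (fun j ↦ e (j + (k + 1))) n (s + i / w k / W) := by
          rw [hW, ← hmove n n (k + 1) le_rfl _ hi0 s hs, ← hyz]
          exact mem_image_of_mem _ hzs
        have h2 : rot (W * (s + i / w k / W)) = rot (i / w k) := by
          rw [mul_add, mul_div_cancel₀ _ hW0.ne', rot_add, hs, one_mul]
        refine hx (s + i / w k / W) ?_ ?_
        · rw [hwin, ← hW, mul_assoc, ← rot_zpow, h2, rot_zpow, mul_div_cancel₀ _ hw0.ne']
          simpa using rot_intCast i
        · rw [hdisk, ← hW, h2]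
          exact mem_image_of_mem _ h1
      have h1 := ih m (k + 1) (by omega) _ hi0 z hznot
      have h2 : (A m (k + 1) (i / w k)).symm y = z := by
        rw [Homeomorph.symm_apply_eq, h1, hyz]
      rw [h2, ih m (k + 1) (by omega) _ (htime k i hi t ht) z hznot]
    · push Not at hxe
      rw [hBid k _ (hAiso m (k + 1)) t x hxe, hBid k _ (hAiso n (k + 1)) t x hxe]

end glue

/-! ### The limit of the glued isotopies -/

lemma exists_tendstoUniformly {X Y : Type*} [MetricSpace Y] [CompleteSpace Y] {a : ℕ → X → Y}
    (h : ∀ ε > 0, ∃ N, ∀ m ≥ N, ∀ x, dist (a m x) (a N x) ≤ ε) :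
    ∃ f, TendstoUniformly a f atTop := by
  have h1 : UniformCauchySeqOn a atTop univ := by
    refine Metric.uniformCauchySeqOn_iff.mpr fun ε hε ↦ ?_
    obtain ⟨N, hN⟩ := h (ε / 3) (by positivity)
    refine ⟨N, fun m hm n hn x _ ↦ ?_⟩
    have := dist_triangle_right (a m x) (a n x) (a N x)
    linarith [hN m hm x, hN n hn x]
  have h2 : ∀ x, ∃ y, Tendsto (fun n ↦ a n x) atTop (𝓝 y) := fun x ↦
    cauchySeq_tendsto_of_complete (h1.cauchySeq (mem_univ x))
  choose f hf using h2
  exact ⟨f, tendstoUniformlyOn_univ.mp (h1.tendstoUniformlyOn_of_tendsto fun x _ ↦ hf x)⟩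

/-- A sequence of isotopies converges to an isotopy if it is uniformly Cauchy together with the
sequence of inverses. -/
lemma exists_limit_isotopy {A : ℕ → ℝ → UnitDisk ≃ₜ UnitDisk} (hA : ∀ m, IsDiskIsotopy (A m))
    (h : ∀ ε > 0, ∃ N, ∀ m ≥ N, ∀ t x, dist (A m t x) (A N t x) ≤ ε)
    (h' : ∀ ε > 0, ∃ N, ∀ m ≥ N, ∀ t x, dist ((A m t).symm x) ((A N t).symm x) ≤ ε) :
    ∃ F : ℝ → UnitDisk ≃ₜ UnitDisk, IsDiskIsotopy F ∧
      (∀ t x, Tendsto (fun m ↦ A m t x) atTop (𝓝 (F t x))) ∧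
      ∀ t x, Tendsto (fun m ↦ (A m t).symm x) atTop (𝓝 ((F t).symm x)) := by
  obtain ⟨f, hf⟩ := exists_tendstoUniformly (a := fun m (q : ℝ × UnitDisk) ↦ A m q.1 q.2)
    fun ε hε ↦ (h ε hε).imp fun N hN m hm q ↦ hN m hm q.1 q.2
  obtain ⟨g, hg⟩ := exists_tendstoUniformly (a := fun m (q : ℝ × UnitDisk) ↦ (A m q.1).symm q.2)
    fun ε hε ↦ (h' ε hε).imp fun N hN m hm q ↦ hN m hm q.1 q.2
  have hfc : Continuous f := hf.continuous (Frequently.of_forall fun m ↦ (hA m).continuous)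
  have hgc : Continuous g :=
    hg.continuous (Frequently.of_forall fun m ↦ continuous_family_symm (hA m).continuous)
  have hfg : ∀ t x, f (t, g (t, x)) = x := fun t x ↦ by
    have h1 : Tendsto (fun m ↦ ((t, (A m t).symm x) : ℝ × UnitDisk)) atTop (𝓝 (t, g (t, x))) :=
      tendsto_const_nhds.prodMk_nhds (hg.tendsto_at (t, x))
    have h2 := hf.tendsto_comp hfc.continuousAt h1
    simp only [Homeomorph.apply_symm_apply] at h2
    exact tendsto_nhds_unique h2 tendsto_const_nhds
  have hgf : ∀ t x, g (t, f (t, x)) = x := fun t x ↦ by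
    have h1 : Tendsto (fun m ↦ ((t, A m t x) : ℝ × UnitDisk)) atTop (𝓝 (t, f (t, x))) :=
      tendsto_const_nhds.prodMk_nhds (hf.tendsto_at (t, x))
    have h2 := hg.tendsto_comp hgc.continuousAt h1
    simp only [Homeomorph.symm_apply_apply] at h2
    exact tendsto_nhds_unique h2 tendsto_const_nhds
  refine ⟨fun t ↦
    { toFun := fun x ↦ f (t, x)
      invFun := fun x ↦ g (t, x)
      left_inv := hgf t
      right_inv := hfg t
      continuous_toFun := hfc.comp (continuous_const.prodMk continuous_id)
      continuous_invFun := hgc.comp (continuous_const.prodMk continuous_id) },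
    ⟨hfc, fun x ↦ ?_, fun t x hx ↦ ?_⟩, fun t x ↦ hf.tendsto_at (t, x),
    fun t x ↦ hg.tendsto_at (t, x)⟩
  · refine tendsto_nhds_unique (hf.tendsto_at (0, x)) ?_
    simp only [(hA _).zero]
    exact tendsto_const_nhds
  · refine tendsto_nhds_unique (hf.tendsto_at (t, x)) ?_
    simp only [(hA _).boundary t x hx]
    exact tendsto_const_nhds

lemma isCompact_braidDisk {e : ℕ → SolidTorus → SolidTorus} {w : ℕ → ℤ}
    (he : ∀ n, IsThickBraid (e n) (w n)) (n : ℕ) (s : ℝ) : IsCompact (braidDisk e n s) :=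
  isCompact_range (continuous_fst.comp ((isEmbedding_iteratedBraid he n).continuous.comp
    (continuous_id.prodMk continuous_const)))

lemma dist_le_of_mem_braidDisk {e : ℕ → SolidTorus → SolidTorus}
    (hdiam : TendstoUniformly
      (fun n (z : Circle) ↦ Metric.diam (iteratedBraid e n '' {p : SolidTorus | p.2 = z}))
      (fun _ ↦ 0) atTop) {ε : ℝ} (hε : 0 < ε) :
    ∃ N, ∀ n ≥ N, ∀ s, ∀ x ∈ braidDisk e n s, ∀ y ∈ braidDisk e n s, dist x y < ε := by
  obtain ⟨N, hN⟩ := eventually_atTop.mp (Metric.tendstoUniformly_iff.mp hdiam ε hε)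
  refine ⟨N, fun n hn s ↦ ?_⟩
  rintro _ ⟨x, rfl⟩ _ ⟨y, rfl⟩
  have h1 := hN n hn (rot s)
  rw [Real.dist_eq, zero_sub, abs_neg, abs_of_nonneg Metric.diam_nonneg] at h1
  refine lt_of_le_of_lt (le_trans ?_ (Metric.dist_le_diam_of_mem
    (isCompact_univ.isBounded.subset (subset_univ _))
    (mem_image_of_mem _ (show (x, rot s) ∈ {p : SolidTorus | p.2 = rot s} from rfl))
    (mem_image_of_mem _ (show (y, rot s) ∈ {p : SolidTorus | p.2 = rot s} from rfl)))) h1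
  exact le_max_left _ _

/-- The disks in which the iterated braids meet the meridian disks are moved around by an isotopy of
the disk, simultaneously for all generations. -/
lemma exists_isotopy_of_braids {e : ℕ → SolidTorus → SolidTorus} {w : ℕ → ℤ}
    (hw : ∀ n, 1 < w n) (he : ∀ n, IsThickBraid (e n) (w n))
    (hext : ∀ n, IsExtendableBraid (e n) (w n))
    (hdiam : TendstoUniformly
      (fun n (z : Circle) ↦ Metric.diam (iteratedBraid e n '' {p : SolidTorus | p.2 = z}))
      (fun _ ↦ 0) atTop) :
    ∃ F : ℝ → UnitDisk ≃ₜ UnitDisk, IsDiskIsotopy F ∧ ∀ n, ∀ t ∈ Icc (0 : ℝ) 1, ∀ s : ℝ,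
      rot (iteratedWinding w n * s) = 1 →
        F t '' braidDisk e n s = braidDisk e n (s + t / iteratedWinding w n) := by
  obtain ⟨A, hA, hmove, hstable⟩ := exists_glued_isotopies hw he hext
  have hmove := fun n m h t ht s ↦ hmove n m 0 h t ht s
  have hstable := fun n m h t ht x ↦ hstable n m 0 h t ht x
  simp only [add_zero] at hmove hstable
  have hmem : ∀ n m, n ≤ m → ∀ t ∈ Icc (0 : ℝ) 1, ∀ s : ℝ, rot (iteratedWinding w n * s) = 1 →
      ∀ x, A m 0 t x ∈ braidDisk e n (s + t / iteratedWinding w n) ↔ x ∈ braidDisk e n s := by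
    intro n m h t ht s hs x
    rw [← hmove n m h t ht s hs, (A m 0 t).injective.mem_set_image]
  have hclamp : ∀ t, clamp t ∈ Icc (0 : ℝ) 1 := fun t ↦ ⟨clamp_nonneg t, clamp_le_one t⟩
  have hA' : ∀ m, IsDiskIsotopy fun t ↦ A m 0 (clamp t) := fun m ↦
    ⟨(hA m 0).continuous.comp ((continuous_clamp.comp continuous_fst).prodMk continuous_snd),
      fun x ↦ by rw [clamp_of_mem ⟨le_rfl, zero_le_one⟩, (hA m 0).zero],
      fun t ↦ (hA m 0).boundary _⟩
  obtain ⟨F, hF, hlim, hlim'⟩ := exists_limit_isotopy hA'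
    (fun ε hε ↦ by
      obtain ⟨N, hN⟩ := dist_le_of_mem_braidDisk hdiam hε
      refine ⟨N, fun m hm t x ↦ ?_⟩
      by_cases hx : ∃ s : ℝ, rot (iteratedWinding w N * s) = 1 ∧ x ∈ braidDisk e N s
      · obtain ⟨s, hs, hxs⟩ := hx
        exact (hN N le_rfl _ _ ((hmem N m hm _ (hclamp t) s hs x).mpr hxs) _
          ((hmem N N le_rfl _ (hclamp t) s hs x).mpr hxs)).le
      · push Not at hx
        rw [hstable N m hm _ (hclamp t) x hx, dist_self]
        exact hε.le)
    (fun ε hε ↦ by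
      obtain ⟨N, hN⟩ := dist_le_of_mem_braidDisk hdiam hε
      refine ⟨N, fun m hm t y ↦ ?_⟩
      obtain ⟨x, rfl⟩ := (A m 0 (clamp t)).surjective y
      rw [Homeomorph.symm_apply_apply]
      by_cases hx : ∃ s : ℝ, rot (iteratedWinding w N * s) = 1 ∧ x ∈ braidDisk e N s
      · obtain ⟨s, hs, hxs⟩ := hx
        refine (hN N le_rfl _ _ hxs _ ((hmem N N le_rfl _ (hclamp t) s hs _).mp ?_)).le
        rw [Homeomorph.apply_symm_apply]
        exact (hmem N m hm _ (hclamp t) s hs x).mpr hxs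
      · push Not at hx
        rw [hstable N m hm _ (hclamp t) x hx, Homeomorph.symm_apply_apply, dist_self]
        exact hε.le)
  refine ⟨F, hF, fun n t ht s hs ↦ Subset.antisymm ?_ fun y hy ↦ ?_⟩
  · rintro _ ⟨x, hx, rfl⟩
    refine (isCompact_braidDisk he n _).isClosed.mem_of_tendsto (hlim t x) ?_
    filter_upwards [eventually_ge_atTop n] with m hm
    rw [clamp_of_mem ht]
    exact (hmem n m hm t ht s hs x).mpr hx
  · refine ⟨(F t).symm y, ?_, (F t).apply_symm_apply y⟩
    refine (isCompact_braidDisk he n _).isClosed.mem_of_tendsto (hlim' t y) ?_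
    filter_upwards [eventually_ge_atTop n] with m hm
    rw [clamp_of_mem ht]
    refine (hmem n m hm t ht s hs _).mp ?_
    rwa [Homeomorph.apply_symm_apply]

/-! ### The meridian disks of a standard solenoid -/

section disks

variable {e : ℕ → SolidTorus → SolidTorus} {w : ℕ → ℤ}

lemma mem_range_iteratedBraid_iff (he : ∀ n, IsThickBraid (e n) (w n)) (n : ℕ) (x : UnitDisk)
    (t : ℝ) : (x, rot t) ∈ range (iteratedBraid e n) ↔
      ∃ s : ℝ, rot (iteratedWinding w n * s) = rot t ∧ x ∈ braidDisk e n s := by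
  constructor
  · rintro ⟨⟨y, z⟩, h⟩
    obtain ⟨s, rfl⟩ := exists_rot_eq z
    rw [iteratedBraid_rot he, Prod.mk.injEq] at h
    exact ⟨s, h.2, y, h.1⟩
  · rintro ⟨s, hs, y, rfl⟩
    exact ⟨(y, rot s), by rw [iteratedBraid_rot he, hs]⟩

lemma rot_eq_rot_of_mem_braidDisk (he : ∀ n, IsThickBraid (e n) (w n)) {n : ℕ} {s t : ℝ}
    (h : rot (iteratedWinding w n * s) = rot (iteratedWinding w n * t)) {x : UnitDisk}
    (hs : x ∈ braidDisk e n s) (ht : x ∈ braidDisk e n t) : rot s = rot t := by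
  obtain ⟨y, rfl⟩ := hs
  obtain ⟨y', hy'⟩ := ht
  have h1 : iteratedBraid e n (y', rot t) = iteratedBraid e n (y, rot s) := by
    rw [iteratedBraid_rot he, iteratedBraid_rot he n y s, h]
    exact Prod.ext hy' rfl
  exact (congrArg Prod.snd ((isEmbedding_iteratedBraid he n).injective h1)).symm

lemma isEmbedding_braidDisk (he : ∀ n, IsThickBraid (e n) (w n)) (n : ℕ) (s : ℝ) :
    IsEmbedding fun x ↦ (iteratedBraid e n (x, rot s)).1 := by
  have hc : Continuous fun x ↦ (iteratedBraid e n (x, rot s)).1 :=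
    continuous_fst.comp ((isEmbedding_iteratedBraid he n).continuous.comp
      (continuous_id.prodMk continuous_const))
  refine (hc.isClosedEmbedding fun x y h ↦ ?_).isEmbedding
  have h1 : iteratedBraid e n (x, rot s) = iteratedBraid e n (y, rot s) := by
    rw [iteratedBraid_rot he, iteratedBraid_rot he n y s]
    exact Prod.ext h rfl
  exact congrArg Prod.fst ((isEmbedding_iteratedBraid he n).injective h1)

lemma exists_of_mem_braidDisk_succ (he : ∀ n, IsThickBraid (e n) (w n)) {n : ℕ} {s : ℝ}
    {x : UnitDisk} (hx : x ∈ braidDisk e (n + 1) s) :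
    ∃ y : UnitDisk, ‖(y : ℂ)‖ < 1 ∧ (iteratedBraid e n (y, rot (w n * s))).1 = x := by
  obtain ⟨v, rfl⟩ := hx
  refine ⟨(e n (v, rot s)).1, (he n).mem_interior _, ?_⟩
  have h1 : e n (v, rot s) = ((e n (v, rot s)).1, rot (w n * s)) :=
    Prod.ext rfl (by rw [(he n).fibre, rot_zpow])
  change _ = (iteratedBraid e n (e n (v, rot s))).1
  rw [h1]

lemma braidDisk_succ_subset (he : ∀ n, IsThickBraid (e n) (w n)) (n : ℕ) (s : ℝ) :
    braidDisk e (n + 1) s ⊆ braidDisk e n (w n * s) := fun x hx ↦ by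
  obtain ⟨y, -, hy⟩ := exists_of_mem_braidDisk_succ he hx
  exact ⟨y, hy⟩

/-- The union of the disks in which the `n`-th solid torus meets the meridian disk over `1`. -/
def braidDisks (e : ℕ → SolidTorus → SolidTorus) (w : ℕ → ℤ) (n : ℕ) : Set UnitDisk :=
  {x | ∃ s : ℝ, rot (iteratedWinding w n * s) = 1 ∧ x ∈ braidDisk e n s}

lemma mem_interior_braidDisks (he : ∀ n, IsThickBraid (e n) (w n)) {n : ℕ} {x : UnitDisk}
    (hx : x ∈ braidDisks e w (n + 1)) : (x : ℂ) ∈ interior ((↑) '' braidDisks e w n : Set ℂ) := by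
  obtain ⟨s, hs, hxs⟩ := hx
  have hemb := isEmbedding_braidDisk he n (w n * s)
  refine interior_maximal ?_ (isOpen_image_interior_disk hemb.continuous hemb.injective) ?_
  · rintro _ ⟨y, -, rfl⟩
    refine mem_image_of_mem _ ⟨w n * s, ?_, mem_range_self y⟩
    rw [iteratedWinding_succ] at hs
    push_cast at hs
    rwa [← mul_assoc]
  · obtain ⟨y, hy, rfl⟩ := exists_of_mem_braidDisk_succ he hxs
    exact ⟨y, hy, rfl⟩

lemma braidDisks_eq_iUnion (hw : ∀ n, 1 < w n) (n : ℕ) : braidDisks e w n =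
    ⋃ i ∈ Finset.range (iteratedWinding w n).toNat, braidDisk e n (i / iteratedWinding w n) := by
  have hW := iteratedWinding_pos hw n
  have hW' : (iteratedWinding w n : ℝ) ≠ 0 := by exact_mod_cast hW.ne'
  ext x
  simp only [mem_iUnion, Finset.mem_range, exists_prop]
  constructor
  · rintro ⟨s, hs, hx⟩
    obtain ⟨i, hi, his⟩ := exists_rot_div_of_zpow_eq_one hW (η := rot s) (by rw [rot_zpow, hs])
    exact ⟨i, by omega, by rwa [← braidDisk_congr e n his]⟩
  · rintro ⟨i, -, hx⟩
    refine ⟨_, ?_, hx⟩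
    rw [mul_div_cancel₀ _ hW']
    simpa using rot_intCast i

lemma isClosed_braidDisks (hw : ∀ n, 1 < w n) (he : ∀ n, IsThickBraid (e n) (w n)) (n : ℕ) :
    IsClosed (braidDisks e w n) := by
  rw [braidDisks_eq_iUnion hw]
  exact isClosed_biUnion_finset fun i _ ↦ (isCompact_braidDisk he n _).isClosed

/-- Every disk of every generation contains points common to all generations. -/
lemma exists_mem_braidDisk_inter (hw : ∀ n, 1 < w n) (he : ∀ n, IsThickBraid (e n) (w n)) (n : ℕ)
    {s : ℝ} (hs : rot (iteratedWinding w n * s) = 1) :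
    ∃ x ∈ braidDisk e n s, x ∈ ⋂ m, braidDisks e w m := by
  have hanti : Antitone (braidDisks e w) :=
    antitone_of_interior fun m x hx ↦ mem_interior_braidDisks he hx
  let V : ℕ → ℤ := iteratedWinding fun j ↦ w (n + j)
  have hV : ∀ m, (V m : ℝ) ≠ 0 := fun m ↦ by
    exact_mod_cast (iteratedWinding_pos (fun j ↦ hw (n + j)) m).ne'
  have hWV : ∀ m, iteratedWinding w (n + m) = iteratedWinding w n * V m := fun m ↦
    Finset.prod_range_add _ _ _
  obtain ⟨x, hx⟩ := IsCompact.nonempty_iInter_of_sequence_nonempty_isCompact_isClosed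
    (fun m ↦ braidDisk e (n + m) (s / V m))
    (fun m ↦ by
      have h1 : (w (n + m) : ℝ) * (s / V (m + 1)) = s / V m := by
        have h2 : (V (m + 1) : ℝ) = V m * w (n + m) := by
          exact_mod_cast iteratedWinding_succ (fun j ↦ w (n + j)) m
        have h3 : (w (n + m) : ℝ) ≠ 0 := by exact_mod_cast (zero_lt_one.trans (hw _)).ne'
        have h4 := hV m
        rw [h2]
        field_simp
      rw [← h1]
      exact braidDisk_succ_subset he (n + m) _)
    (fun m ↦ range_nonempty _) (isCompact_braidDisk he _ _)
    (fun m ↦ (isCompact_braidDisk he _ _).isClosed)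
  rw [mem_iInter] at hx
  refine ⟨x, by simpa [V, iteratedWinding] using hx 0, mem_iInter.mpr fun m ↦ ?_⟩
  refine hanti (Nat.le_add_left m n) ⟨_, ?_, hx m⟩
  rw [hWV, Int.cast_mul, mul_assoc, mul_div_cancel₀ _ (hV m), hs]

/-- A standard solenoid meets a meridian disk in a Cantor set: its intersections with the disks of
each generation are clopen, and each disk contains several disks of the next generation. -/
lemma isCantorSet_iInter_braidDisks (hw : ∀ n, 1 < w n) (he : ∀ n, IsThickBraid (e n) (w n))
    (hdiam : TendstoUniformly
      (fun n (z : Circle) ↦ Metric.diam (iteratedBraid e n '' {p : SolidTorus | p.2 = z}))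
      (fun _ ↦ 0) atTop) : IsCantorSet (⋂ n, braidDisks e w n) := by
  classical
  set C := ⋂ n, braidDisks e w n with hC
  have hCclosed : IsClosed C := isClosed_iInter fun n ↦ isClosed_braidDisks hw he n
  have : CompactSpace C := isCompact_iff_compactSpace.mp hCclosed.isCompact
  have : Nonempty C := by
    obtain ⟨x, -, hx⟩ := exists_mem_braidDisk_inter hw he 0 (s := 0) (by rw [mul_zero, rot_zero])
    exact ⟨⟨x, hx⟩⟩
  have hCmem : ∀ (x : C) n, ∃ i : ℕ, rot (iteratedWinding w n * (i / iteratedWinding w n)) = 1 ∧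
      (x : UnitDisk) ∈ braidDisk e n (i / iteratedWinding w n) := by
    intro x n
    obtain ⟨s, hs, hxs⟩ := mem_iInter.mp x.2 n
    obtain ⟨i, -, his⟩ := exists_rot_div_of_zpow_eq_one (iteratedWinding_pos hw n) (η := rot s)
      (by rw [rot_zpow, hs])
    refine ⟨i, ?_, by rwa [← braidDisk_congr e n his]⟩
    rw [mul_div_iteratedWinding hw]
    simpa using rot_intCast i
  have hclopen : ∀ (n i : ℕ),
      IsClopen {x : C | (x : UnitDisk) ∈ braidDisk e n (i / iteratedWinding w n)} := by
    intro n i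
    have hcl : ∀ i : ℕ,
        IsClosed {x : C | (x : UnitDisk) ∈ braidDisk e n (i / iteratedWinding w n)} := fun i ↦
      (isCompact_braidDisk he n _).isClosed.preimage continuous_subtype_val
    refine ⟨hcl i, ?_⟩
    have h1 : {x : C | (x : UnitDisk) ∈ braidDisk e n (i / iteratedWinding w n)}ᶜ =
        ⋃ j ∈ (Finset.range (iteratedWinding w n).toNat).filter
          fun j : ℕ ↦ rot (j / iteratedWinding w n) ≠ rot (i / iteratedWinding w n),
          {x : C | (x : UnitDisk) ∈ braidDisk e n (j / iteratedWinding w n)} := by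
      ext x
      simp only [mem_compl_iff, mem_ofPred_eq, mem_iUnion, Finset.mem_filter, exists_prop,
        Finset.mem_range]
      constructor
      · intro hx
        have h2 := mem_iInter.mp x.2 n
        rw [braidDisks_eq_iUnion hw] at h2
        simp only [mem_iUnion, Finset.mem_range, exists_prop] at h2
        obtain ⟨j, hj, hxj⟩ := h2
        exact ⟨j, ⟨hj, fun h ↦ hx (by rwa [← braidDisk_congr e n h])⟩, hxj⟩
      · rintro ⟨j, ⟨-, hj⟩, hxj⟩ hxi
        refine hj (rot_eq_rot_of_mem_braidDisk he ?_ hxj hxi)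
        rw [mul_div_iteratedWinding hw, mul_div_iteratedWinding hw]
        simpa using (rot_intCast j).trans (rot_intCast i).symm
    rw [← isClosed_compl_iff, h1]
    exact isClosed_biUnion_finset fun j _ ↦ hcl j
  refine nonempty_homeomorph_nat_bool
    (fun j ↦ {x : C | (x : UnitDisk) ∈
      braidDisk e j.unpair.1 (j.unpair.2 / iteratedWinding w j.unpair.1)})
    (fun j ↦ hclopen _ _) (fun x y hxy ↦ ?_) (fun V hV hVne ↦ ?_)
  · obtain ⟨n, hn⟩ := dist_le_of_mem_braidDisk hdiam (dist_pos.mpr hxy)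
    obtain ⟨i, -, hi⟩ := hCmem x n
    refine ⟨Nat.pair n i, by simpa using hi, fun hy ↦ ?_⟩
    simp only [mem_ofPred_eq, Nat.unpair_pair] at hy
    exact (hn n le_rfl _ _ hi _ hy).ne rfl
  · obtain ⟨x, hx⟩ := hVne
    obtain ⟨ε, hε, hball⟩ := Metric.isOpen_iff.mp hV.isOpen x hx
    obtain ⟨n, hn⟩ := dist_le_of_mem_braidDisk hdiam hε
    obtain ⟨i, hi1, hi⟩ := hCmem x n
    set s : ℝ := i / iteratedWinding w n with hs
    have hw0 : (0 : ℝ) < w n := by exact_mod_cast zero_lt_one.trans (hw n)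
    -- two of the disks of the next generation in the disk of `x`
    have hsub : ∀ a : ℤ, rot (iteratedWinding w (n + 1) * ((s + a) / w n)) = 1 ∧
        ∃ y : C, (y : UnitDisk) ∈ braidDisk e (n + 1) ((s + a) / w n) ∧ y ∈ V := by
      intro a
      have h1 : rot (iteratedWinding w (n + 1) * ((s + a) / w n)) = 1 := by
        rw [iteratedWinding_succ, Int.cast_mul, mul_assoc, mul_div_cancel₀ _ hw0.ne', mul_add,
          rot_add, hi1, one_mul]
        exact_mod_cast rot_intCast _
      obtain ⟨y, hy, hyC⟩ := exists_mem_braidDisk_inter hw he (n + 1) h1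
      refine ⟨h1, ⟨y, hyC⟩, hy, hball ?_⟩
      have h2 := braidDisk_succ_subset he n _ hy
      rw [mul_div_cancel₀ _ hw0.ne', braidDisk_congr e n (rot_eq_rot_iff.mpr ⟨a, rfl⟩)] at h2
      exact hn n le_rfl _ _ h2 _ hi
    obtain ⟨h0, y, hy, hyV⟩ := hsub 0
    obtain ⟨h1, y', hy', hyV'⟩ := hsub 1
    refine ⟨y, hyV, y', hyV', ?_⟩
    rintro rfl
    have h2 := rot_eq_rot_of_mem_braidDisk he (h1.trans h0.symm) hy' hy
    obtain ⟨l, hl⟩ := rot_eq_rot_iff.mp h2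
    have h3 : (1 : ℝ) = l * w n := by
      field_simp at hl
      push_cast at hl
      linarith
    have h4 : (1 : ℤ) = l * w n := by exact_mod_cast h3
    have h5 := Int.le_of_dvd one_pos (Dvd.intro_left l h4.symm)
    exact (hw n).not_ge h5

lemma cyclicallyPermutesDisks_braidDisks (hw : ∀ n, 1 < w n) (he : ∀ n, IsThickBraid (e n) (w n))
    (n : ℕ) {f : UnitDisk ≃ₜ UnitDisk}
    (hf : ∀ s : ℝ, rot (iteratedWinding w n * s) = 1 →
      f '' braidDisk e n s = braidDisk e n (s + 1 / iteratedWinding w n)) :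
    CyclicallyPermutesDisks f (braidDisks e w n) := by
  obtain ⟨k, hk⟩ := Int.eq_ofNat_of_zero_le (iteratedWinding_pos hw n).le
  have hk0 : 0 < k := by exact_mod_cast hk ▸ iteratedWinding_pos hw n
  have hkR : (0 : ℝ) < k := by exact_mod_cast hk0
  have : NeZero k := ⟨hk0.ne'⟩
  rw [hk, Int.cast_natCast] at hf
  have hone : ∀ i : ℕ, rot (k * (i / k)) = 1 := fun i ↦ by
    rw [mul_div_cancel₀ _ hkR.ne']
    simpa using rot_intCast i
  refine ⟨k, fun i ↦ braidDisk e n (i.val / k), hk0, fun i ↦ ?_, fun i j hij ↦ ?_, ?_, fun i ↦ ?_⟩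
  · exact ⟨(isEmbedding_braidDisk he n _).toHomeomorph.symm⟩
  · refine Set.disjoint_left.mpr fun x hxi hxj ↦ ?_
    have h1 := rot_eq_rot_of_mem_braidDisk he (by
      rw [hk, Int.cast_natCast, hone, hone]) hxi hxj
    have h2 := rot_add_div_injective (w := k) 0 (a₁ := ⟨i.val, i.val_lt⟩) (a₂ := ⟨j.val, j.val_lt⟩)
      (by simpa using h1)
    exact hij (ZMod.val_injective k (Fin.mk.inj_iff.mp h2))
  · rw [braidDisks_eq_iUnion hw, hk]
    refine Subset.antisymm (iUnion₂_subset fun i hi ↦ ?_) (iUnion_subset fun i ↦ ?_)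
    · refine subset_iUnion_of_subset (i : ZMod k) ?_
      rw [ZMod.val_cast_of_lt (by simpa using hi), Int.cast_natCast]
    · rw [← Int.cast_natCast (R := ℝ) k]
      exact subset_iUnion₂_of_subset i.val (by simpa using i.val_lt) Subset.rfl
  · rw [hf _ (hone _)]
    refine braidDisk_congr e n (rot_eq_rot_iff.mpr ?_)
    have h1 : (((i.val : ℤ) + 1 : ℤ) : ZMod k) = (((i + 1).val : ℤ) : ZMod k) := by simp
    obtain ⟨l, hl⟩ := (ZMod.intCast_eq_intCast_iff_dvd_sub _ _ _).mp h1.symm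
    have h2 : (i.val : ℝ) + 1 - (i + 1).val = k * l := by exact_mod_cast hl
    refine ⟨l, ?_⟩
    field_simp
    linarith

end disks

/-- A standard solenoid is, in the solid torus, the suspension of a homeomorphism of a Cantor set in
the disk which factors through nested disks. -/
theorem IsStandardSolenoid.exists_mappingTorus {S : Set SolidTorus} (hS : IsStandardSolenoid S) :
    ∃ (C : Set UnitDisk) (f : UnitDisk ≃ₜ UnitDisk), IsCantorSet C ∧ f '' C = C ∧
      FactorsThroughNestedDisks f C ∧ ∃ h : MappingTorus f ≃ₜ SolidTorus,
        h '' mappingTorusOf f C = S := by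
  obtain ⟨e, w, hwe, hext, hdiam, rfl⟩ := hS.exists_extendable
  have hw := fun n ↦ (hwe n).1
  have he := fun n ↦ (hwe n).2
  obtain ⟨F, hF, hmove⟩ := exists_isotopy_of_braids hw he hext hdiam
  obtain ⟨h, hh⟩ := exists_homeomorph_mappingTorus (f := F 1) hF.continuous hF.zero fun _ ↦ rfl
  have hiff : ∀ n, ∀ t ∈ Icc (0 : ℝ) 1, ∀ x,
      (F t x, rot t) ∈ range (iteratedBraid e n) ↔ x ∈ braidDisks e w n := by
    intro n t ht x
    rw [mem_range_iteratedBraid_iff he]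
    have hW := mul_div_iteratedWinding hw n t
    constructor
    · rintro ⟨s, hs, hxs⟩
      have h1 : rot (iteratedWinding w n * (s - t / iteratedWinding w n)) = 1 := by
        rw [mul_sub, hW, sub_eq_add_neg, rot_add, rot_neg, hs, mul_inv_cancel]
      refine ⟨_, h1, ?_⟩
      have h2 := hmove n t ht _ h1
      rw [sub_add_cancel] at h2
      rwa [← h2, (F t).injective.mem_set_image] at hxs
    · rintro ⟨s, hs, hxs⟩
      refine ⟨s + t / iteratedWinding w n, by rw [mul_add, hW, rot_add, hs, one_mul], ?_⟩
      rw [← hmove n t ht s hs]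
      exact mem_image_of_mem _ hxs
  have hF1 : ∀ n x, F 1 x ∈ braidDisks e w n ↔ x ∈ braidDisks e w n := fun n x ↦ by
    have h0 := hiff n 0 ⟨le_rfl, zero_le_one⟩ (F 1 x)
    have h1 := hiff n 1 ⟨zero_le_one, le_rfl⟩ x
    rw [hF.zero, rot_zero] at h0
    rw [rot_one] at h1
    exact h0.symm.trans h1
  refine ⟨⋂ n, braidDisks e w n, F 1, isCantorSet_iInter_braidDisks hw he hdiam, ?_,
    ⟨?_, braidDisks e w, fun n x hx ↦ mem_interior_braidDisks he hx, rfl, fun n ↦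
      cyclicallyPermutesDisks_braidDisks hw he n
        (hmove n 1 ⟨zero_le_one, le_rfl⟩)⟩, h, ?_⟩
  · have h1 : F 1 ⁻¹' (⋂ n, braidDisks e w n) = ⋂ n, braidDisks e w n := by
      ext x
      simp only [mem_preimage, mem_iInter, hF1]
    conv_lhs => rw [← h1]
    exact (F 1).surjective.image_preimage _
  · refine ⟨id, ⟨id, continuous_id, fun _ ↦ rfl, fun t ↦ by simp⟩, fun z ↦ ?_⟩
    exact hF.boundary 1 _ (Circle.norm_coe z)
  · ext ⟨y, z⟩
    constructor
    · rintro ⟨_, ⟨⟨x, t⟩, ⟨hx, -⟩, rfl⟩, hxy⟩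
      rw [hh] at hxy
      rw [← hxy]
      exact mem_iInter.mpr fun n ↦ (hiff n t t.2 x).mpr (mem_iInter.mp hx n)
    · intro hy
      obtain ⟨t, ht, rfl⟩ := exists_mem_Ico_rot_eq z
      have ht' : t ∈ Icc (0 : ℝ) 1 := ⟨ht.1, ht.2.le⟩
      refine ⟨_, ⟨((F t).symm y, ⟨t, ht'⟩), ⟨mem_iInter.mpr fun n ↦ (hiff n t ht' _).mp ?_,
        mem_univ _⟩, rfl⟩, ?_⟩
      · rw [Homeomorph.apply_symm_apply]
        exact mem_iInter.mp hy n
      · rw [hh, Homeomorph.apply_symm_apply]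

/-! ### Solid tori in the 3-sphere -/

/-- The image of an interior point of an embedded solid torus in the sphere is an interior point, by
invariance of domain in a chart of the sphere. -/
lemma range_mem_nhds_of_isEmbedding {j : SolidTorus → Sphere3} (hj : IsEmbedding j)
    {p : SolidTorus} (hp : ‖(p.1 : ℂ)‖ < 1) : range j ∈ 𝓝 (j p) := by
  have : Fact (Module.finrank ℝ (EuclideanSpace ℝ (Fin 4)) = 3 + 1) := ⟨by simp⟩
  obtain ⟨x, z⟩ := p
  obtain ⟨t, rfl⟩ := exists_rot_eq z
  let φ := chartAt (EuclideanSpace ℝ (Fin 3)) (j (x, rot t))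
  let g : ℝ × ℂ → Sphere3 := fun q ↦ j (toDisk q.2, rot q.1)
  have hg : Continuous g := hj.continuous.comp
    ((continuous_toDisk.comp continuous_snd).prodMk (continuous_rot.comp continuous_fst))
  let U : Set (ℝ × ℂ) := (Metric.ball t (1 / 2) ×ˢ Metric.ball 0 1) ∩ g ⁻¹' φ.source
  have hU : IsOpen U :=
    (Metric.isOpen_ball.prod Metric.isOpen_ball).inter (φ.open_source.preimage hg)
  have hginj : InjOn g U := by
    rintro ⟨s, y⟩ ⟨⟨hs, hy⟩, -⟩ ⟨s', y'⟩ ⟨⟨hs', hy'⟩, -⟩ h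
    have h1 := hj.injective h
    rw [Prod.mk.injEq] at h1
    simp only [mem_ball_zero_iff] at hy hy'
    have h2 := congrArg Subtype.val h1.1
    simp only [coe_toDisk hy.le, coe_toDisk hy'.le] at h2
    obtain ⟨n, hn⟩ := rot_eq_rot_iff.mp h1.2
    simp only [Metric.mem_ball, Real.dist_eq, abs_lt] at hs hs' hn
    have h3 : (n : ℝ) < 1 := by linarith [hs.2, hs'.1]
    have h4 : (-1 : ℝ) < n := by linarith [hs.1, hs'.2]
    have h5 : n < 1 := by exact_mod_cast h3
    have h6 : -1 < n := by exact_mod_cast h4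
    obtain rfl : n = 0 := by omega
    exact Prod.ext (by simpa using hn) h2
  have hV : IsOpen ((φ ∘ g) '' U) := by
    refine isOpen_image_of_injOn (by simp) (by simp) hU
      (φ.continuousOn.comp hg.continuousOn fun q hq ↦ hq.2) ?_
    exact φ.injOn.comp hginj fun q hq ↦ hq.2
  have hopen : IsOpen (g '' U) := by
    have h1 : g '' U = φ.source ∩ φ ⁻¹' ((φ ∘ g) '' U) := by
      ext y
      constructor
      · rintro ⟨q, hq, rfl⟩
        exact ⟨hq.2, q, hq, rfl⟩
      · rintro ⟨hy, q, hq, hqy⟩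
        exact ⟨q, hq, φ.injOn hq.2 hy hqy⟩
    rw [h1]
    exact φ.isOpen_inter_preimage hV
  refine mem_of_superset (hopen.mem_nhds ⟨(t, x), ⟨⟨?_, ?_⟩, ?_⟩, ?_⟩) ?_
  · exact Metric.mem_ball_self (by norm_num)
  · simpa using hp
  · simp only [mem_preimage, g, toDisk_coe]
    exact mem_chart_source _ _
  · simp only [g, toDisk_coe]
  · rintro _ ⟨q, -, rfl⟩
    exact mem_range_self _

lemma IsStandardSolenoid.norm_lt_one {S : Set SolidTorus} (hS : IsStandardSolenoid S)
    {p : SolidTorus} (hp : p ∈ S) : ‖(p.1 : ℂ)‖ < 1 := by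
  obtain ⟨e, w, he, -, rfl⟩ := hS
  obtain ⟨q, rfl⟩ := mem_iInter.mp hp 1
  exact (he 0).2.mem_interior q

/-- A tame solenoid has a neighbourhood of the shape of a mapping torus. -/
theorem IsTame.exists_mappingTorus {S : Set Sphere3} (hS : IsTame S) :
    ∃ N ∈ 𝓝ˢ S, ∃ (C : Set UnitDisk) (f : UnitDisk ≃ₜ UnitDisk),
      IsCantorSet C ∧ f '' C = C ∧ FactorsThroughNestedDisks f C ∧
        PairHomeomorphic ((↑) ⁻¹' S : Set N) (mappingTorusOf f C) := by
  obtain ⟨ι, T, hι, ⟨S', hS', φ, hφ⟩, rfl⟩ := hS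
  obtain ⟨C, f, hC, hfC, hf, h, hh⟩ := hS'.exists_mappingTorus
  have hj : IsEmbedding (ι ∘ φ.symm) := hι.comp φ.symm.isEmbedding
  refine ⟨range (ι ∘ φ.symm), ?_, C, f, hC, hfC, hf, hj.toHomeomorph.symm.trans h.symm, ?_⟩
  · rw [mem_nhdsSet_iff_forall]
    rintro _ ⟨p, hp, rfl⟩
    have h1 := range_mem_nhds_of_isEmbedding hj (p := φ p)
      (hS'.norm_lt_one (hφ ▸ mem_image_of_mem _ hp))
    rwa [Function.comp_apply, Homeomorph.symm_apply_apply] at h1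
  · have h1 : ((↑) ⁻¹' (ι '' T) : Set (range (ι ∘ φ.symm))) = hj.toHomeomorph '' S' := by
      ext y
      obtain ⟨p, rfl⟩ := hj.toHomeomorph.surjective y
      rw [hj.toHomeomorph.injective.mem_set_image, ← hφ]
      change ι (φ.symm p) ∈ ι '' T ↔ _
      rw [hι.injective.mem_set_image]
      constructor
      · intro h3
        exact ⟨_, h3, φ.apply_symm_apply p⟩
      · rintro ⟨q, hq, rfl⟩
        rwa [Homeomorph.symm_apply_apply]
    rw [h1, ← hh, ← image_comp, ← image_comp]
    convert image_id _ using 2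
    funext q
    simp

theorem mainTheorem5 (S : Set Sphere3) (hS : IsSolenoid S) :
    IsTame S ↔
      ∃ N ∈ 𝓝ˢ S, ∃ (C : Set UnitDisk) (f : UnitDisk ≃ₜ UnitDisk),
        IsCantorSet C ∧ f '' C = C ∧ FactorsThroughNestedDisks f C ∧
          PairHomeomorphic ((↑) ⁻¹' S : Set N) (mappingTorusOf f C) := by
  refine ⟨fun h ↦ h.exists_mappingTorus, ?_⟩
  rintro ⟨N, hN, C, f, hC, -, hf, h⟩
  exact isTame_of_mappingTorus (subset_of_mem_nhdsSet hN) hC hf h
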